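/- **Notation.** Let $S_m$ be the space of complex binary forms of order $m$ in $x_1,x_2$ (i.e. homogeneous polynomials of degree $m$), with the action of $SL_2=SL_2(\mathbf C)$ by linear substitution. Let $R=\mathbf C[a_0,\dots,a_5]=\mathrm{Sym}(S_5^*)$, graded with $\deg a_i=1$, with the induced action of $SL_2$; let $\mathbb F=\sum_{i=0}^5\binom5i a_i x_1^{5-i}x_2^i$ be the generic binary quintic, and $\mathbf P^5=\mathbf P S_5=\mathrm{Proj}\,R$. For forms $A,B$ of orders $m,n$ and $0\le r\le\min(m,n)$, the $r$-th transvectant is $$(A,B)_r=\frac{(m-r)!\,(n-r)!}{m!\,n!}\sum_{i=0}^r(-1)^i\binom ri\frac{\partial^rA}{\partial x_1^{r-i}\partial x_2^i}\,\frac{\partial^rB}{\partial x_1^i\partial x_2^{r-i}} .$$ The Wronskian of $m$ binary forms $A_1,\dots,A_m$ of the same order is $\det\bigl(\partial^{m-1}A_i/\partial x_1^{m-j}\partial x_2^{j-1}\bigr)_{1\le i,j\le m}$. Put $$\vartheta_{22}=(\mathbb F,\mathbb F)_4,\quad \vartheta_{26}=(\mathbb F,\mathbb F)_2,\quad \vartheta_{33}=(\vartheta_{22},\mathbb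 F)_2,\quad \vartheta_{40}=(\vartheta_{22},\vartheta_{22})_2,\quad \vartheta_{51}=(\vartheta_{22}^2,\mathbb F)_4,\quad \vartheta_{80}=(\vartheta_{22}^3,\vartheta_{26})_6 .$$ For $\tau=(\alpha,\beta,\gamma)\in\mathbf Q^3$ let $\mathcal U=\vartheta_{33}\vartheta_{22}-\alpha\,\vartheta_{40}\mathbb F$ and $\mathcal V=\vartheta_{51}\vartheta_{22}^2-\beta\,\vartheta_{40}^2\mathbb F-\gamma\,\vartheta_{80}\mathbb F$, and define $$\sigma_\tau(\mathbb F):\ S_2\oplus S_0\oplus S_0\to R\otimes S_5,\qquad (A,c_1,c_2)\mapsto (A,\mathbb F)_1+c_1\,\mathcal U+c_2\,\mathcal V .$$ Let $\Gamma_\tau$ be the Wronskian of the images under $\sigma_\tau(\mathbb F)$ of the basis $x_1^2,\ x_1x_2,\ x_2^2$ of $S_2$ and the basis vectors $1,\ 1$ of the two copies of $S_0$; let $\mathfrak b_\tau\subseteq R$ be the ideal generated by the coefficients of $\Gamma_\tau$ (as a form in $x_1,x_2$), and $V(\mathfrak b_\tau)\subseteq\mathbf P^5$ its zero locus. Finally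 let $\mathcal B\subseteq\mathbf P^5$ be the union of the $SL_2$-orbits of the six points represented by $$x_1^5+x_2^5,\quad x_1x_2(x_1-x_2)(x_1^2+x_1x_2+x_2^2),\quad x_1^3x_2(x_1+x_2),\quad x_1^3x_2^2,\quad x_1^4x_2,\quad x_1^5 .$$ **Theorem.** Let $\tau\in\mathbf Q^3$. 1. The ideal $\mathfrak b_\tau$ is perfect of height two (that is, it has height two and the projective dimension of $R/\mathfrak b_\tau$ equals the grade of $\mathfrak b_\tau$), and $R/\mathfrak b_\tau$ has an $SL_2$-equivariant graded minimal free resolution of the form $$0\leftarrow R/\mathfrak b_\tau\leftarrow R\leftarrow R(-17)\otimes S_5\leftarrow \bigl(R(-18)\otimes S_2\bigr)\oplus R(-22)\oplus R(-26)\leftarrow 0 .$$ 2. There is an inclusion $\mathcal B\subseteq V(\mathfrak b_\tau)$, and $\mathcal B=V(\mathfrak b_\tau)$ if and only if $\tau$ is one of the triples $$(0,0,0),\qquad \left(\tfrac25,\tfrac{14}{75},-\tfrac25\right),\qquad \left(\tfrac16,\tfrac2{45},-\tfrac13\right).$$ -/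

import Mathlib

noncomputable section

namespace Quintic

open MvPolynomial

/-! ## Binary forms, transvectants, Wronskians -/

/-- Binary forms of order `m` with coefficients in `A`, in the variables `x₁ = X 0`, `x₂ = X 1`.
For `A = ℂ` this is `S_m = Sym^m V`, and for a `ℂ`-algebra `A` it is `A ⊗ S_m`. -/
abbrev BinaryForm (A : Type) [CommRing A] (m : ℕ) : Submodule A (MvPolynomial (Fin 2) A) :=
  homogeneousSubmodule (Fin 2) A m

/-- The exponent of `x₁ ^ i * x₂ ^ j`. -/
def expo (i j : ℕ) : Fin 2 →₀ ℕ := Finsupp.single 0 i + Finsupp.single 1 j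

/-- The iterated partial derivative `∂^(i+j) / ∂x₁^i ∂x₂^j`. -/
def partialD {A : Type} [CommRing A] (i j : ℕ) (G : MvPolynomial (Fin 2) A) :
    MvPolynomial (Fin 2) A :=
  (pderiv 0)^[i] ((pderiv 1)^[j] G)

/-- The `r`-th transvectant `(G, H)_r` of a form `G` of order `m` and a form `H` of order `n`. -/
def transvectant {A : Type} [CommRing A] [Algebra ℚ A] (m n r : ℕ)
    (G H : MvPolynomial (Fin 2) A) : MvPolynomial (Fin 2) A :=
  if r ≤ min m n then
    (((m - r).factorial * (n - r).factorial : ℚ) / (m.factorial * n.factorial : ℚ)) •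
      ∑ i ∈ Finset.range (r + 1),
        ((-1 : ℚ) ^ i * (r.choose i : ℚ)) • (partialD (r - i) i G * partialD i (r - i) H)
  else 0

/-- The Wronskian of `A_1, …, A_m`: the determinant of the matrix with `(i,j)` entry
`∂^(m-1) A_i / ∂x₁^(m-j) ∂x₂^(j-1)` (indices `1 ≤ i, j ≤ m`, here shifted to start from `0`). -/
def wronskian {A : Type} [CommRing A] {m : ℕ} (G : Fin m → MvPolynomial (Fin 2) A) :
    MvPolynomial (Fin 2) A :=
  Matrix.det (Matrix.of fun i j : Fin m => partialD (m - 1 - (j : ℕ)) (j : ℕ) (G i))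

/-! ## Covariants of a quintic `F` -/

section Covariants

variable {A : Type} [CommRing A] [Algebra ℚ A] (F : MvPolynomial (Fin 2) A)

/-- `ϑ₂₂ = (F, F)_4`. -/
def theta22 : MvPolynomial (Fin 2) A := transvectant 5 5 4 F F

/-- `ϑ₂₆ = (F, F)_2`. -/
def theta26 : MvPolynomial (Fin 2) A := transvectant 5 5 2 F F

/-- `ϑ₃₃ = (ϑ₂₂, F)_2`. -/
def theta33 : MvPolynomial (Fin 2) A := transvectant 2 5 2 (theta22 F) F

/-- `ϑ₄₀ = (ϑ₂₂, ϑ₂₂)_2`. -/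
def theta40 : MvPolynomial (Fin 2) A := transvectant 2 2 2 (theta22 F) (theta22 F)

/-- `ϑ₅₁ = (ϑ₂₂², F)_4`. -/
def theta51 : MvPolynomial (Fin 2) A := transvectant 4 5 4 (theta22 F ^ 2) F

/-- `ϑ₈₀ = (ϑ₂₂³, ϑ₂₆)_6`. -/
def theta80 : MvPolynomial (Fin 2) A := transvectant 6 6 6 (theta22 F ^ 3) (theta26 F)

/-- `𝒰 = ϑ₃₃ ϑ₂₂ - α ϑ₄₀ F`. -/
def covU (α : ℚ) : MvPolynomial (Fin 2) A :=
  theta33 F * theta22 F - α • (theta40 F * F)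

/-- `𝒱 = ϑ₅₁ ϑ₂₂² - β ϑ₄₀² F - γ ϑ₈₀ F`. -/
def covV (β γ : ℚ) : MvPolynomial (Fin 2) A :=
  theta51 F * theta22 F ^ 2 - β • (theta40 F ^ 2 * F) - γ • (theta80 F * F)

/-- `σ_τ(F) : S_2 ⊕ S_0 ⊕ S_0 → S_5`, `(G, c₁, c₂) ↦ (G, F)_1 + c₁ 𝒰 + c₂ 𝒱`,
where `τ = (α, β, γ)`. -/
def sigma (τ : ℚ × ℚ × ℚ) (G c₁ c₂ : MvPolynomial (Fin 2) A) : MvPolynomial (Fin 2) A :=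
  transvectant 2 5 1 G F + c₁ * covU F τ.1 + c₂ * covV F τ.2.1 τ.2.2

/-- The Wronskian of the map `σ_τ(F)`, i.e. of the images of the basis
`x₁², x₁x₂, x₂²; 1; 1` of `S_2 ⊕ S_0 ⊕ S_0`. -/
def Gam (τ : ℚ × ℚ × ℚ) : MvPolynomial (Fin 2) A :=
  wronskian ![sigma F τ (X 0 ^ 2) 0 0, sigma F τ (X 0 * X 1) 0 0, sigma F τ (X 1 ^ 2) 0 0,
    sigma F τ 0 1 0, sigma F τ 0 0 1]

end Covariants

/-! ## The generic quintic and the ideal `𝔟_τ` -/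

/-- `R = ℂ[a₀, …, a₅]`, the coordinate ring of the space of binary quintics. -/
abbrev R : Type := MvPolynomial (Fin 6) ℂ

/-- The generic quintic `𝔽 = ∑ binom(5,i) a_i x₁^(5-i) x₂^i`. -/
def genericQuintic : MvPolynomial (Fin 2) R :=
  ∑ i : Fin 6, monomial (expo (5 - (i : ℕ)) (i : ℕ)) ((Nat.choose 5 i : R) * X i)

/-- The `i`-th coordinate `a_i` of the quintic `∑ binom(5,i) a_i x₁^(5-i) x₂^i`. -/
def quinticCoord {A : Type} [CommRing A] [Algebra ℚ A] (G : MvPolynomial (Fin 2) A)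
    (i : Fin 6) : A :=
  ((Nat.choose 5 i : ℚ)⁻¹) • coeff (expo (5 - (i : ℕ)) (i : ℕ)) G

/-- `𝔟_τ ⊆ R`, the ideal generated by the coefficients of `Γ_τ`, the Wronskian of `σ_τ(𝔽)`. -/
def idealB (τ : ℚ × ℚ × ℚ) : Ideal R :=
  Ideal.span (Set.range fun e : Fin 2 →₀ ℕ => coeff e (Gam genericQuintic τ))

/-! ## The action of `SL₂(ℂ)` -/

/-- `SL₂(ℂ)`. -/
abbrev SL2 : Type := Matrix.SpecialLinearGroup (Fin 2) ℂ

/-- The action of `g` on the variables, `x_j ↦ ∑ i, g i j • x_i`. For `A = ℂ` this is the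
action of `SL₂` on binary forms. -/
def subst {A : Type} [CommRing A] [Algebra ℂ A] (g : SL2) :
    MvPolynomial (Fin 2) A →ₐ[A] MvPolynomial (Fin 2) A :=
  aeval fun j => ∑ i : Fin 2, C (algebraMap ℂ A (g i j)) * X i

/-- The action of `g` on `R = Sym(S_5^*)`, i.e. `(g • φ)(F) = φ(g⁻¹ • F)`. -/
def actR (g : SL2) : R →ₐ[ℂ] R :=
  aeval fun i => quinticCoord (subst g⁻¹ genericQuintic) i

/-- The diagonal action of `g` on forms with coefficients in `R`, i.e. on `R ⊗ S_m`. -/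
def actPoly (g : SL2) (G : MvPolynomial (Fin 2) R) : MvPolynomial (Fin 2) R :=
  subst g (map (actR g : R →+* R) G)

theorem actPoly_mem (g : SL2) {m : ℕ} {G : MvPolynomial (Fin 2) R} (hG : G ∈ BinaryForm R m) :
    actPoly g G ∈ BinaryForm R m := by
  have h1 : (map (actR g : R →+* R) G).IsHomogeneous m :=
    IsHomogeneous.map ((mem_homogeneousSubmodule m G).1 hG) _
  have h2 : ∀ j : Fin 2,
      (∑ i : Fin 2, C (algebraMap ℂ R (g i j)) * X i : MvPolynomial (Fin 2) R).IsHomogeneous 1 :=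
    fun j => IsHomogeneous.sum _ _ _ fun i _ => isHomogeneous_C_mul_X _ i
  have h3 := h1.aeval _ h2
  rw [one_mul] at h3
  exact (mem_homogeneousSubmodule m _).2 h3

/-- The diagonal action of `g` on `R ⊗ S_m`. -/
def act (g : SL2) {m : ℕ} (G : BinaryForm R m) : BinaryForm R m :=
  ⟨actPoly g G, actPoly_mem g G.2⟩

/-! ## Perfect ideals and graded equivariant minimal resolutions -/

/-- The grade of an ideal: the supremum of the lengths of the regular sequences contained in it. -/
def grade {A : Type} [CommRing A] (I : Ideal A) : ℕ∞ :=
  ⨆ (rs : List A) (_ : RingTheory.Sequence.IsRegular A rs ∧ ∀ r ∈ rs, r ∈ I), (rs.length : ℕ∞)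

/-- `I` is perfect if the projective dimension of `A ⧸ I` equals the grade of `I`. -/
def IsPerfect {A : Type} [CommRing A] (I : Ideal A) : Prop :=
  CategoryTheory.projectiveDimension (ModuleCat.of A (A ⧸ I)) = ((grade I : ℕ∞) : WithBot ℕ∞)

/-- `G` lies in the degree `n` component of the graded `R`-module `R(-s) ⊗ S_m`: the coefficients
of `G` are homogeneous of degree `n - s` (and `G = 0` if `n < s`). -/
def InDegree (s n : ℕ) {m : ℕ} (G : BinaryForm R m) : Prop :=
  if s ≤ n then ∀ e : Fin 2 →₀ ℕ, (coeff e (G : MvPolynomial (Fin 2) R)).IsHomogeneous (n - s)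
  else G = 0

/-- The irrelevant maximal ideal `(a₀, …, a₅)` of `R`. -/
def irrelevant : Ideal R := Ideal.span (Set.range X)

/-- The sequence
`0 ← R/I ← R ← R(-17) ⊗ S_5 ← R(-18) ⊗ S_2 ⊕ R(-22) ⊗ S_0 ⊕ R(-26) ⊗ S_0 ← 0`
given by `d₁`, `d₂` is an `SL₂`-equivariant minimal graded free resolution of `R/I`. -/
structure IsMinimalResolution (I : Ideal R) (d₁ : BinaryForm R 5 →ₗ[R] R)
    (d₂ : (BinaryForm R 2 × BinaryForm R 0 × BinaryForm R 0) →ₗ[R] BinaryForm R 5) : Prop where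
  /-- exactness at `R` -/
  range_d₁ : LinearMap.range d₁ = I
  /-- exactness at `R(-17) ⊗ S_5` -/
  exact : Function.Exact d₂ d₁
  /-- exactness at the last term -/
  injective_d₂ : Function.Injective d₂
  /-- `d₁` has degree zero -/
  graded_d₁ : ∀ (n : ℕ) (G : BinaryForm R 5), InDegree 17 n G → (d₁ G).IsHomogeneous n
  /-- `d₂` has degree zero -/
  graded_d₂ : ∀ (n : ℕ) (G : BinaryForm R 2) (c₁ c₂ : BinaryForm R 0),
    InDegree 18 n G → InDegree 22 n c₁ → InDegree 26 n c₂ → InDegree 17 n (d₂ (G, c₁, c₂))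
  /-- minimality -/
  minimal_d₁ : LinearMap.range d₁ ≤ irrelevant
  /-- minimality -/
  minimal_d₂ : LinearMap.range d₂ ≤ irrelevant • (⊤ : Submodule R (BinaryForm R 5))
  /-- `d₁` is equivariant -/
  equivariant_d₁ : ∀ (g : SL2) (G : BinaryForm R 5), d₁ (act g G) = actR g (d₁ G)
  /-- `d₂` is equivariant -/
  equivariant_d₂ : ∀ (g : SL2) (G : BinaryForm R 2) (c₁ c₂ : BinaryForm R 0),
    d₂ (act g G, act g c₁, act g c₂) = act g (d₂ (G, c₁, c₂))

/-! ## Subvarieties of `ℙ⁵ = ℙ S_5` -/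

/-- `ℙ⁵ = ℙ S_5`, the space of nonzero complex binary quintics up to scalars. -/
abbrev P5 : Type := Projectivization ℂ (BinaryForm ℂ 5)

/-- The subvariety of `ℙ⁵` defined by an ideal of `R`. -/
def zeroLocus (I : Ideal R) : Set P5 :=
  {p | ∀ (F : BinaryForm ℂ 5) (hF : F ≠ 0), Projectivization.mk ℂ F hF = p →
    ∀ f ∈ I, eval (quinticCoord (F : MvPolynomial (Fin 2) ℂ)) f = 0}

/-- The forms `U_(1), …, U_(6)`. -/
def formU : Fin 6 → MvPolynomial (Fin 2) ℂ :=
  ![X 0 ^ 5 + X 1 ^ 5,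
    X 0 * X 1 * (X 0 - X 1) * (X 0 ^ 2 + X 0 * X 1 + X 1 ^ 2),
    X 0 ^ 3 * X 1 * (X 0 + X 1),
    X 0 ^ 3 * X 1 ^ 2,
    X 0 ^ 4 * X 1,
    X 0 ^ 5]

/-- `ℬ ⊆ ℙ⁵`, the union of the `SL₂`-orbits of the points `[U_(1)], …, [U_(6)]`. -/
def locusB : Set P5 :=
  {p | ∃ (F : BinaryForm ℂ 5) (hF : F ≠ 0), Projectivization.mk ℂ F hF = p ∧
    ∃ (g : SL2) (i : Fin 6), (F : MvPolynomial (Fin 2) ℂ) = subst g (formU i)}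

end Quintic

end

/-!
# Perfect ideals of height two attached to binary quintics

The coefficients of `Γ_τ` are, up to the constant `120 ^ 5`, the maximal minors of the `5 × 6`
matrix `sigmaMat τ 𝔽` of `σ_τ(𝔽)` (`Gam_eq`, `idealB_eq`), so the asserted resolution is the
Hilbert–Burch complex of this matrix. Its maps are `σ_τ(𝔽)` and `G ↦ det (G, M)`. The degrees come
from those of the rows, and the equivariance from that of transvectants together with the fact
that `SL₂` has no nontrivial characters (`borderedDet_equivariant`). Exactness
(`exact_vecMul_borderedDet`), height and projective dimension only need two coprime elements in
`𝔟_τ`, and a bound for the height from above. The bound `height_idealB_le` holds because `𝔟_τ`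
vanishes on the four-dimensional cone of quintics with a triple root.

Coprimality (`exists_relPrime_idealB`) is shown for all `τ` at once. The greatest common divisor
`d` of `𝔟_τ` is unique up to constants and therefore spans a one-dimensional representation of
`SL₂`, so it is an invariant. It divides the invariant `det (𝔽, M)` of degree `18`, which does not
vanish at `x₁⁵ + 10 x₁² x₂³`. The monomials that contribute to the value at this quintic are the
`a₀^m a₃^n`, and the torus forces `n = 5 m`; hence the degree of `d` and that of its cofactor are
multiples of `6`. The value `6` is excluded, since the differential equations of invariants kill
the coefficient of `a₀ a₃⁵` (`coeff6_eq_zero`). As `d` divides minors of degree `17`, it is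
constant.

The zero locus of `𝔟_τ` consists of the quintics `F` for which `σ_τ(F)` is not injective
(`Dependent`, `mem_zeroLocus_iff`), a condition that is invariant under `GL₂`. On `ℬ` it can be
checked at the six forms: either `𝒰` and `𝒱` are both multiples of `F`, or `𝒱 = 0`.

For the equality `ℬ = V(𝔟_τ)`, the trinomials `s x₁⁵ + 10 x₁³x₂² + 5 x₁x₂⁴` are decisive. Such a
quintic is in the zero locus if and only if `(s - 1) (s + 15) P(s) = 0` for a quartic `P` whose
coefficients are affine in `τ` (`dependent_trinomial_iff`). On `ℬ` one of `ϑ₃₃` and `ϑ₅₁`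
vanishes, whereas for `s ≠ 1, -15` neither of them vanishes at the trinomial. So equality forces
`P` to be a quartic with all its roots in `{1, -15}`, and this singles out the three triples
(`eq_of_roots`). Conversely, let `τ` be one of these, and let `F` be in the zero locus. As `F` is
apolar to `ϑ₃₃`, a normal form of the cubic `ϑ₃₃` gives one of `F` (`inB_of_dependent`). If `ϑ₃₃`
is zero or has a triple root, then `F` lies in `ℬ` in any case. If it has a double root, then `F`
is not in the zero locus. If it has three distinct roots, then `F` is a sum of three fifth powers
of linear forms, which lies in the zero locus only if two of the summands can be exchanged by a
symmetry; then `F` is equivalent to a trinomial, and the condition on `P` leaves `s = -15`, a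
point of `ℬ`. -/

noncomputable section

namespace Quintic

open MvPolynomial Finset

set_option linter.unusedSectionVars false

/-! ### Binary forms with binomial coefficients -/

section Form
variable {A : Type} [CommRing A]

/-- The binary form `∑ binom(m, k) g_k x₁^(m-k) x₂^k`. Only the entries `g 0, …, g m` of the
sequence `g` matter; sequences indexed by all of `ℕ` make differentiation by `x₂` a shift of the
index. -/
def form (m : ℕ) (g : ℕ → A) : MvPolynomial (Fin 2) A :=
  ∑ k ∈ range (m + 1), monomial (expo (m - k) k) ((m.choose k : A) * g k)

theorem expo_apply_zero (i j : ℕ) : expo i j 0 = i := by simp [expo]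

theorem expo_apply_one (i j : ℕ) : expo i j 1 = j := by simp [expo]

theorem expo_inj {i j k l : ℕ} : expo i j = expo k l ↔ i = k ∧ j = l := by
  constructor
  · intro h
    exact ⟨by simpa [expo] using DFunLike.congr_fun h 0,
      by simpa [expo] using DFunLike.congr_fun h 1⟩
  · rintro ⟨rfl, rfl⟩; rfl

theorem monomial_expo (i j : ℕ) (c : A) :
    monomial (expo i j) c = C c * X 0 ^ i * X 1 ^ j := by
  rw [X_pow_eq_monomial, X_pow_eq_monomial, C_mul_monomial, monomial_mul, mul_one, mul_one]; rfl

theorem eq_expo (e : Fin 2 →₀ ℕ) : e = expo (e 0) (e 1) := by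
  ext i; fin_cases i <;> simp [expo]

theorem expo_add (i j k l : ℕ) : expo i j + expo k l = expo (i + k) (j + l) := by
  ext x; fin_cases x <;> simp [expo]

theorem degree_expo (i j : ℕ) : (expo i j).degree = i + j := by
  simp [expo, Finsupp.degree_eq_sum]

theorem pderiv_zero_monomial (a b : ℕ) (c : A) :
    pderiv 0 (monomial (expo a b) c) = monomial (expo (a - 1) b) (c * a) := by
  rw [pderiv_monomial, expo_apply_zero]
  congr 1
  congr 1
  ext x; fin_cases x <;> simp [expo]

theorem pderiv_one_monomial (a b : ℕ) (c : A) :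
    pderiv 1 (monomial (expo a b) c) = monomial (expo a (b - 1)) (c * b) := by
  rw [pderiv_monomial, expo_apply_one]
  congr 1
  congr 1
  ext x; fin_cases x <;> simp [expo]

theorem pderiv_zero_form (m : ℕ) (g : ℕ → A) :
    pderiv 0 (form (m + 1) g) = (m + 1) • form m g := by
  unfold form
  rw [map_sum, sum_range_succ, pderiv_zero_monomial, smul_sum]
  simp only [Nat.sub_self, Nat.cast_zero, mul_zero, monomial_zero, add_zero]
  refine sum_congr rfl fun k hk => ?_
  have hk' : k ≤ m := by simpa [Nat.lt_succ_iff] using hk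
  rw [pderiv_zero_monomial, show m + 1 - k - 1 = m - k by omega, ← map_nsmul]
  congr 1
  have := Nat.choose_mul_succ_eq m k
  have h2 : ((m + 1).choose k : A) * ((m + 1 - k : ℕ) : A) =
      (m.choose k : A) * ((m + 1 : ℕ) : A) := by
    simpa only [Nat.cast_mul] using (congrArg (Nat.cast : ℕ → A) this).symm
  rw [nsmul_eq_mul]
  linear_combination g k * h2

theorem pderiv_one_form (m : ℕ) (g : ℕ → A) :
    pderiv 1 (form (m + 1) g) = (m + 1) • form m (fun k => g (k + 1)) := by
  unfold form
  rw [map_sum, sum_range_succ', pderiv_one_monomial, smul_sum]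
  simp only [Nat.cast_zero, mul_zero, monomial_zero, add_zero]
  refine sum_congr rfl fun k hk => ?_
  rw [pderiv_one_monomial, show m + 1 - (k + 1) = m - k by omega, ← map_nsmul]
  congr 1
  have h2 : ((m + 1).choose (k + 1) : A) * ((k + 1 : ℕ) : A) =
      (m.choose k : A) * ((m + 1 : ℕ) : A) := by
    have h3 := Nat.add_one_mul_choose_eq m k
    rw [mul_comm (m + 1)] at h3
    simpa only [Nat.cast_mul] using (congrArg (Nat.cast : ℕ → A) h3).symm
  rw [nsmul_eq_mul]
  linear_combination g (k + 1) * h2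

/-- A partial derivative of a form only shifts its coefficient sequence, up to an integer factor. -/
theorem partialD_form (n i j : ℕ) (g : ℕ → A) :
    partialD i j (form (n + i + j) g) =
      ((n + i + j).descFactorial (i + j)) • form n (fun k => g (k + j)) := by
  have h1 : ∀ (j m : ℕ), (pderiv 1)^[j] (form (m + j) g) =
      ((m + j).descFactorial j) • form m (fun k => g (k + j)) := by
    intro j
    induction j with
    | zero => intro m; simp
    | succ j ih =>
      intro m
      rw [Function.iterate_succ_apply', show m + (j + 1) = m + 1 + j by ring, ih, map_nsmul,
        pderiv_one_form, smul_smul, Nat.descFactorial_succ, Nat.add_sub_cancel, mul_comm]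
      simp only [add_assoc, add_comm 1]
  have h2 : ∀ (i m : ℕ) (g : ℕ → A), (pderiv 0)^[i] (form (m + i) g) =
      ((m + i).descFactorial i) • form m g := by
    intro i
    induction i with
    | zero => intro m g; simp
    | succ j ih =>
      intro m g
      rw [Function.iterate_succ_apply', show m + (j + 1) = m + 1 + j by ring, ih, map_nsmul,
        pderiv_zero_form, smul_smul, Nat.descFactorial_succ, Nat.add_sub_cancel, mul_comm]
  have h3 : ∀ (i c : ℕ) (G : MvPolynomial (Fin 2) A),
      (pderiv 0)^[i] (c • G) = c • (pderiv 0)^[i] G := by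
    intro i c G
    induction i with
    | zero => rfl
    | succ i ih => rw [Function.iterate_succ_apply', Function.iterate_succ_apply', ih, map_nsmul]
  rw [partialD, h1, h3, h2, smul_smul]
  congr 1
  rw [add_comm i j, ← Nat.descFactorial_mul_descFactorial (le_add_right le_rfl : j ≤ j + i),
    mul_comm]
  simp

theorem form_isHomogeneous (m : ℕ) (g : ℕ → A) : (form m g).IsHomogeneous m := by
  refine IsHomogeneous.sum _ _ _ fun k hk => isHomogeneous_monomial _ ?_
  have : k < m + 1 := by simpa using hk
  rw [degree_expo]; omega

theorem coeff_form {m k : ℕ} (hk : k ≤ m) (g : ℕ → A) :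
    coeff (expo (m - k) k) (form m g) = (m.choose k : A) * g k := by
  rw [form, coeff_sum, sum_eq_single k]
  · simp
  · intro b _ hb
    rw [coeff_monomial, if_neg]
    rw [expo_inj]; tauto
  · intro h; simp at h; omega

theorem form_congr {m : ℕ} {g h : ℕ → A} (H : ∀ k ≤ m, g k = h k) : form m g = form m h := by
  refine sum_congr rfl fun k hk => ?_
  rw [H k (by simpa [Nat.lt_succ_iff] using hk)]

theorem form_add (m : ℕ) (g h : ℕ → A) : form m g + form m h = form m (g + h) := by
  simp [form, mul_add, sum_add_distrib]

theorem form_zero (m : ℕ) : form m (0 : ℕ → A) = 0 := by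
  simp [form]

theorem form_C_mul (m : ℕ) (c : A) (g : ℕ → A) : C c * form m g = form m (fun k => c * g k) := by
  rw [form, mul_sum]
  refine sum_congr rfl fun k _ => ?_
  rw [C_mul_monomial]; congr 1; ring

theorem form_map {B : Type} [CommRing B] (f : A →+* B) (m : ℕ) (g : ℕ → A) :
    map f (form m g) = form m (fun k => f (g k)) := by
  simp [form, map_monomial]

variable [Algebra ℚ A]

theorem choose_mul_inv_smul {m k : ℕ} (hk : k ≤ m) (x : A) :
    (m.choose k : A) * ((m.choose k : ℚ)⁻¹ • x) = x := by
  have h : (m.choose k : ℚ) ≠ 0 := by exact_mod_cast (Nat.choose_pos hk).ne'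
  rw [← nsmul_eq_mul, ← Nat.cast_smul_eq_nsmul ℚ, smul_smul, mul_inv_cancel₀ h, one_smul]

theorem choose_mul_cancel {m k : ℕ} (hk : k ≤ m) {x y : A}
    (h : (m.choose k : A) * x = (m.choose k : A) * y) : x = y := by
  have h0 : (m.choose k : ℚ) ≠ 0 := by exact_mod_cast (Nat.choose_pos hk).ne'
  have := congrArg (fun z => ((m.choose k : ℚ)⁻¹ • z)) h
  simpa only [← nsmul_eq_mul, ← Nat.cast_smul_eq_nsmul ℚ, smul_smul, inv_mul_cancel₀ h0,
    one_smul] using this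

theorem form_injective {m : ℕ} {g h : ℕ → A} (H : form m g = form m h) :
    ∀ k ≤ m, g k = h k := by
  intro k hk
  have := congrArg (coeff (expo (m - k) k)) H
  rw [coeff_form hk, coeff_form hk] at this
  exact choose_mul_cancel hk this

/-- The sequence `g` with `form m g = G`, for a form `G` of order `m`. -/
def coord (m : ℕ) (G : MvPolynomial (Fin 2) A) (k : ℕ) : A :=
  ((m.choose k : ℚ)⁻¹) • coeff (expo (m - k) k) G

theorem form_coord {m : ℕ} {G : MvPolynomial (Fin 2) A} (hG : G.IsHomogeneous m) :
    form m (coord m G) = G := by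
  ext e
  by_cases he : e.degree = m
  · have h1 : e = expo (m - e 1) (e 1) := by
      rw [eq_expo e, degree_expo] at he
      conv_lhs => rw [eq_expo e]
      rw [← he, Nat.add_sub_cancel]
    have h2 : e 1 ≤ m := by
      rw [eq_expo e, degree_expo] at he; omega
    rw [h1, coeff_form h2, coord, choose_mul_inv_smul h2]
  · rw [(form_isHomogeneous m _).coeff_eq_zero he, hG.coeff_eq_zero he]

theorem coord_form {m k : ℕ} (hk : k ≤ m) (g : ℕ → A) : coord m (form m g) k = g k :=
  form_injective (form_coord (form_isHomogeneous m g)) k hk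

/-- The coordinates of the product of `form m g` and `form n h`. -/
def conv (m n : ℕ) (g h : ℕ → A) (k : ℕ) : A :=
  (((m + n).choose k : ℚ)⁻¹) •
    ∑ i ∈ range (k + 1), (m.choose i : A) * (n.choose (k - i) : A) * g i * h (k - i)

theorem form_mul (m n : ℕ) (g h : ℕ → A) : form m g * form n h = form (m + n) (conv m n g h) := by
  rw [form, form, sum_mul_sum, ← sum_product']
  rw [← sum_fiberwise_of_maps_to (t := range (m + n + 1)) (g := fun p : ℕ × ℕ => p.1 + p.2)
    (by intro p hp; simp at hp ⊢; omega), form]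
  refine sum_congr rfl fun k hk => ?_
  have hk' : k ≤ m + n := by simpa [Nat.lt_succ_iff] using hk
  rw [conv, choose_mul_inv_smul hk', map_sum,
    ← Nat.sum_antidiagonal_eq_sum_range_succ (fun i j => monomial (expo (m + n - k) k)
      ((m.choose i : A) * (n.choose j : A) * g i * h j))]
  refine sum_subset_zero_on_sdiff ?_ ?_ ?_
  · intro p hp; simp at hp ⊢; omega
  · rintro ⟨i, j⟩ hp
    simp only [mem_sdiff, HasAntidiagonal.mem_antidiagonal, mem_filter, mem_product,
      mem_range] at hp
    by_cases hi : m < i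
    · simp [Nat.choose_eq_zero_of_lt hi]
    · have hj : n < j := by by_contra hj; apply hp.2; omega
      simp [Nat.choose_eq_zero_of_lt hj]
  · rintro ⟨i, j⟩ hp
    simp only [mem_filter, mem_product, mem_range] at hp
    rw [monomial_mul, expo_add, show m - i + (n - j) = m + n - k by omega, hp.2]
    congr 1; ring

end Form

/-! ### Transvectants -/

section Transvectant
variable {A : Type} [CommRing A] [Algebra ℚ A]

/-- The transvectant without its normalising factor, defined for all polynomials. -/
def omega (r : ℕ) (G H : MvPolynomial (Fin 2) A) : MvPolynomial (Fin 2) A :=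
  ∑ i ∈ range (r + 1),
    ((-1 : ℚ) ^ i * (r.choose i : ℚ)) • (partialD (r - i) i G * partialD i (r - i) H)

theorem transvectant_eq_omega {m n r : ℕ} (h : r ≤ min m n) (G H : MvPolynomial (Fin 2) A) :
    transvectant m n r G H = (((m - r).factorial * (n - r).factorial : ℚ) /
      (m.factorial * n.factorial : ℚ)) • omega r G H := by
  rw [transvectant, if_pos h, omega]

theorem pderiv_comm (G : MvPolynomial (Fin 2) A) (i j : Fin 2) :
    pderiv i (pderiv j G) = pderiv j (pderiv i G) := by
  induction G using MvPolynomial.induction_on' with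
  | add p q hp hq => simp [hp, hq]
  | monomial u a =>
    simp only [pderiv_monomial]
    by_cases h : i = j
    · subst h; rfl
    · have h1 : u - Finsupp.single j 1 - Finsupp.single i 1 =
          u - Finsupp.single i 1 - Finsupp.single j 1 :=
        tsub_right_comm
      rw [h1]
      congr 1
      simp [h, Ne.symm h]
      ring

theorem partialD_pderiv_zero (i j : ℕ) (G : MvPolynomial (Fin 2) A) :
    partialD i j (pderiv 0 G) = partialD (i + 1) j G := by
  have h : ∀ (j : ℕ) (G : MvPolynomial (Fin 2) A),
      (pderiv 1)^[j] (pderiv 0 G) = pderiv 0 ((pderiv 1)^[j] G) := by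
    intro j
    induction j with
    | zero => intro G; rfl
    | succ j ih => intro G; rw [Function.iterate_succ_apply, pderiv_comm, ih]; rfl
  rw [partialD, partialD, h, Function.iterate_succ_apply]

theorem partialD_pderiv_one (i j : ℕ) (G : MvPolynomial (Fin 2) A) :
    partialD i j (pderiv 1 G) = partialD i (j + 1) G := by
  rw [partialD, partialD, Function.iterate_succ_apply]

/-- Pascal's rule for alternating binomial sums. -/
theorem alternating_choose_sum {M : Type*} [AddCommGroup M] [Module ℚ M] (r : ℕ) (c : ℕ → M) :
    ∑ i ∈ range (r + 2), ((-1 : ℚ) ^ i * ((r + 1).choose i : ℚ)) • c i =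
      ∑ i ∈ range (r + 1), ((-1 : ℚ) ^ i * (r.choose i : ℚ)) • c i -
      ∑ i ∈ range (r + 1), ((-1 : ℚ) ^ i * (r.choose i : ℚ)) • c (i + 1) := by
  have h1 : ∑ i ∈ range (r + 1), ((-1 : ℚ) ^ i * (r.choose i : ℚ)) • c i =
      ∑ i ∈ range (r + 1), ((-1 : ℚ) ^ (i + 1) * (r.choose (i + 1) : ℚ)) • c (i + 1) + c 0 := by
    rw [sum_range_succ', sum_range_succ _ r]
    simp
  rw [sum_range_succ', h1, add_sub_right_comm, ← sum_sub_distrib]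
  congr 1
  · refine sum_congr rfl fun i _ => ?_
    rw [← sub_smul, Nat.choose_succ_succ]
    congr 1
    push_cast; ring
  · simp

/-- The `r`-th transvectant is the `r`-th power of Cayley's operator `∂₁ ⊗ ∂₂ - ∂₂ ⊗ ∂₁` followed by
multiplication; this recursion reduces statements about `omega` to the case `r = 0`. -/
theorem omega_succ (r : ℕ) (G H : MvPolynomial (Fin 2) A) :
    omega (r + 1) G H =
      omega r (pderiv 0 G) (pderiv 1 H) - omega r (pderiv 1 G) (pderiv 0 H) := by
  rw [omega, alternating_choose_sum r
    (fun i => partialD (r + 1 - i) i G * partialD i (r + 1 - i) H), omega, omega]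
  congr 1
  · refine sum_congr rfl fun i hi => ?_
    rw [partialD_pderiv_zero, partialD_pderiv_one]
    have : r + 1 - i = r - i + 1 := by simp at hi; omega
    rw [this]
  · refine sum_congr rfl fun i hi => ?_
    rw [partialD_pderiv_zero, partialD_pderiv_one]
    have : r + 1 - (i + 1) = r - i := by omega
    rw [this]

theorem omega_zero (G H : MvPolynomial (Fin 2) A) : omega 0 G H = G * H := by
  simp [omega, partialD]

theorem omega_add_left (r : ℕ) (G G' H : MvPolynomial (Fin 2) A) :
    omega r (G + G') H = omega r G H + omega r G' H := by
  induction r generalizing G G' H with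
  | zero => simp [omega_zero, add_mul]
  | succ r ih => simp only [omega_succ, map_add, ih]; ring

theorem omega_add_right (r : ℕ) (G H H' : MvPolynomial (Fin 2) A) :
    omega r G (H + H') = omega r G H + omega r G H' := by
  induction r generalizing G H H' with
  | zero => simp [omega_zero, mul_add]
  | succ r ih => simp only [omega_succ, map_add, ih]; ring

theorem omega_C_mul_left (r : ℕ) (c : A) (G H : MvPolynomial (Fin 2) A) :
    omega r (C c * G) H = C c * omega r G H := by
  induction r generalizing G H with
  | zero => simp [omega_zero, mul_assoc]
  | succ r ih =>
    have hC : ∀ (i : Fin 2), pderiv i (C c * G) = C c * pderiv i G := fun i => pderiv_C_mul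
    simp only [omega_succ, hC, ih]; ring

theorem omega_C_mul_right (r : ℕ) (c : A) (G H : MvPolynomial (Fin 2) A) :
    omega r G (C c * H) = C c * omega r G H := by
  induction r generalizing G H with
  | zero => simp [omega_zero]; ring
  | succ r ih => simp only [omega_succ, pderiv_C_mul, ih]; ring

theorem map_omega {B : Type} [CommRing B] [Algebra ℚ B] (f : A →+* B) (r : ℕ)
    (G H : MvPolynomial (Fin 2) A) : map f (omega r G H) = omega r (map f G) (map f H) := by
  induction r generalizing G H with
  | zero => simp [omega_zero]
  | succ r ih => simp only [omega_succ, map_sub, ih, pderiv_map]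

/-- The linear substitution `x_j ↦ ∑ i, h i j • x_i` by an arbitrary matrix, extending `subst`. -/
def substM (h : Matrix (Fin 2) (Fin 2) A) : MvPolynomial (Fin 2) A →ₐ[A] MvPolynomial (Fin 2) A :=
  aeval fun j => ∑ i : Fin 2, C (h i j) * X i

theorem pderiv_substM (h : Matrix (Fin 2) (Fin 2) A) (i : Fin 2) (G : MvPolynomial (Fin 2) A) :
    pderiv i (substM h G) = ∑ j : Fin 2, C (h i j) * substM h (pderiv j G) := by
  induction G using MvPolynomial.induction_on with
  | C a => simp [substM]
  | add p q hp hq => simp only [map_add, hp, hq, mul_add, sum_add_distrib]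
  | mul_X p j hp =>
    have hX : pderiv i (substM h (X j)) = C (h i j) := by
      fin_cases i <;> simp [substM, pderiv_X]
    have hd : ∀ k, pderiv k (X j : MvPolynomial (Fin 2) A) = if k = j then 1 else 0 := by
      intro k
      simp [pderiv_X, Pi.single_apply, eq_comm]
    rw [map_mul, Derivation.leibniz, hp, hX]
    simp only [Derivation.leibniz, hd, smul_eq_mul, map_add, map_mul, mul_add, sum_add_distrib,
      mul_sum]
    congr 1
    · rw [sum_eq_single j]
      · simp; ring
      · intro b _ hb; simp [hb]
      · simp
    · refine sum_congr rfl fun k _ => ?_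
      ring

/-- A linear substitution by `h` multiplies Cayley's operator by `det h`. -/
theorem omega_substM (h : Matrix (Fin 2) (Fin 2) A) (r : ℕ) (G H : MvPolynomial (Fin 2) A) :
    omega r (substM h G) (substM h H) = C (h.det ^ r) * substM h (omega r G H) := by
  induction r generalizing G H with
  | zero => simp [omega_zero]
  | succ r ih =>
    simp only [omega_succ, pderiv_substM, Fin.sum_univ_two, omega_add_left, omega_add_right,
      omega_C_mul_left, omega_C_mul_right, ih, map_sub]
    rw [Matrix.det_fin_two, pow_succ]
    simp only [map_mul, map_sub]
    ring

theorem map_smul_rat {B : Type} [CommRing B] [Algebra ℚ B] (f : A →+* B) (q : ℚ)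
    (G : MvPolynomial (Fin 2) A) : map f (q • G) = q • map f G :=
  map_rat_smul (map f) q G

theorem map_transvectant {B : Type} [CommRing B] [Algebra ℚ B] (f : A →+* B) (m n r : ℕ)
    (G H : MvPolynomial (Fin 2) A) :
    map f (transvectant m n r G H) = transvectant m n r (map f G) (map f H) := by
  by_cases h : r ≤ min m n
  · rw [transvectant_eq_omega h, transvectant_eq_omega h, map_smul_rat, map_omega]
  · simp [transvectant, h]

theorem transvectant_substM (h : Matrix (Fin 2) (Fin 2) A) (m n r : ℕ)
    (G H : MvPolynomial (Fin 2) A) :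
    transvectant m n r (substM h G) (substM h H) =
      C (h.det ^ r) * substM h (transvectant m n r G H) := by
  by_cases h : r ≤ min m n
  · rw [transvectant_eq_omega h, transvectant_eq_omega h, omega_substM, map_rat_smul,
      mul_smul_comm]
  · simp [transvectant, h]

/-- The coordinates of the `r`-th transvectant of `form m g` and `form n h`. -/
def transC (m n r : ℕ) (g h : ℕ → A) (k : ℕ) : A :=
  ∑ i ∈ range (r + 1), ((-1 : ℚ) ^ i * (r.choose i : ℚ)) •
    conv (m - r) (n - r) (fun k => g (k + i)) (fun k => h (k + (r - i))) k

theorem form_sum {ι : Type*} (s : Finset ι) (m : ℕ) (g : ι → ℕ → A) :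
    ∑ i ∈ s, form m (g i) = form m (fun k => ∑ i ∈ s, g i k) := by
  simp only [form, mul_sum, map_sum]
  rw [sum_comm]

theorem form_smul (m : ℕ) (c : ℚ) (g : ℕ → A) : c • form m g = form m (fun k => c • g k) := by
  simp only [form, smul_sum, smul_monomial, mul_smul_comm]

theorem transvectant_form {m n r : ℕ} (hr : r ≤ min m n) (g h : ℕ → A) :
    transvectant m n r (form m g) (form n h) = form (m + n - 2 * r) (transC m n r g h) := by
  have hm : r ≤ m := hr.trans (min_le_left _ _)
  have hn : r ≤ n := hr.trans (min_le_right _ _)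
  have key : ∀ i ∈ range (r + 1), partialD (r - i) i (form m g) * partialD i (r - i) (form n h) =
      ((m.descFactorial r * n.descFactorial r : ℕ) : ℚ) •
        form (m + n - 2 * r)
          (conv (m - r) (n - r) (fun k => g (k + i)) (fun k => h (k + (r - i)))) := by
    intro i hi
    have hi' : i ≤ r := by simpa [Nat.lt_succ_iff] using hi
    have e1 : m - r + (r - i) + i = m := by omega
    have e2 : n - r + i + (r - i) = n := by omega
    have h1 := partialD_form (m - r) (r - i) i g
    have h2 := partialD_form (n - r) i (r - i) h
    rw [e1, Nat.sub_add_cancel hi'] at h1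
    rw [e2, Nat.add_sub_cancel' hi'] at h2
    rw [h1, h2, smul_mul_smul_comm, form_mul, Nat.cast_smul_eq_nsmul,
      show m - r + (n - r) = m + n - 2 * r by omega]
  -- the factor from differentiating cancels the normalisation of the transvectant
  have hc : ((m - r).factorial * (n - r).factorial : ℚ) / (m.factorial * n.factorial : ℚ) *
      ((m.descFactorial r * n.descFactorial r : ℕ) : ℚ) = 1 := by
    rw [← Nat.factorial_mul_descFactorial hm, ← Nat.factorial_mul_descFactorial hn]
    have f1 : ((m - r).factorial : ℚ) ≠ 0 := by exact_mod_cast (m - r).factorial_ne_zero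
    have f2 : ((n - r).factorial : ℚ) ≠ 0 := by exact_mod_cast (n - r).factorial_ne_zero
    have f3 : (m.descFactorial r : ℚ) ≠ 0 := by
      exact_mod_cast (Nat.pos_iff_ne_zero.mp (Nat.descFactorial_pos.mpr hm))
    have f4 : (n.descFactorial r : ℚ) ≠ 0 := by
      exact_mod_cast (Nat.pos_iff_ne_zero.mp (Nat.descFactorial_pos.mpr hn))
    push_cast
    field_simp
  rw [transvectant, if_pos hr]
  unfold transC
  rw [sum_congr rfl (fun i hi => by rw [key i hi]), ← form_sum, smul_sum]
  refine sum_congr rfl fun i _ => ?_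
  rw [← form_smul, smul_smul, mul_comm, mul_smul, smul_smul _ _ (form _ _), hc, one_smul]

end Transvectant

open Finset

/-! ### The Hilbert–Burch theorem -/

section HilbertBurch
variable {A : Type} [CommRing A] {n : ℕ}

/-- The maximal minor of `M` obtained by deleting the column `j`. -/
def minor (M : Matrix (Fin n) (Fin (n + 1)) A) (j : Fin (n + 1)) : A :=
  (M.submatrix id j.succAbove).det

/-- The square matrix with first row `v` and the rows of `M` below it. -/
def bordered (v : Fin (n + 1) → A) (M : Matrix (Fin n) (Fin (n + 1)) A) :
    Matrix (Fin (n + 1)) (Fin (n + 1)) A :=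
  Matrix.of (Fin.cons v M)

theorem bordered_zero (v : Fin (n + 1) → A) (M : Matrix (Fin n) (Fin (n + 1)) A) (j) :
    bordered v M 0 j = v j := rfl

theorem bordered_succ (v : Fin (n + 1) → A) (M : Matrix (Fin n) (Fin (n + 1)) A) (i j) :
    bordered v M (Fin.succ i) j = M i j := rfl

theorem det_bordered (v : Fin (n + 1) → A) (M : Matrix (Fin n) (Fin (n + 1)) A) :
    (bordered v M).det = ∑ j : Fin (n + 1), (-1) ^ (j : ℕ) * minor M j * v j := by
  rw [Matrix.det_succ_row_zero]
  refine sum_congr rfl fun j _ => ?_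
  rw [bordered_zero, mul_right_comm]
  rfl

/-- The linear form `v ↦ det (v, M)`, whose coefficients are the signed maximal minors of `M`. -/
def borderedDet (M : Matrix (Fin n) (Fin (n + 1)) A) : (Fin (n + 1) → A) →ₗ[A] A :=
  ∑ j : Fin (n + 1), ((-1) ^ (j : ℕ) * minor M j) • LinearMap.proj j

theorem borderedDet_apply (M : Matrix (Fin n) (Fin (n + 1)) A) (v : Fin (n + 1) → A) :
    borderedDet M v = (bordered v M).det := by
  simp [borderedDet, det_bordered]

theorem borderedDet_vecMul (M : Matrix (Fin n) (Fin (n + 1)) A) (w : Fin n → A) :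
    borderedDet M (Matrix.vecMul w M) = 0 := by
  have h : Matrix.vecMul w M = ∑ i, w i • M i := by
    ext j; simp [Matrix.vecMul, dotProduct]
  rw [h, map_sum]
  refine sum_eq_zero fun i _ => ?_
  rw [map_smul, borderedDet_apply, Matrix.det_zero_of_row_eq (Fin.succ_ne_zero i).symm, smul_zero]
  rfl

theorem range_borderedDet (M : Matrix (Fin n) (Fin (n + 1)) A) :
    LinearMap.range (borderedDet M) = Ideal.span (Set.range (minor M)) := by
  apply le_antisymm
  · rintro _ ⟨v, rfl⟩
    rw [borderedDet_apply, det_bordered]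
    exact sum_mem fun j _ => Ideal.mul_mem_right _ _
      (Ideal.mul_mem_left _ _ (Ideal.subset_span ⟨j, rfl⟩))
  · rw [Ideal.span_le]
    rintro _ ⟨j, rfl⟩
    refine ⟨Pi.single j ((-1) ^ (j : ℕ)), ?_⟩
    rw [borderedDet_apply, det_bordered, sum_eq_single j]
    · rw [Pi.single_eq_same, mul_right_comm, ← mul_pow]; simp
    · intro b _ hb; simp [hb]
    · simp

/-- A vector on which the linear form `borderedDet M` vanishes becomes, after multiplication by any
maximal minor of `M`, a combination of the rows of `M`: since the bordered matrix has determinant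
zero, its adjugate gives a linear relation between its rows in which `v` occurs with that minor. -/
theorem exists_minor_smul_eq {M : Matrix (Fin n) (Fin (n + 1)) A} {v : Fin (n + 1) → A}
    (hv : borderedDet M v = 0) (k : Fin (n + 1)) :
    ∃ y : Fin n → A, minor M k • v = Matrix.vecMul y M := by
  have hdet : (bordered v M).det = 0 := by rw [← borderedDet_apply, hv]
  have h0 : Matrix.adjugate (bordered v M) k 0 = (-1) ^ (k : ℕ) * minor M k := by
    rw [Matrix.adjugate_fin_succ_eq_det_submatrix]
    simp only [Fin.val_zero, zero_add]
    rfl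
  refine ⟨fun i => -((-1) ^ (k : ℕ) * Matrix.adjugate (bordered v M) k (Fin.succ i)), ?_⟩
  ext j
  have h1 := congrFun (congrFun (Matrix.adjugate_mul (bordered v M)) k) j
  rw [hdet, zero_smul, Matrix.mul_apply, Fin.sum_univ_succ, h0, bordered_zero] at h1
  simp only [bordered_succ, Matrix.zero_apply] at h1
  have h2 : ((-1 : A) ^ (k : ℕ)) * (-1) ^ (k : ℕ) = 1 := by rw [← mul_pow]; simp
  simp only [Pi.smul_apply, smul_eq_mul, Matrix.vecMul, dotProduct, neg_mul, sum_neg_distrib]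
  have h3 : ∑ i, (-1) ^ (k : ℕ) * (bordered v M).adjugate k i.succ * M i j =
      (-1) ^ (k : ℕ) * ∑ i, (bordered v M).adjugate k i.succ * M i j := by
    rw [mul_sum]; simp only [mul_assoc]
  rw [h3]
  linear_combination (-1) ^ (k : ℕ) * h1 - minor M k * v j * h2

theorem exists_smul_eq_of_mem {M : Matrix (Fin n) (Fin (n + 1)) A} {v : Fin (n + 1) → A}
    (hv : borderedDet M v = 0) {f : A} (hf : f ∈ Ideal.span (Set.range (minor M))) :
    ∃ y : Fin n → A, f • v = Matrix.vecMul y M := by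
  induction hf using Submodule.span_induction with
  | mem x hx => obtain ⟨k, rfl⟩ := hx; exact exists_minor_smul_eq hv k
  | zero => exact ⟨0, by simp⟩
  | add x y _ _ hx hy =>
    obtain ⟨a, ha⟩ := hx
    obtain ⟨b, hb⟩ := hy
    exact ⟨a + b, by rw [add_smul, ha, hb, Matrix.add_vecMul]⟩
  | smul c x _ hx =>
    obtain ⟨a, ha⟩ := hx
    exact ⟨c • a, by rw [smul_assoc, ha, Matrix.smul_vecMul]⟩

theorem vecMul_injective [IsDomain A] {M : Matrix (Fin n) (Fin (n + 1)) A} {j : Fin (n + 1)}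
    (hj : minor M j ≠ 0) : Function.Injective fun w => Matrix.vecMul w M := by
  intro a b hab
  have h : Matrix.vecMul (a - b) M = 0 := by
    rw [Matrix.sub_vecMul]; exact sub_eq_zero.mpr hab
  refine sub_eq_zero.mp (Matrix.eq_zero_of_vecMul_eq_zero hj ?_)
  ext i
  have := congrFun h (j.succAbove i)
  simpa [Matrix.vecMul, dotProduct] using this

theorem exists_minor_ne_zero {M : Matrix (Fin n) (Fin (n + 1)) A} {f : A}
    (hf : f ∈ Ideal.span (Set.range (minor M))) (hf0 : f ≠ 0) : ∃ j, minor M j ≠ 0 := by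
  by_contra! hM
  have h : Ideal.span (Set.range (minor M)) = ⊥ := by
    rw [Ideal.span_eq_bot]; rintro _ ⟨j, rfl⟩; exact hM j
  rw [h] at hf
  exact hf0 hf

/-- The Hilbert–Burch theorem. If the ideal of maximal minors of `M` contains a regular sequence
`f, h` (regularity of `h` modulo `f` is spelled out as divisibility), then the complex
`Aⁿ → Aⁿ⁺¹ → A` given by `M` and its signed maximal minors is exact in the middle. For `v` in the
kernel, `f • v = y M` and `h • v = z M`; then `h • y = f • z` forces `f` to divide `y`. -/
theorem exact_vecMul_borderedDet [IsDomain A] {M : Matrix (Fin n) (Fin (n + 1)) A} {f h : A}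
    (hf : f ∈ Ideal.span (Set.range (minor M))) (hh : h ∈ Ideal.span (Set.range (minor M)))
    (hf0 : f ≠ 0) (hfh : ∀ a, f ∣ h * a → f ∣ a) :
    Function.Exact M.vecMulLinear (borderedDet M) := by
  obtain ⟨j, hj⟩ := exists_minor_ne_zero hf hf0
  intro v
  constructor
  · intro hv
    obtain ⟨y, hy⟩ := exists_smul_eq_of_mem hv hf
    obtain ⟨z, hz⟩ := exists_smul_eq_of_mem hv hh
    have h1 : h • y = f • z := by
      apply vecMul_injective hj
      simp only [Matrix.smul_vecMul, ← hy, ← hz]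
      rw [smul_comm]
    have h2 : ∀ i, ∃ w, y i = f * w := by
      intro i
      have := congrFun h1 i
      exact hfh _ ⟨z i, this⟩
    choose w hw using h2
    refine ⟨w, ?_⟩
    rw [Matrix.vecMulLinear_apply]
    have h3 : f • Matrix.vecMul w M = f • v := by
      rw [hy, ← Matrix.smul_vecMul]
      congr 1
      ext i; exact (hw i).symm
    exact smul_right_injective _ hf0 h3
  · rintro ⟨w, rfl⟩
    exact borderedDet_vecMul M w

end HilbertBurch

/-! ### Grade, height and projective dimension -/

section Regular
open RingTheory.Sequence
variable {A : Type} [CommRing A]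

/-- Each further element of a regular sequence lies outside the minimal primes over the previous
ones, so that the height grows by at least one. -/
theorem length_le_height_of_isWeaklyRegular {rs : List A} (h : IsWeaklyRegular A rs)
    (P : Ideal A) [P.IsPrime] (hP : ∀ r ∈ rs, r ∈ P) : (rs.length : ℕ∞) ≤ P.height := by
  induction rs using List.reverseRecOn generalizing P with
  | nil => simp
  | append_singleton rs r ih =>
    rw [isWeaklyRegular_append_iff, isWeaklyRegular_singleton_iff] at h
    have hle : Ideal.ofList rs ≤ P :=
      Ideal.span_le.mpr fun x hx => hP x (List.mem_append_left _ hx)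
    obtain ⟨Q, hQ, hQP⟩ := Ideal.exists_minimalPrimes_le hle
    have := hQ.1.1
    have hr : r ∉ Q := by
      apply h.2.notMem_of_mem_minimalPrimes
      rw [smul_eq_mul, Ideal.mul_top, Ideal.annihilator_quotient]
      exact hQ
    have hlt : Q < P := lt_of_le_of_ne hQP fun e => hr (e ▸ hP r (by simp))
    have h1 := ih h.1 Q fun x hx => hQ.1.2 (Ideal.subset_span hx)
    have h2 := Ideal.height_add_one_le_of_lt_of_isPrime hlt
    rw [List.length_append, List.length_singleton, Nat.cast_add, Nat.cast_one]
    exact (add_le_add_left h1 1).trans h2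

theorem grade_le_height (I : Ideal A) : grade I ≤ I.height := by
  refine iSup₂_le fun rs hrs => ?_
  rw [Ideal.height_eq_inf_minimalPrimes]
  refine le_iInf₂ fun P hP => ?_
  have := hP.1.1
  exact length_le_height_of_isWeaklyRegular hrs.1.1 P fun r hr => hP.1.2 (hrs.2 r hr)

/-- Two elements without common factors form a regular sequence. -/
theorem two_le_grade {I : Ideal A} [IsDomain A] (hI : I ≠ ⊤) {f h : A} (hf : f ∈ I) (hh : h ∈ I)
    (hf0 : f ≠ 0) (hfh : ∀ a, f ∣ h * a → f ∣ a) : 2 ≤ grade I := by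
  have hreg : IsRegular A [f, h] := by
    refine ⟨?_, ?_⟩
    · rw [isWeaklyRegular_cons_iff, isWeaklyRegular_singleton_iff]
      refine ⟨fun a b hab => mul_left_cancel₀ hf0 hab, ?_⟩
      rw [isSMulRegular_iff_right_eq_zero_of_smul]
      intro x hx
      obtain ⟨a, rfl⟩ := Submodule.Quotient.mk_surjective _ x
      rw [← Submodule.Quotient.mk_smul, Submodule.Quotient.mk_eq_zero] at hx
      rw [Submodule.Quotient.mk_eq_zero]
      rw [Submodule.mem_smul_pointwise_iff_exists] at hx ⊢
      obtain ⟨b, _, hb⟩ := hx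
      obtain ⟨c, hc⟩ := hfh a ⟨b, hb.symm⟩
      exact ⟨c, trivial, hc.symm⟩
    · intro htop
      apply hI
      rw [eq_top_iff, htop, smul_eq_mul, Ideal.mul_top, Ideal.ofList, Ideal.span_le]
      intro x hx
      simp at hx
      rcases hx with rfl | rfl <;> assumption
  have : ((2 : ℕ) : ℕ∞) ≤ grade I := by
    refine le_iSup₂_of_le [f, h] ⟨hreg, ?_⟩ le_rfl
    intro r hr
    simp at hr
    rcases hr with rfl | rfl <;> assumption
  exact_mod_cast this

open CategoryTheory in
/-- A free resolution `0 → Aⁿ → Aᵐ → A → A / I → 0` which is minimal with respect to a proper ideal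
`J`, and whose last term is nonzero, has the length of the projective dimension: otherwise `I` would
be projective and `d₂` would have a retraction, while the image of `d₂` lies in `J Aᵐ`. -/
theorem projectiveDimension_quotient_eq_two {I : Ideal A} {m n : ℕ}
    {d₁ : (Fin m → A) →ₗ[A] A} {d₂ : (Fin n → A) →ₗ[A] (Fin m → A)}
    (hr : LinearMap.range d₁ = I) (he : Function.Exact d₂ d₁) (hi : Function.Injective d₂)
    (hn : 0 < n) {J : Ideal A} (hJ : J ≠ ⊤)
    (hmin : LinearMap.range d₂ ≤ J • (⊤ : Submodule A (Fin m → A))) :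
    projectiveDimension (ModuleCat.of A (A ⧸ I)) = 2 := by
  -- the two short exact sequences into which the resolution splits
  let p : (Fin m → A) →ₗ[A] I := d₁.codRestrict I fun x => hr ▸ LinearMap.mem_range_self d₁ x
  have hp : Function.Surjective p := by
    rintro ⟨x, hx⟩
    rw [← hr] at hx
    obtain ⟨y, rfl⟩ := hx
    exact ⟨y, rfl⟩
  have hpe : Function.Exact d₂ p := by
    intro x
    rw [← he x, Subtype.ext_iff]; rfl
  let S₁ : ShortComplex (ModuleCat A) := ShortComplex.mk (ModuleCat.ofHom d₂) (ModuleCat.ofHom p)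
    (by ext1; exact LinearMap.ext fun x => hpe.apply_apply_eq_zero x)
  have hS₁ : S₁.ShortExact :=
    { exact := (ShortComplex.ShortExact.moduleCat_exact_iff_function_exact S₁).mpr hpe
      mono_f := (ModuleCat.mono_iff_injective _).mpr hi
      epi_g := (ModuleCat.epi_iff_surjective _).mpr hp }
  let S₂ : ShortComplex (ModuleCat A) :=
    ShortComplex.mk (ModuleCat.ofHom I.subtype) (ModuleCat.ofHom I.mkQ)
      (by ext1; exact LinearMap.ext fun x => (LinearMap.exact_subtype_mkQ I).apply_apply_eq_zero x)
  have hS₂ : S₂.ShortExact :=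
    { exact := (ShortComplex.ShortExact.moduleCat_exact_iff_function_exact S₂).mpr
        (LinearMap.exact_subtype_mkQ I)
      mono_f := (ModuleCat.mono_iff_injective _).mpr Subtype.val_injective
      epi_g := (ModuleCat.epi_iff_surjective _).mpr I.mkQ_surjective }
  have pr1 : Projective S₁.X₁ := ModuleCat.projective_of_free (Pi.basisFun A (Fin n))
  have pr2 : Projective S₁.X₂ := ModuleCat.projective_of_free (Pi.basisFun A (Fin m))
  have pr3 : Projective S₂.X₂ := ModuleCat.projective_of_free (Module.Basis.singleton Unit A)
  apply le_antisymm
  · rw [show (2 : WithBot ℕ∞) = ((2 : ℕ) : WithBot ℕ∞) from rfl, projectiveDimension_le_iff]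
    have h1 : HasProjectiveDimensionLT S₁.X₃ 2 :=
      hS₁.hasProjectiveDimensionLT_X₃ 1 inferInstance inferInstance
    exact hS₂.hasProjectiveDimensionLT_X₃ 2 h1 inferInstance
  · rw [show (2 : WithBot ℕ∞) = ((2 : ℕ) : WithBot ℕ∞) from rfl, projectiveDimension_ge_iff]
    intro hlt
    have h1 : HasProjectiveDimensionLT S₂.X₁ 1 :=
      hS₂.hasProjectiveDimensionLT_X₁ 1 inferInstance hlt
    have h2 : Projective (ModuleCat.of A I) := projective_iff_hasProjectiveDimensionLT_one.mpr h1
    have h3 : Module.Projective A I := (IsProjective.iff_projective _).mpr h2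
    obtain ⟨s, hs⟩ := Module.projective_lifting_property p LinearMap.id hp
    have hs' : ∀ x, p (s x) = x := fun x => LinearMap.congr_fun hs x
    have hl : ∀ v : Fin m → A, ∃ w, d₂ w = v - s (p v) := by
      intro v
      exact (hpe _).mp (by rw [map_sub, hs', sub_self])
    -- the retraction of `d₂` belonging to the section `s` of `p`
    choose t ht using hl
    have hlin : ∀ w, t (d₂ w) = w := by
      intro w
      apply hi
      rw [ht, hpe.apply_apply_eq_zero, map_zero, sub_zero]
    have hadd : ∀ v w, t (v + w) = t v + t w := by
      intro v w
      apply hi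
      simp only [map_add, ht]
      abel
    have hsmul : ∀ (r : A) v, t (r • v) = r • t v := by
      intro r v
      apply hi
      simp only [map_smul, ht, smul_sub]
    have hmem : ∀ v ∈ J • (⊤ : Submodule A (Fin m → A)), ∀ i, t v i ∈ J := by
      intro v hv
      refine Submodule.smul_induction_on hv ?_ ?_
      · intro r hr x _ i
        rw [hsmul]
        exact J.mul_mem_right _ hr
      · intro x y hx hy i
        rw [hadd]
        exact J.add_mem (hx i) (hy i)
    apply hJ
    rw [Ideal.eq_top_iff_one]
    have h4 := hmem _ (hmin (LinearMap.mem_range_self d₂ (Pi.single ⟨0, hn⟩ 1))) ⟨0, hn⟩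
    rwa [hlin, Pi.single_eq_same] at h4

end Regular

/-! ### The covariants of a quintic -/

section Covariants
variable {A : Type} [CommRing A] [Algebra ℚ A]

theorem transvectant_add_left (m n r : ℕ) (G G' H : MvPolynomial (Fin 2) A) :
    transvectant m n r (G + G') H = transvectant m n r G H + transvectant m n r G' H := by
  by_cases h : r ≤ min m n
  · simp only [transvectant_eq_omega h, omega_add_left, smul_add]
  · simp [transvectant, h]

theorem transvectant_C_mul_left (m n r : ℕ) (c : A) (G H : MvPolynomial (Fin 2) A) :
    transvectant m n r (C c * G) H = C c * transvectant m n r G H := by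
  by_cases h : r ≤ min m n
  · simp only [transvectant_eq_omega h, omega_C_mul_left, mul_smul_comm]
  · simp [transvectant, h]

theorem transvectant_C_mul_right (m n r : ℕ) (c : A) (G H : MvPolynomial (Fin 2) A) :
    transvectant m n r G (C c * H) = C c * transvectant m n r G H := by
  by_cases h : r ≤ min m n
  · simp only [transvectant_eq_omega h, omega_C_mul_right, mul_smul_comm]
  · simp [transvectant, h]

theorem transvectant_zero_left (m n r : ℕ) (H : MvPolynomial (Fin 2) A) :
    transvectant m n r 0 H = 0 := by
  simpa using transvectant_C_mul_left m n r (0 : A) 0 H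

theorem transvectant_isHomogeneous {m n r : ℕ} {G H : MvPolynomial (Fin 2) A}
    (hr : r ≤ min m n) (hG : G.IsHomogeneous m) (hH : H.IsHomogeneous n) :
    (transvectant m n r G H).IsHomogeneous (m + n - 2 * r) := by
  rw [← form_coord hG, ← form_coord hH, transvectant_form hr]
  exact form_isHomogeneous _ _

variable {F : MvPolynomial (Fin 2) A}

theorem isHomogeneous_rat_smul {σ : Type*} {m : ℕ} {G : MvPolynomial σ A} (hG : G.IsHomogeneous m)
    (q : ℚ) : (q • G).IsHomogeneous m := by
  rw [← algebraMap_smul A q G]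
  exact (homogeneousSubmodule σ A m).smul_mem _ hG

theorem theta22_isHomogeneous (hF : F.IsHomogeneous 5) : (theta22 F).IsHomogeneous 2 :=
  transvectant_isHomogeneous (by norm_num) hF hF

theorem theta26_isHomogeneous (hF : F.IsHomogeneous 5) : (theta26 F).IsHomogeneous 6 :=
  transvectant_isHomogeneous (by norm_num) hF hF

theorem theta33_isHomogeneous (hF : F.IsHomogeneous 5) : (theta33 F).IsHomogeneous 3 :=
  transvectant_isHomogeneous (by norm_num) (theta22_isHomogeneous hF) hF

theorem theta40_isHomogeneous (hF : F.IsHomogeneous 5) : (theta40 F).IsHomogeneous 0 :=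
  transvectant_isHomogeneous (by norm_num) (theta22_isHomogeneous hF) (theta22_isHomogeneous hF)

theorem theta51_isHomogeneous (hF : F.IsHomogeneous 5) : (theta51 F).IsHomogeneous 1 :=
  transvectant_isHomogeneous (by norm_num) ((theta22_isHomogeneous hF).pow 2) hF

theorem theta80_isHomogeneous (hF : F.IsHomogeneous 5) : (theta80 F).IsHomogeneous 0 :=
  transvectant_isHomogeneous (by norm_num) ((theta22_isHomogeneous hF).pow 3)
    (theta26_isHomogeneous hF)

theorem covU_isHomogeneous (hF : F.IsHomogeneous 5) (α : ℚ) : (covU F α).IsHomogeneous 5 := by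
  refine IsHomogeneous.sub ((theta33_isHomogeneous hF).mul (theta22_isHomogeneous hF)) ?_
  simpa using isHomogeneous_rat_smul ((theta40_isHomogeneous hF).mul hF) α

theorem covV_isHomogeneous (hF : F.IsHomogeneous 5) (β γ : ℚ) : (covV F β γ).IsHomogeneous 5 := by
  refine IsHomogeneous.sub (IsHomogeneous.sub
    ((theta51_isHomogeneous hF).mul ((theta22_isHomogeneous hF).pow 2)) ?_) ?_
  · simpa using isHomogeneous_rat_smul (((theta40_isHomogeneous hF).pow 2).mul hF) β
  · simpa using isHomogeneous_rat_smul ((theta80_isHomogeneous hF).mul hF) γ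

theorem sigma_isHomogeneous (hF : F.IsHomogeneous 5) (τ : ℚ × ℚ × ℚ)
    {G c₁ c₂ : MvPolynomial (Fin 2) A} (hG : G.IsHomogeneous 2) (h₁ : c₁.IsHomogeneous 0)
    (h₂ : c₂.IsHomogeneous 0) : (sigma F τ G c₁ c₂).IsHomogeneous 5 := by
  refine IsHomogeneous.add (IsHomogeneous.add
    (transvectant_isHomogeneous (by norm_num) hG hF) ?_) ?_
  · simpa using h₁.mul (covU_isHomogeneous hF τ.1)
  · simpa using h₂.mul (covV_isHomogeneous hF τ.2.1 τ.2.2)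

theorem sigma_add (τ : ℚ × ℚ × ℚ) (G c₁ c₂ G' c₁' c₂' : MvPolynomial (Fin 2) A) :
    sigma F τ (G + G') (c₁ + c₁') (c₂ + c₂') = sigma F τ G c₁ c₂ + sigma F τ G' c₁' c₂' := by
  simp only [sigma, transvectant_add_left]; ring

theorem sigma_C_mul (τ : ℚ × ℚ × ℚ) (a : A) (G c₁ c₂ : MvPolynomial (Fin 2) A) :
    sigma F τ (C a * G) (C a * c₁) (C a * c₂) = C a * sigma F τ G c₁ c₂ := by
  simp only [sigma, transvectant_C_mul_left]; ring

section Map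
variable {B : Type} [CommRing B] [Algebra ℚ B] (f : A →+* B) (F)

theorem map_theta22 : map f (theta22 F) = theta22 (map f F) := map_transvectant ..

theorem map_theta26 : map f (theta26 F) = theta26 (map f F) := map_transvectant ..

theorem map_theta33 : map f (theta33 F) = theta33 (map f F) := by
  rw [theta33, map_transvectant, map_theta22]; rfl

theorem map_theta40 : map f (theta40 F) = theta40 (map f F) := by
  rw [theta40, map_transvectant, map_theta22]; rfl

theorem map_theta51 : map f (theta51 F) = theta51 (map f F) := by
  rw [theta51, map_transvectant, map_pow, map_theta22]; rfl

theorem map_theta80 : map f (theta80 F) = theta80 (map f F) := by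
  rw [theta80, map_transvectant, map_pow, map_theta22, map_theta26]; rfl

theorem map_covU (α : ℚ) : map f (covU F α) = covU (map f F) α := by
  simp only [covU, map_sub, map_mul, map_smul_rat, map_theta33, map_theta22, map_theta40]

theorem map_covV (β γ : ℚ) : map f (covV F β γ) = covV (map f F) β γ := by
  simp only [covV, map_sub, map_mul, map_pow, map_smul_rat, map_theta51, map_theta22, map_theta40,
    map_theta80]

theorem map_sigma (τ : ℚ × ℚ × ℚ) (G c₁ c₂ : MvPolynomial (Fin 2) A) :
    map f (sigma F τ G c₁ c₂) = sigma (map f F) τ (map f G) (map f c₁) (map f c₂) := by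
  simp only [sigma, map_add, map_mul, map_transvectant, map_covU, map_covV]

end Map

section Subst
variable (h : Matrix (Fin 2) (Fin 2) A) (F)

theorem theta22_substM : theta22 (substM h F) = C (h.det ^ 4) * substM h (theta22 F) :=
  transvectant_substM ..

theorem theta26_substM : theta26 (substM h F) = C (h.det ^ 2) * substM h (theta26 F) :=
  transvectant_substM ..

theorem theta33_substM : theta33 (substM h F) = C (h.det ^ 6) * substM h (theta33 F) := by
  rw [theta33, theta22_substM, transvectant_C_mul_left, transvectant_substM, ← mul_assoc, ← C_mul,
    ← pow_add]; rfl

theorem theta40_substM : theta40 (substM h F) = C (h.det ^ 10) * substM h (theta40 F) := by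
  rw [theta40, theta22_substM, transvectant_C_mul_left, transvectant_C_mul_right,
    transvectant_substM, ← mul_assoc, ← mul_assoc, ← C_mul, ← C_mul, ← pow_add, ← pow_add]; rfl

theorem theta51_substM : theta51 (substM h F) = C (h.det ^ 12) * substM h (theta51 F) := by
  have h1 : theta22 (substM h F) ^ 2 = C (h.det ^ 8) * substM h (theta22 F ^ 2) := by
    simp only [theta22_substM, map_pow, mul_pow]; ring
  unfold theta51
  rw [h1, transvectant_C_mul_left, transvectant_substM, ← mul_assoc, ← C_mul,
    ← pow_add]

theorem theta80_substM : theta80 (substM h F) = C (h.det ^ 20) * substM h (theta80 F) := by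
  have h1 : theta22 (substM h F) ^ 3 = C (h.det ^ 12) * substM h (theta22 F ^ 3) := by
    simp only [theta22_substM, map_pow, mul_pow]; ring
  unfold theta80
  rw [h1, theta26_substM, transvectant_C_mul_left, transvectant_C_mul_right,
    transvectant_substM, ← mul_assoc, ← mul_assoc, ← C_mul, ← C_mul, ← pow_add, ← pow_add]

theorem covU_substM (α : ℚ) : covU (substM h F) α = C (h.det ^ 10) * substM h (covU F α) := by
  rw [covU, covU, theta33_substM, theta22_substM, theta40_substM, map_sub, map_rat_smul,
    Algebra.smul_def, Algebra.smul_def]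
  simp only [map_mul, map_pow]
  ring

theorem covV_substM (β γ : ℚ) :
    covV (substM h F) β γ = C (h.det ^ 20) * substM h (covV F β γ) := by
  rw [covV, covV, theta51_substM, theta22_substM, theta40_substM, theta80_substM, map_sub, map_sub,
    map_rat_smul, map_rat_smul]
  simp only [map_mul, map_pow, Algebra.smul_def]
  ring

/-- The equivariance of `σ_τ`: on the three summands the powers of `det h` are `1`, `10`, `20`. -/
theorem sigma_substM (τ : ℚ × ℚ × ℚ) (G c₁ c₂ : MvPolynomial (Fin 2) A) :
    sigma (substM h F) τ (substM h G) (substM h c₁) (substM h c₂) =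
      substM h (sigma F τ (C h.det * G) (C (h.det ^ 10) * c₁) (C (h.det ^ 20) * c₂)) := by
  simp only [sigma, transvectant_substM, covU_substM, covV_substM, transvectant_C_mul_left,
    map_add, map_mul, pow_one]
  have : ∀ a : A, substM h (C a) = C a := fun a => by simp [substM]
  simp only [this]
  ring

end Subst

end Covariants

/-! ### The Wronskian and the maximal minors -/

section Wronskian

/-- The determinant of the matrix with entries `a_{i,j} x + a_{i,j+1} y` in terms of the maximal
minors of `a`. Border `a` by the row `e` of monomials `(-y)^(n-j) x^j` and multiply by the
bidiagonal matrix `D` which replaces consecutive columns `u, v` by `u x + v y`: all entries of the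
first row but one become zero. -/
theorem det_two_term {B : Type} [CommRing B] [IsDomain B] {n : ℕ}
    (a : Matrix (Fin n) (Fin (n + 1)) B) (x y : B) (hy : y ≠ 0) :
    (Matrix.of fun i j : Fin n => a i j.castSucc * x + a i j.succ * y).det =
      ∑ j : Fin (n + 1), minor a j * x ^ (j : ℕ) * y ^ (n - j) := by
  set e : Fin (n + 1) → B := fun j => (-y) ^ (n - (j : ℕ)) * x ^ (j : ℕ) with he
  set D : Matrix (Fin (n + 1)) (Fin (n + 1)) B := Matrix.of fun k l =>
    Fin.cases (if k = 0 then 1 else 0)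
      (fun j : Fin n => (if k = j.castSucc then x else 0) + (if k = j.succ then y else 0)) l with hD
  have hD0 : ∀ k, D k 0 = if k = 0 then 1 else 0 := fun k => rfl
  have hDs : ∀ k (j : Fin n), D k j.succ =
      (if k = j.castSucc then x else 0) + (if k = j.succ then y else 0) := fun k j => rfl
  have hdetD : D.det = y ^ n := by
    rw [Matrix.det_of_isUpperTriangular]
    · rw [Fin.prod_univ_succ, hD0, if_pos rfl, one_mul]
      have : ∀ j : Fin n, D j.succ j.succ = y := by
        intro j
        rw [hDs, if_neg (Fin.castSucc_lt_succ).ne', if_pos rfl, zero_add]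
      simp [this]
    · intro i j hij
      simp only [id] at hij
      revert hij
      refine Fin.cases ?_ (fun j => ?_) j
      · intro h; rw [hD0, if_neg h.ne']
      · intro h
        rw [hDs, if_neg (lt_trans Fin.castSucc_lt_succ h).ne', if_neg h.ne', add_zero]
  have hN0 : ∀ k, (bordered e a * D) k 0 = bordered e a k 0 := by
    intro k
    rw [Matrix.mul_apply, Finset.sum_eq_single 0]
    · rw [hD0, if_pos rfl, mul_one]
    · intro b _ hb; rw [hD0, if_neg hb, mul_zero]
    · simp
  have hNs : ∀ k (j : Fin n), (bordered e a * D) k j.succ =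
      bordered e a k j.castSucc * x + bordered e a k j.succ * y := by
    intro k j
    rw [Matrix.mul_apply]
    simp [hDs, mul_add, Finset.sum_add_distrib]
  have hrow : ∀ j : Fin n, (bordered e a * D) 0 j.succ = 0 := by
    intro j
    rw [hNs, bordered_zero, bordered_zero, he]
    simp only [Fin.val_castSucc, Fin.val_succ]
    have hj : n - (j : ℕ) = n - (j + 1) + 1 := by have := j.2; omega
    rw [hj]; ring
  have h1 : (bordered e a * D).det = (-y) ^ n *
      (Matrix.of fun i j : Fin n => a i j.castSucc * x + a i j.succ * y).det := by
    rw [Matrix.det_succ_row_zero, Fin.sum_univ_succ]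
    simp only [hrow, mul_zero, zero_mul, Finset.sum_const_zero, add_zero, hN0, bordered_zero]
    have he0 : e 0 = (-y) ^ n := by simp [he]
    rw [he0, Fin.val_zero, pow_zero, one_mul]
    congr 2
    ext i j
    rw [Matrix.submatrix_apply, Fin.zero_succAbove, hNs]
    rfl
  rw [Matrix.det_mul, hdetD, det_bordered, he] at h1
  have h2 : ∑ j : Fin (n + 1), (-1) ^ (j : ℕ) * minor a j * ((-y) ^ (n - (j : ℕ)) * x ^ (j : ℕ)) =
      (-1) ^ n * ∑ j : Fin (n + 1), minor a j * x ^ (j : ℕ) * y ^ (n - j) := by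
    rw [Finset.mul_sum]
    refine Finset.sum_congr rfl fun j _ => ?_
    have hj : (-1 : B) ^ n = (-1) ^ (j : ℕ) * (-1) ^ (n - (j : ℕ)) := by
      rw [← pow_add]; congr 1; have := j.2; omega
    rw [hj, neg_pow y]; ring
  simp only [h2] at h1
  have h3 : (-y) ^ n ≠ 0 := pow_ne_zero _ (neg_ne_zero.mpr hy)
  apply mul_left_cancel₀ h3
  rw [← h1, neg_pow y]; ring

end Wronskian

section SigmaMatrix
variable {A : Type} [CommRing A] [Algebra ℚ A]

/-- The images under `σ_τ(F)` of the basis `x₁², x₁x₂, x₂², 1, 1`. -/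
def sigmaRow (τ : ℚ × ℚ × ℚ) (F : MvPolynomial (Fin 2) A) : Fin 5 → MvPolynomial (Fin 2) A :=
  ![sigma F τ (X 0 ^ 2) 0 0, sigma F τ (X 0 * X 1) 0 0, sigma F τ (X 1 ^ 2) 0 0,
    sigma F τ 0 1 0, sigma F τ 0 0 1]

/-- The matrix of `σ_τ(F)`. Its rows are the images of the basis, in the coordinates `g` of
`∑ binom(5, k) g_k x₁^(5-k) x₂^k`. -/
def sigmaMat (τ : ℚ × ℚ × ℚ) (F : MvPolynomial (Fin 2) A) : Matrix (Fin 5) (Fin 6) A :=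
  Matrix.of fun i j => coord 5 (sigmaRow τ F i) j

/-- The extension of a vector `v : Fin n → A` by zero to a sequence. -/
def extend {n : ℕ} (v : Fin n → A) (k : ℕ) : A := if h : k < n then v ⟨k, h⟩ else 0

theorem extend_coe {n : ℕ} (v : Fin n → A) (k : Fin n) : extend v k = v k := by
  simp [extend]

theorem isHomogeneous_X_sq (i j : Fin 2) : (X i * X j : MvPolynomial (Fin 2) A).IsHomogeneous 2 :=
  (isHomogeneous_X A i).mul (isHomogeneous_X A j)

theorem sigmaRow_isHomogeneous (τ : ℚ × ℚ × ℚ) {F : MvPolynomial (Fin 2) A}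
    (hF : F.IsHomogeneous 5) (i : Fin 5) : (sigmaRow τ F i).IsHomogeneous 5 := by
  have z2 := isHomogeneous_zero (Fin 2) A 2
  have z0 := isHomogeneous_zero (Fin 2) A 0
  have o0 := isHomogeneous_one (Fin 2) A
  fin_cases i
  · exact sigma_isHomogeneous hF τ ((isHomogeneous_X A 0).pow 2) z0 z0
  · exact sigma_isHomogeneous hF τ (isHomogeneous_X_sq 0 1) z0 z0
  · exact sigma_isHomogeneous hF τ ((isHomogeneous_X A 1).pow 2) z0 z0
  · exact sigma_isHomogeneous hF τ z2 o0 z0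
  · exact sigma_isHomogeneous hF τ z2 z0 o0

theorem form_one (g : ℕ → A) : form 1 g = C (g 0) * X 0 + C (g 1) * X 1 := by
  simp [form, sum_range_succ, C_mul_X_eq_monomial, expo]

/-- The coefficients of `Γ_τ` are the maximal minors of the matrix of `σ_τ`, up to the factor
`120 ^ 5` that comes from the fourth derivatives of quintics. -/
theorem Gam_eq [IsDomain A] (τ : ℚ × ℚ × ℚ) {F : MvPolynomial (Fin 2) A}
    (hF : F.IsHomogeneous 5) :
    Gam F τ = C (120 ^ 5) *
      ∑ j : Fin 6, monomial (expo j (5 - j)) (minor (sigmaMat τ F) j) := by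
  have hentry : ∀ (i : Fin 5) (j : Fin 5), partialD (5 - 1 - (j : ℕ)) (j : ℕ) (sigmaRow τ F i) =
      C 120 * (C (sigmaMat τ F i j.castSucc) * X 0 + C (sigmaMat τ F i j.succ) * X 1) := by
    intro i j
    have h1 := partialD_form 1 (5 - 1 - (j : ℕ)) j (coord 5 (sigmaRow τ F i))
    have h2 : 1 + (5 - 1 - (j : ℕ)) + j = 5 := by have := j.2; omega
    have h3 : 5 - 1 - (j : ℕ) + j = 4 := by have := j.2; omega
    rw [h2, h3, form_coord (sigmaRow_isHomogeneous τ hF i), form_one,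
      show Nat.descFactorial 5 4 = 120 from rfl] at h1
    rw [h1, nsmul_eq_mul, sigmaMat, Matrix.of_apply, Matrix.of_apply, Nat.cast_ofNat,
      ← map_ofNat C 120, zero_add, add_comm 1]
    rfl
  have hG : Gam F τ = wronskian (sigmaRow τ F) := rfl
  rw [hG, wronskian]
  have h4 : (Matrix.of fun i j : Fin 5 => partialD (5 - 1 - (j : ℕ)) (j : ℕ) (sigmaRow τ F i)) =
      (C 120 : MvPolynomial (Fin 2) A) • Matrix.of fun i j : Fin 5 =>
        ((sigmaMat τ F).map C) i j.castSucc * X 0 + ((sigmaMat τ F).map C) i j.succ * X 1 := by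
    ext1 i j
    simp only [Matrix.of_apply, Matrix.smul_apply, hentry, Matrix.map_apply, smul_eq_mul]
  rw [h4, Matrix.det_smul, det_two_term _ _ _ (X_ne_zero 1), Fintype.card_fin, ← C_pow]
  refine congrArg (fun z => C (120 ^ 5) * z) (sum_congr rfl fun j _ => ?_)
  have h5 : minor ((sigmaMat τ F).map C) j =
      (C (minor (sigmaMat τ F) j) : MvPolynomial (Fin 2) A) := by
    rw [minor, minor, RingHom.map_det]; rfl
  rw [h5, X_pow_eq_monomial, X_pow_eq_monomial, mul_assoc, monomial_mul, C_mul_monomial, mul_one,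
    mul_one]
  rfl

theorem coeff_sum_minor (M : Fin 6 → A) (j : Fin 6) :
    coeff (expo j (5 - j)) (∑ j : Fin 6, monomial (expo j (5 - j)) (M j)) = M j := by
  rw [coeff_sum, sum_eq_single j]
  · simp
  · intro b _ hb
    rw [coeff_monomial, if_neg]
    rw [expo_inj, not_and_or]
    left
    exact fun h => hb (Fin.ext h)
  · simp

theorem span_coeff_Gam [IsDomain A] (τ : ℚ × ℚ × ℚ) {F : MvPolynomial (Fin 2) A}
    (hF : F.IsHomogeneous 5) :
    Ideal.span (Set.range fun e : Fin 2 →₀ ℕ => coeff e (Gam F τ)) =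
      Ideal.span (Set.range (minor (sigmaMat τ F))) := by
  apply le_antisymm
  · rw [Ideal.span_le]
    rintro _ ⟨e, rfl⟩
    simp only [Gam_eq τ hF, coeff_C_mul, coeff_sum, coeff_monomial]
    refine Ideal.mul_mem_left _ _ (sum_mem fun j _ => ?_)
    split_ifs
    · exact Ideal.subset_span ⟨j, rfl⟩
    · exact zero_mem _
  · rw [Ideal.span_le]
    rintro _ ⟨j, rfl⟩
    have h1 : coeff (expo j (5 - j)) (Gam F τ) = 120 ^ 5 * minor (sigmaMat τ F) j := by
      rw [Gam_eq τ hF, coeff_C_mul, coeff_sum_minor]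
    have h2 : minor (sigmaMat τ F) j =
        algebraMap ℚ A ((120 ^ 5)⁻¹) * coeff (expo j (5 - j)) (Gam F τ) := by
      have h3 : (120 ^ 5 : A) = algebraMap ℚ A (120 ^ 5) := by rw [map_pow, map_ofNat]
      rw [h1, h3, ← mul_assoc, ← map_mul, inv_mul_cancel₀ (by norm_num), map_one, one_mul]
    rw [h2]
    exact Ideal.mul_mem_left _ _ (Ideal.subset_span ⟨_, rfl⟩)

/-- The quadratic form `a x₁² + b x₁x₂ + c x₂²`. -/
def quad (a b c : A) : MvPolynomial (Fin 2) A :=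
  C a * X 0 ^ 2 + C b * (X 0 * X 1) + C c * X 1 ^ 2

theorem quad_isHomogeneous (a b c : A) : (quad a b c).IsHomogeneous 2 := by
  refine IsHomogeneous.add (IsHomogeneous.add ?_ ?_) ?_
  · simpa using (isHomogeneous_C (Fin 2) a).mul ((isHomogeneous_X A 0).pow 2)
  · simpa using (isHomogeneous_C (Fin 2) b).mul (isHomogeneous_X_sq (A := A) 0 1)
  · simpa using (isHomogeneous_C (Fin 2) c).mul ((isHomogeneous_X A 1).pow 2)

theorem sigma_quad (τ : ℚ × ℚ × ℚ) (F : MvPolynomial (Fin 2) A) (w : Fin 5 → A) :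
    sigma F τ (quad (w 0) (w 1) (w 2)) (C (w 3)) (C (w 4)) = ∑ i, C (w i) * sigmaRow τ F i := by
  rw [Fin.sum_univ_five]
  simp only [sigmaRow, Matrix.cons_val, ← sigma_C_mul, ← sigma_add, quad]
  simp

theorem coord_add (m : ℕ) (G H : MvPolynomial (Fin 2) A) (k : ℕ) :
    coord m (G + H) k = coord m G k + coord m H k := by
  simp [coord, smul_add]

theorem coord_C_mul (m : ℕ) (c : A) (G : MvPolynomial (Fin 2) A) (k : ℕ) :
    coord m (C c * G) k = c * coord m G k := by
  simp [coord]

theorem coord_sum {ι : Type*} (s : Finset ι) (m : ℕ) (G : ι → MvPolynomial (Fin 2) A) (k : ℕ) :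
    coord m (∑ i ∈ s, G i) k = ∑ i ∈ s, coord m (G i) k := by
  simp [coord, coeff_sum, smul_sum]

theorem coord_sigma (τ : ℚ × ℚ × ℚ) (F : MvPolynomial (Fin 2) A) (w : Fin 5 → A) (j : Fin 6) :
    coord 5 (sigma F τ (quad (w 0) (w 1) (w 2)) (C (w 3)) (C (w 4))) j =
      Matrix.vecMul w (sigmaMat τ F) j := by
  rw [sigma_quad, coord_sum]
  simp only [coord_C_mul, Matrix.vecMul, dotProduct, sigmaMat, Matrix.of_apply]

theorem map_coord {B : Type} [CommRing B] [Algebra ℚ B] (f : A →+* B) (m : ℕ)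
    (G : MvPolynomial (Fin 2) A) (k : ℕ) : coord m (map f G) k = f (coord m G k) := by
  rw [coord, coord, coeff_map, map_rat_smul]

theorem sigmaMat_map {B : Type} [CommRing B] [Algebra ℚ B] (f : A →+* B) (τ : ℚ × ℚ × ℚ)
    (F : MvPolynomial (Fin 2) A) : sigmaMat τ (map f F) = (sigmaMat τ F).map f := by
  ext i j
  rw [Matrix.map_apply, sigmaMat, sigmaMat, Matrix.of_apply, Matrix.of_apply, ← map_coord]
  congr 1
  fin_cases i <;> simp [sigmaRow, map_sigma]

theorem minor_map {B : Type} [CommRing B] (f : A →+* B) {n : ℕ}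
    (M : Matrix (Fin n) (Fin (n + 1)) A) (j) : minor (M.map f) j = f (minor M j) := by
  rw [minor, minor, RingHom.map_det]; rfl

theorem coord_eq_zero_iff {m : ℕ} {G : MvPolynomial (Fin 2) A} (hG : G.IsHomogeneous m) :
    G = 0 ↔ ∀ j : Fin (m + 1), coord m G j = 0 := by
  constructor
  · rintro rfl j; simp [coord]
  · intro h
    rw [← form_coord hG, ← form_zero m]
    exact form_congr fun k hk => h ⟨k, by omega⟩

end SigmaMatrix

/-! ### Dependence over the complex numbers -/

section Dependence

/-- The map `σ_τ(F)` fails to be injective, for a complex quintic `F`. The vector `w` holds the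
coordinates with respect to `x₁², x₁x₂, x₂², 1, 1`. -/
def Dependent (τ : ℚ × ℚ × ℚ) (F : MvPolynomial (Fin 2) ℂ) : Prop :=
  ∃ w : Fin 5 → ℂ, w ≠ 0 ∧ sigma F τ (quad (w 0) (w 1) (w 2)) (C (w 3)) (C (w 4)) = 0

/-- The rows of a matrix with one more column than rows are dependent if and only if its maximal
minors vanish: otherwise a further row could be chosen outside their span. -/
theorem exists_vecMul_eq_zero_iff_minor {K : Type} [Field K] {n : ℕ}
    (M : Matrix (Fin n) (Fin (n + 1)) K) :
    (∃ w, w ≠ 0 ∧ Matrix.vecMul w M = 0) ↔ ∀ j, minor M j = 0 := by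
  constructor
  · rintro ⟨w, hw, h⟩ j
    rw [minor, ← Matrix.exists_vecMul_eq_zero_iff]
    refine ⟨w, hw, ?_⟩
    ext i
    simpa [Matrix.vecMul, dotProduct] using congrFun h (j.succAbove i)
  · intro h
    by_contra! hne
    have hinj : Function.Injective M.vecMulLinear := by
      rw [injective_iff_map_eq_zero]
      intro w hw
      by_contra h0
      exact hne w h0 hw
    have hrange : LinearMap.range M.vecMulLinear ≠ ⊤ := by
      intro htop
      have h1 := LinearMap.finrank_range_of_inj hinj
      rw [htop, finrank_top] at h1
      simp at h1
    obtain ⟨v, hv⟩ : ∃ v, v ∉ LinearMap.range M.vecMulLinear := by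
      by_contra! hall
      exact hrange (eq_top_iff.mpr fun v _ => hall v)
    have hdet : (bordered v M).det = 0 := by
      rw [det_bordered]; simp [h]
    obtain ⟨u, hu, huv⟩ := Matrix.exists_vecMul_eq_zero_iff.mpr hdet
    have hsum : ∀ j, u 0 * v j + ∑ i, u (Fin.succ i) * M i j = 0 := by
      intro j
      have := congrFun huv j
      rw [Matrix.vecMul, dotProduct, Fin.sum_univ_succ] at this
      simpa [bordered_zero, bordered_succ] using this
    by_cases hu0 : u 0 = 0
    · refine hne (fun i => u i.succ) ?_ ?_
      · intro h0
        apply hu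
        ext i
        refine Fin.cases hu0 (fun i => congrFun h0 i) i
      · ext j
        simpa [hu0, Matrix.vecMul, dotProduct] using hsum j
    · apply hv
      refine ⟨fun i => -(u 0)⁻¹ * u i.succ, ?_⟩
      ext j
      rw [Matrix.vecMulLinear_apply, Matrix.vecMul, dotProduct]
      simp only [mul_assoc, ← mul_sum]
      have := hsum j
      field_simp
      linear_combination -this

theorem dependent_iff_minor (τ : ℚ × ℚ × ℚ) {F : MvPolynomial (Fin 2) ℂ}
    (hF : F.IsHomogeneous 5) : Dependent τ F ↔ ∀ j, minor (sigmaMat τ F) j = 0 := by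
  rw [← exists_vecMul_eq_zero_iff_minor]
  refine exists_congr fun w => and_congr_right fun _ => ?_
  rw [coord_eq_zero_iff (sigma_isHomogeneous hF τ (quad_isHomogeneous _ _ _)
    (isHomogeneous_C _ _) (isHomogeneous_C _ _)), funext_iff]
  exact forall_congr' fun j => by rw [coord_sigma]; rfl

theorem genericQuintic_eq : genericQuintic = form 5 (extend (X : Fin 6 → R)) := by
  rw [form, sum_range]
  exact sum_congr rfl fun i _ => by rw [extend_coe]

theorem genericQuintic_isHomogeneous : genericQuintic.IsHomogeneous 5 := by
  rw [genericQuintic_eq]; exact form_isHomogeneous _ _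

theorem quinticCoord_eq {A : Type} [CommRing A] [Algebra ℚ A] (G : MvPolynomial (Fin 2) A)
    (i : Fin 6) : quinticCoord G i = coord 5 G i := rfl

theorem map_genericQuintic {A : Type} [CommRing A] [Algebra ℚ A] (f : R →+* A)
    {G : MvPolynomial (Fin 2) A} (hG : G.IsHomogeneous 5) (hf : ∀ i, f (X i) = quinticCoord G i) :
    map f genericQuintic = G := by
  rw [genericQuintic_eq, form_map]
  conv_rhs => rw [← form_coord hG]
  refine form_congr fun k hk => ?_
  have := extend_coe (X : Fin 6 → R) ⟨k, by omega⟩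
  simp only at this
  rw [this, hf]
  rfl

theorem idealB_eq (τ : ℚ × ℚ × ℚ) :
    idealB τ = Ideal.span (Set.range (minor (sigmaMat τ genericQuintic))) :=
  span_coeff_Gam τ genericQuintic_isHomogeneous

/-- The zero locus of `𝔟_τ` consists of the quintics `F` for which `σ_τ(F)` is not injective. -/
theorem dependent_iff_idealB (τ : ℚ × ℚ × ℚ) {F : MvPolynomial (Fin 2) ℂ}
    (hF : F.IsHomogeneous 5) :
    Dependent τ F ↔ ∀ f ∈ idealB τ, eval (quinticCoord F) f = 0 := by
  have hmap : map (eval (quinticCoord F)) genericQuintic = F :=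
    map_genericQuintic _ hF fun i => eval_X i
  have hm : ∀ j, minor (sigmaMat τ F) j =
      eval (quinticCoord F) (minor (sigmaMat τ genericQuintic) j) := by
    intro j
    rw [← minor_map, ← sigmaMat_map, hmap]
  rw [dependent_iff_minor τ hF, idealB_eq]
  constructor
  · intro h f hf
    have : Ideal.span (Set.range (minor (sigmaMat τ genericQuintic))) ≤
        RingHom.ker (eval (quinticCoord F)) := by
      rw [Ideal.span_le]
      rintro _ ⟨j, rfl⟩
      exact (hm j).symm.trans (h j)
    exact this hf
  · intro h j
    rw [hm]
    exact h _ (Ideal.subset_span ⟨j, rfl⟩)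

end Dependence

/-! ### Characters of `SL₂` -/

section SL2

/-- The upper unipotent matrix with entry `t`. -/
def upper (t : ℂ) : SL2 := ⟨!![1, t; 0, 1], by simp [Matrix.det_fin_two]⟩

/-- The lower unipotent matrix with entry `t`. -/
def lower (t : ℂ) : SL2 := ⟨!![1, 0; t, 1], by simp [Matrix.det_fin_two]⟩

/-- The diagonal matrix with entries `t` and `t⁻¹`. -/
def torus (t : ℂ) (ht : t ≠ 0) : SL2 := ⟨!![t, 0; 0, t⁻¹], by simp [Matrix.det_fin_two, ht]⟩

theorem coe_upper (t : ℂ) : (upper t : Matrix (Fin 2) (Fin 2) ℂ) = !![1, t; 0, 1] := rfl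

theorem coe_lower (t : ℂ) : (lower t : Matrix (Fin 2) (Fin 2) ℂ) = !![1, 0; t, 1] := rfl

theorem coe_torus (t : ℂ) (ht : t ≠ 0) :
    (torus t ht : Matrix (Fin 2) (Fin 2) ℂ) = !![t, 0; 0, t⁻¹] := rfl

theorem SL2_ext {g h : SL2} (e : (g : Matrix (Fin 2) (Fin 2) ℂ) = h) : g = h := Subtype.ext e

theorem matrix_two_congr {a b c d a' b' c' d' : ℂ} (ha : a = a') (hb : b = b') (hc : c = c')
    (hd : d = d') : !![a, b; c, d] = !![a', b'; c', d'] := by rw [ha, hb, hc, hd]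

/-- Every character of `SL₂` is trivial: the group is generated by unipotent matrices, and these are
commutators. -/
theorem map_SL2_eq_one {N : Type*} [CommMonoid N] (χ : SL2 →* N) (g : SL2) : χ g = 1 := by
  have h2 : (2 : ℂ) ≠ 0 := two_ne_zero
  have h2' : (2⁻¹ : ℂ) ≠ 0 := inv_ne_zero h2
  have hD : χ (torus 2 h2) * χ (torus 2⁻¹ h2') = 1 := by
    rw [← map_mul, ← map_one χ]
    congr 1
    apply SL2_ext
    rw [Matrix.SpecialLinearGroup.coe_mul, coe_torus, coe_torus, Matrix.mul_fin_two,
      Matrix.SpecialLinearGroup.coe_one, Matrix.one_fin_two]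
    apply matrix_two_congr <;> norm_num
  -- a unipotent matrix is a commutator of a torus element and a unipotent matrix
  have hU : ∀ t, χ (upper t) = 1 := by
    intro t
    have e1 : upper t = torus 2 h2 * upper (t / 3) * torus 2⁻¹ h2' * upper (-(t / 3)) := by
      apply SL2_ext
      simp only [Matrix.SpecialLinearGroup.coe_mul, coe_torus, coe_upper, Matrix.mul_fin_two]
      apply matrix_two_congr <;> ring
    have e2 : χ (upper (t / 3)) * χ (upper (-(t / 3))) = 1 := by
      rw [← map_mul, ← map_one χ]
      congr 1
      apply SL2_ext
      rw [Matrix.SpecialLinearGroup.coe_mul, coe_upper, coe_upper, Matrix.mul_fin_two,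
        Matrix.SpecialLinearGroup.coe_one, Matrix.one_fin_two]
      apply matrix_two_congr <;> ring
    rw [e1, map_mul, map_mul, map_mul, mul_right_comm (χ (torus 2 h2)), hD, one_mul, e2]
  have hL : ∀ t, χ (lower t) = 1 := by
    intro t
    have e1 : lower t = torus 2⁻¹ h2' * lower (t / 3) * torus 2 h2 * lower (-(t / 3)) := by
      apply SL2_ext
      simp only [Matrix.SpecialLinearGroup.coe_mul, coe_torus, coe_lower, Matrix.mul_fin_two]
      apply matrix_two_congr <;> ring
    have e2 : χ (lower (t / 3)) * χ (lower (-(t / 3))) = 1 := by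
      rw [← map_mul, ← map_one χ]
      congr 1
      apply SL2_ext
      rw [Matrix.SpecialLinearGroup.coe_mul, coe_lower, coe_lower, Matrix.mul_fin_two,
        Matrix.SpecialLinearGroup.coe_one, Matrix.one_fin_two]
      apply matrix_two_congr <;> ring
    rw [e1, map_mul, map_mul, map_mul, mul_right_comm (χ (torus 2⁻¹ h2')), mul_comm (χ (torus _ _)),
      hD, one_mul, e2]
  -- the product of three unipotent matrices is arbitrary with a nonzero lower left entry
  have key : ∀ g : SL2, g 1 0 ≠ 0 → χ g = 1 := by
    intro g hc
    have hdet : g 0 0 * g 1 1 - g 0 1 * g 1 0 = 1 := by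
      rw [← Matrix.det_fin_two]; exact g.2
    have e : g = upper ((g 0 0 - 1) / g 1 0) * lower (g 1 0) * upper ((g 1 1 - 1) / g 1 0) := by
      apply SL2_ext
      simp only [Matrix.SpecialLinearGroup.coe_mul, coe_upper, coe_lower, Matrix.mul_fin_two]
      refine (Matrix.eta_fin_two (g : Matrix (Fin 2) (Fin 2) ℂ)).trans ?_
      apply matrix_two_congr <;> field_simp <;> first | ring1 | linear_combination -hdet
    rw [e, map_mul, map_mul, hU, hL, hU]; simp
  by_cases hc : g 1 0 = 0
  · have hdet : g 0 0 * g 1 1 - g 0 1 * g 1 0 = 1 := by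
      rw [← Matrix.det_fin_two]; exact g.2
    have ha : g 0 0 ≠ 0 := by
      rintro h; rw [h, hc] at hdet; simp at hdet
    have h1 := key (lower 1 * g) (by
      rw [Matrix.SpecialLinearGroup.coe_mul, coe_lower, Matrix.mul_apply, Fin.sum_univ_two]
      simpa [hc] using ha)
    rwa [map_mul, hL, one_mul] at h1
  · exact key g hc

end SL2

/-! ### Linear substitutions on forms -/

section Subst
variable {A : Type} [CommRing A]

theorem substM_C [Algebra ℚ A] (h : Matrix (Fin 2) (Fin 2) A) (c : A) :
    substM h (C c) = C c := by simp [substM]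

theorem substM_X (h : Matrix (Fin 2) (Fin 2) A) (j : Fin 2) :
    substM h (X j) = C (h 0 j) * X 0 + C (h 1 j) * X 1 := by
  simp [substM, Fin.sum_univ_two]

theorem substM_substM (h k : Matrix (Fin 2) (Fin 2) A) (G : MvPolynomial (Fin 2) A) :
    substM h (substM k G) = substM (h * k) G := by
  have : (substM h).comp (substM k) = substM (h * k) := by
    apply MvPolynomial.algHom_ext
    intro j
    rw [AlgHom.comp_apply, substM_X, substM_X, map_add, map_mul, map_mul, substM_X, substM_X]
    simp only [Matrix.mul_apply, Fin.sum_univ_two, map_add, map_mul, substM, aeval_C,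
      algebraMap_eq]
    ring
  exact DFunLike.congr_fun this G

theorem substM_one (G : MvPolynomial (Fin 2) A) : substM (1 : Matrix (Fin 2) (Fin 2) A) G = G := by
  have : substM (1 : Matrix (Fin 2) (Fin 2) A) = AlgHom.id A _ := by
    apply MvPolynomial.algHom_ext
    intro j
    rw [substM_X]
    revert j
    rw [Fin.forall_fin_two]
    simp
  rw [this]; rfl

theorem map_substM {B : Type} [CommRing B] (f : A →+* B) (h : Matrix (Fin 2) (Fin 2) A)
    (G : MvPolynomial (Fin 2) A) : map f (substM h G) = substM (h.map f) (map f G) := by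
  induction G using MvPolynomial.induction_on with
  | C a => simp [substM]
  | add p q hp hq => simp only [map_add, hp, hq]
  | mul_X p j hp => rw [map_mul, map_mul, hp, map_mul, map_mul, substM_X, map_X, substM_X]; simp

theorem substM_isHomogeneous (h : Matrix (Fin 2) (Fin 2) A) {m : ℕ} {G : MvPolynomial (Fin 2) A}
    (hG : G.IsHomogeneous m) : (substM h G).IsHomogeneous m := by
  have h2 : ∀ j : Fin 2, (∑ i : Fin 2, C (h i j) * X i : MvPolynomial (Fin 2) A).IsHomogeneous 1 :=
    fun j => IsHomogeneous.sum _ _ _ fun i _ => isHomogeneous_C_mul_X _ i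
  have h3 := hG.aeval _ h2
  rwa [one_mul] at h3

variable [Algebra ℚ A]

/-- The matrix by which the substitution `h` acts on the coordinates of forms of order `m`, written
as row vectors. -/
def symMat (m : ℕ) (h : Matrix (Fin 2) (Fin 2) A) : Matrix (Fin (m + 1)) (Fin (m + 1)) A :=
  Matrix.of fun k j => coord m (substM h (form m (Pi.single (k : ℕ) 1))) j

theorem form_eq_sum (m : ℕ) (g : ℕ → A) :
    form m g = ∑ k : Fin (m + 1), C (g k) * form m (Pi.single (k : ℕ) 1) := by
  simp only [form_C_mul, form_sum]
  refine form_congr fun k hk => ?_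
  rw [sum_eq_single ⟨k, by omega⟩]
  · simp
  · intro b _ hb
    rw [Pi.single_eq_of_ne, mul_zero]
    intro h; apply hb; ext; exact h.symm
  · simp

theorem coord_substM {m : ℕ} (h : Matrix (Fin 2) (Fin 2) A) {G : MvPolynomial (Fin 2) A}
    (hG : G.IsHomogeneous m) (j : Fin (m + 1)) :
    coord m (substM h G) j = Matrix.vecMul (fun k : Fin (m + 1) => coord m G k) (symMat m h) j := by
  conv_lhs => rw [← form_coord hG, form_eq_sum]
  simp only [map_sum, map_mul, substM_C, coord_sum, coord_C_mul, Matrix.vecMul, dotProduct, symMat,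
    Matrix.of_apply]

theorem symMat_mul (m : ℕ) (h k : Matrix (Fin 2) (Fin 2) A) :
    symMat m (h * k) = symMat m k * symMat m h := by
  ext i j
  rw [Matrix.mul_apply, symMat, Matrix.of_apply, ← substM_substM,
    coord_substM h (substM_isHomogeneous k (form_isHomogeneous m _))]
  rfl

theorem symMat_one (m : ℕ) : symMat m (1 : Matrix (Fin 2) (Fin 2) A) = 1 := by
  ext i j
  rw [symMat, Matrix.of_apply, substM_one, coord_form (by have := j.2; omega), Pi.single_apply,
    Matrix.one_apply]
  simp [Fin.ext_iff, eq_comm]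

theorem symMat_map {B : Type} [CommRing B] [Algebra ℚ B] (f : A →+* B) (m : ℕ)
    (h : Matrix (Fin 2) (Fin 2) A) : symMat m (h.map f) = (symMat m h).map f := by
  ext i j
  rw [Matrix.map_apply, symMat, symMat, Matrix.of_apply, Matrix.of_apply, ← map_coord, map_substM,
    form_map]
  congr 3
  ext k
  by_cases hk : k = i
  · subst hk; simp
  · simp [hk]

/-- Characters of `SL₂` are trivial, so `SL₂` acts on binary forms with determinant one. -/
theorem det_symMat (m : ℕ) (g : SL2) : (symMat m (g : Matrix (Fin 2) (Fin 2) ℂ)).det = 1 := by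
  let χ : SL2 →* ℂ :=
    { toFun := fun g => (symMat m (g : Matrix (Fin 2) (Fin 2) ℂ)).det
      map_one' := by rw [Matrix.SpecialLinearGroup.coe_one, symMat_one, Matrix.det_one]
      map_mul' := fun g h => by
        rw [Matrix.SpecialLinearGroup.coe_mul, symMat_mul, Matrix.det_mul, mul_comm] }
  exact map_SL2_eq_one χ g

end Subst

/-! ### Equivariance -/

section Equivariance

/-- The matrix `g`, with entries regarded as constants of `R`. -/
def matR (g : SL2) : Matrix (Fin 2) (Fin 2) R :=
  (g : Matrix (Fin 2) (Fin 2) ℂ).map (algebraMap ℂ R)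

theorem det_matR (g : SL2) : (matR g).det = 1 := by
  have h := RingHom.map_det (algebraMap ℂ R) (g : Matrix (Fin 2) (Fin 2) ℂ)
  rw [g.2, map_one] at h
  exact h.symm

theorem subst_eq (g : SL2) (G : MvPolynomial (Fin 2) R) : subst g G = substM (matR g) G := rfl

theorem actPoly_eq (g : SL2) (G : MvPolynomial (Fin 2) R) :
    actPoly g G = substM (matR g) (map (actR g : R →+* R) G) := rfl

theorem matR_mul (g h : SL2) : matR (g * h) = matR g * matR h := by
  rw [matR, Matrix.SpecialLinearGroup.coe_mul, Matrix.map_mul]; rfl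

theorem matR_one : matR 1 = 1 := by
  rw [matR, Matrix.SpecialLinearGroup.coe_one]
  exact Matrix.map_one _ (map_zero _) (map_one _)

theorem map_actR_genericQuintic (g : SL2) :
    map (actR g : R →+* R) genericQuintic = subst g⁻¹ genericQuintic :=
  map_genericQuintic _ (substM_isHomogeneous _ genericQuintic_isHomogeneous) fun i => by
    simp [actR]

/-- The generic quintic is an invariant of the diagonal action on `R ⊗ S_5`. -/
theorem actPoly_genericQuintic (g : SL2) : actPoly g genericQuintic = genericQuintic := by
  rw [actPoly_eq, map_actR_genericQuintic, subst_eq, substM_substM, ← matR_mul, mul_inv_cancel,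
    matR_one, substM_one]

theorem actPoly_sigma (g : SL2) (τ : ℚ × ℚ × ℚ) (G c₁ c₂ : MvPolynomial (Fin 2) R) :
    actPoly g (sigma genericQuintic τ G c₁ c₂) =
      sigma genericQuintic τ (actPoly g G) (actPoly g c₁) (actPoly g c₂) := by
  have h := sigma_substM (map (actR g : R →+* R) genericQuintic) (matR g) τ
    (map (actR g : R →+* R) G) (map (actR g : R →+* R) c₁) (map (actR g : R →+* R) c₂)
  rw [det_matR] at h
  simp only [one_pow, C_1, one_mul] at h
  rw [actPoly_eq, map_sigma, ← h]
  conv_rhs => rw [← actPoly_genericQuintic g]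
  rfl

/-- The matrix by which the substitution `h` acts on `S₂ ⊕ S₀ ⊕ S₀`; its rows are the images of
`x₁², x₁x₂, x₂², 1, 1`, expressed in this basis. -/
def sourceMat {A : Type} [CommRing A] (h : Matrix (Fin 2) (Fin 2) A) : Matrix (Fin 5) (Fin 5) A :=
  !![h 0 0 ^ 2, 2 * h 0 0 * h 1 0, h 1 0 ^ 2, 0, 0;
    h 0 0 * h 0 1, h 0 0 * h 1 1 + h 1 0 * h 0 1, h 1 0 * h 1 1, 0, 0;
    h 0 1 ^ 2, 2 * h 0 1 * h 1 1, h 1 1 ^ 2, 0, 0;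
    0, 0, 0, 1, 0;
    0, 0, 0, 0, 1]

theorem det_sourceMat {A : Type} [CommRing A] (h : Matrix (Fin 2) (Fin 2) A) :
    (sourceMat h).det = h.det ^ 3 := by
  rw [Matrix.det_fin_two]
  simp [sourceMat, Matrix.det_succ_row_zero, Fin.sum_univ_succ, Fin.succAbove]
  ring

theorem actPoly_sigmaRow (g : SL2) (τ : ℚ × ℚ × ℚ) (i : Fin 5) :
    actPoly g (sigmaRow τ genericQuintic i) =
      ∑ k, C (sourceMat (matR g) i k) * sigmaRow τ genericQuintic k := by
  have hX : ∀ j, actPoly g (X j) = C (matR g 0 j) * X 0 + C (matR g 1 j) * X 1 := by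
    intro j; rw [actPoly_eq, map_X, substM_X]
  have hm : ∀ p q, actPoly g (p * q) = actPoly g p * actPoly g q := by
    intro p q; simp only [actPoly_eq, map_mul]
  have hp : ∀ p (n : ℕ), actPoly g (p ^ n) = actPoly g p ^ n := by
    intro p n; simp only [actPoly_eq, map_pow]
  have h0 : actPoly g 0 = 0 := by simp [actPoly_eq]
  have h1 : actPoly g 1 = 1 := by simp [actPoly_eq]
  have e0 : actPoly g (X 0 ^ 2) = quad (sourceMat (matR g) 0 0) (sourceMat (matR g) 0 1)
      (sourceMat (matR g) 0 2) := by
    rw [hp, hX, quad]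
    simp only [sourceMat, Matrix.of_apply, Matrix.cons_val, map_mul, map_pow, map_ofNat]
    ring
  have e1 : actPoly g (X 0 * X 1) = quad (sourceMat (matR g) 1 0) (sourceMat (matR g) 1 1)
      (sourceMat (matR g) 1 2) := by
    rw [hm, hX, hX, quad]
    simp only [sourceMat, Matrix.of_apply, Matrix.cons_val, map_mul, map_add]
    ring
  have e2 : actPoly g (X 1 ^ 2) = quad (sourceMat (matR g) 2 0) (sourceMat (matR g) 2 1)
      (sourceMat (matR g) 2 2) := by
    rw [hp, hX, quad]
    simp only [sourceMat, Matrix.of_apply, Matrix.cons_val, map_mul, map_pow, map_ofNat]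
    ring
  rw [← sigma_quad τ genericQuintic (sourceMat (matR g) i)]
  have key : ∀ (G c₁ c₂ : MvPolynomial (Fin 2) R) (w : Fin 5 → R),
      actPoly g G = quad (w 0) (w 1) (w 2) → actPoly g c₁ = C (w 3) → actPoly g c₂ = C (w 4) →
      actPoly g (sigma genericQuintic τ G c₁ c₂) =
        sigma genericQuintic τ (quad (w 0) (w 1) (w 2)) (C (w 3)) (C (w 4)) := by
    intro G c₁ c₂ w hG hc₁ hc₂
    rw [actPoly_sigma, hG, hc₁, hc₂]
  have hq : quad (0 : R) 0 0 = 0 := by simp [quad]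
  fin_cases i
  · exact key _ _ _ _ e0 (h0.trans C_0.symm) (h0.trans C_0.symm)
  · exact key _ _ _ _ e1 (h0.trans C_0.symm) (h0.trans C_0.symm)
  · exact key _ _ _ _ e2 (h0.trans C_0.symm) (h0.trans C_0.symm)
  · exact key _ _ _ _ (h0.trans hq.symm) (h1.trans C_1.symm) (h0.trans C_0.symm)
  · exact key _ _ _ _ (h0.trans hq.symm) (h0.trans C_0.symm) (h1.trans C_1.symm)

/-- The equivariance of `σ_τ(𝔽)` in terms of matrices. -/
theorem sourceMat_mul_sigmaMat (g : SL2) (τ : ℚ × ℚ × ℚ) :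
    sourceMat (matR g) * sigmaMat τ genericQuintic =
      (sigmaMat τ genericQuintic).map (actR g : R →+* R) * symMat 5 (matR g) := by
  ext1 i j
  have h1 := congrArg (fun G => coord 5 G j) (actPoly_sigmaRow g τ i)
  simp only [coord_sum, coord_C_mul, actPoly_eq] at h1
  rw [coord_substM _
    (IsHomogeneous.map (sigmaRow_isHomogeneous τ genericQuintic_isHomogeneous i) _)] at h1
  rw [Matrix.mul_apply, Matrix.mul_apply]
  simp only [Matrix.vecMul, dotProduct, map_coord] at h1
  exact h1.symm

theorem bordered_mul {A : Type} [CommRing A] {n : ℕ} (v : Fin (n + 1) → A)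
    (M : Matrix (Fin n) (Fin (n + 1)) A) (P : Matrix (Fin (n + 1)) (Fin (n + 1)) A) :
    bordered v M * P = bordered (Matrix.vecMul v P) (M * P) := by
  ext i j
  refine Fin.cases ?_ (fun i => ?_) i
  · rw [Matrix.mul_apply, bordered_zero]; rfl
  · rw [Matrix.mul_apply, bordered_succ, Matrix.mul_apply]; rfl

theorem minor_mul {A : Type} [CommRing A] {n : ℕ} (S : Matrix (Fin n) (Fin n) A)
    (M : Matrix (Fin n) (Fin (n + 1)) A) (j : Fin (n + 1)) :
    minor (S * M) j = S.det * minor M j := by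
  rw [minor, minor, ← Matrix.det_mul]; rfl

/-- The map `G ↦ det (G, M)` is equivariant, since `σ_τ(𝔽)` is and since `SL₂` acts with determinant
one on `S_5` and on `S₂ ⊕ S₀ ⊕ S₀`. -/
theorem borderedDet_equivariant (g : SL2) (τ : ℚ × ℚ × ℚ) {G : MvPolynomial (Fin 2) R}
    (hG : G.IsHomogeneous 5) :
    borderedDet (sigmaMat τ genericQuintic) (fun j : Fin 6 => coord 5 (actPoly g G) j) =
      actR g (borderedDet (sigmaMat τ genericQuintic) (fun j : Fin 6 => coord 5 G j)) := by
  set M := sigmaMat τ genericQuintic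
  set v : Fin 6 → R := fun j => coord 5 G j
  set φ : R →+* R := (actR g : R →+* R)
  have hv : (fun j : Fin 6 => coord 5 (actPoly g G) j) =
      Matrix.vecMul (fun j => φ (v j)) (symMat 5 (matR g)) := by
    ext1 j
    rw [actPoly_eq, coord_substM _ (hG.map _)]
    simp only [map_coord]; rfl
  have hP : (symMat 5 (matR g)).det = 1 := by
    have h := RingHom.map_det (algebraMap ℂ R) (symMat 5 (g : Matrix (Fin 2) (Fin 2) ℂ))
    rw [det_symMat, map_one] at h
    rw [matR, symMat_map]
    exact h.symm
  have hS : ∀ u, borderedDet (sourceMat (matR g) * M) u = borderedDet M u := by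
    intro u
    rw [borderedDet_apply, borderedDet_apply, det_bordered, det_bordered]
    simp only [minor_mul, det_sourceMat, det_matR, one_pow, one_mul]
  have hb : bordered (fun j => φ (v j)) (M.map φ) = (bordered v M).map φ := by
    ext i j
    refine Fin.cases ?_ (fun i => ?_) i <;> rfl
  rw [hv, ← hS, sourceMat_mul_sigmaMat, borderedDet_apply, ← bordered_mul, Matrix.det_mul, hP,
    mul_one, hb, borderedDet_apply]
  exact (RingHom.map_det φ _).symm

theorem actR_mem_idealB (g : SL2) (τ : ℚ × ℚ × ℚ) {f : R} (hf : f ∈ idealB τ) :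
    actR g f ∈ idealB τ := by
  rw [idealB_eq, ← range_borderedDet] at hf ⊢
  obtain ⟨v, rfl⟩ := hf
  have h := borderedDet_equivariant g τ (form_isHomogeneous 5 (extend v))
  have hv : (fun j : Fin 6 => coord 5 (form 5 (extend v)) j) = v := by
    ext1 j; rw [coord_form (by have := j.2; omega), extend_coe]
  rw [hv] at h
  exact ⟨_, h⟩

end Equivariance

/-! ### Coordinate formulas over the complex numbers -/

/-- The sequence with the given first terms, continued by zero. -/
def seq (l : List ℂ) (k : ℕ) : ℂ := l.getD k 0

theorem form_order_zero {A : Type} [CommRing A] [Algebra ℚ A] (g : ℕ → A) : form 0 g = C (g 0) := by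
  simp [form, expo]

theorem form_sub {A : Type} [CommRing A] [Algebra ℚ A] (m : ℕ) (g h : ℕ → A) :
    form m g - form m h = form m (fun k => g k - h k) := by
  simp [form, mul_sub, sum_sub_distrib]

section Coordinates

variable (a : ℕ → ℂ)

/-- The coordinates of `ϑ₂₂`, again with binomial coefficients split off, for the quintic with
coordinates `a`. -/
def coordQ : ℕ → ℂ :=
  seq [2 * (a 0 * a 4 - 4 * a 1 * a 3 + 3 * a 2 ^ 2), a 0 * a 5 - 3 * a 1 * a 4 + 2 * a 2 * a 3,
    2 * (a 1 * a 5 - 4 * a 2 * a 4 + 3 * a 3 ^ 2)]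

/-- The coordinates of `ϑ₂₆`. -/
def coordH : ℕ → ℂ :=
  seq [2 * (a 0 * a 2 - a 1 ^ 2), a 0 * a 3 - a 1 * a 2,
    2 * (a 0 * a 4 + a 1 * a 3 - 2 * a 2 ^ 2) / 5,
    (a 0 * a 5 + 7 * a 1 * a 4 - 8 * a 2 * a 3) / 10,
    2 * (a 1 * a 5 + a 2 * a 4 - 2 * a 3 ^ 2) / 5, a 2 * a 5 - a 3 * a 4,
    2 * (a 3 * a 5 - a 4 ^ 2)]

/-- The coordinates of `ϑ₃₃`. -/
def coordT (k : ℕ) : ℂ :=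
  coordQ a 0 * a (k + 2) - 2 * coordQ a 1 * a (k + 1) + coordQ a 2 * a k

/-- The value of `ϑ₄₀`. -/
def coordD : ℂ := 2 * (coordQ a 0 * coordQ a 2 - coordQ a 1 ^ 2)

/-- The coordinates of `ϑ₂₂²`. -/
def coordQ2 : ℕ → ℂ :=
  seq [coordQ a 0 ^ 2, coordQ a 0 * coordQ a 1, (coordQ a 0 * coordQ a 2 + 2 * coordQ a 1 ^ 2) / 3,
    coordQ a 1 * coordQ a 2, coordQ a 2 ^ 2]

/-- The coordinates of `ϑ₂₂³`. -/
def coordQ3 : ℕ → ℂ :=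
  seq [coordQ a 0 ^ 3, coordQ a 0 ^ 2 * coordQ a 1,
    (coordQ a 0 ^ 2 * coordQ a 2 + 4 * coordQ a 0 * coordQ a 1 ^ 2) / 5,
    (3 * coordQ a 0 * coordQ a 1 * coordQ a 2 + 2 * coordQ a 1 ^ 3) / 5,
    (coordQ a 0 * coordQ a 2 ^ 2 + 4 * coordQ a 1 ^ 2 * coordQ a 2) / 5,
    coordQ a 1 * coordQ a 2 ^ 2, coordQ a 2 ^ 3]

/-- The coordinates of `ϑ₅₁`. -/
def coordE (k : ℕ) : ℂ :=
  coordQ2 a 0 * a (k + 4) - 4 * coordQ2 a 1 * a (k + 3) + 6 * coordQ2 a 2 * a (k + 2) -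
    4 * coordQ2 a 3 * a (k + 1) + coordQ2 a 4 * a k

/-- The value of `ϑ₈₀`. -/
def coordZ : ℂ :=
  coordQ3 a 0 * coordH a 6 - 6 * coordQ3 a 1 * coordH a 5 + 15 * coordQ3 a 2 * coordH a 4 -
    20 * coordQ3 a 3 * coordH a 3 + 15 * coordQ3 a 4 * coordH a 2 - 6 * coordQ3 a 5 * coordH a 1 +
    coordQ3 a 6 * coordH a 0

theorem theta22_form : theta22 (form 5 a) = form 2 (coordQ a) := by
  rw [theta22, transvectant_form (by decide)]
  refine form_congr fun k hk => ?_
  interval_cases k <;>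
    simp [transC, conv, sum_range_succ, Nat.choose, coordQ, seq, Rat.smul_def] <;> ring

theorem theta26_form : theta26 (form 5 a) = form 6 (coordH a) := by
  rw [theta26, transvectant_form (by decide)]
  refine form_congr fun k hk => ?_
  interval_cases k <;>
    simp [transC, conv, sum_range_succ, Nat.choose, coordH, seq, Rat.smul_def] <;> ring

theorem theta33_form : theta33 (form 5 a) = form 3 (coordT a) := by
  rw [theta33, theta22_form, transvectant_form (by decide)]
  refine form_congr fun k hk => ?_
  interval_cases k <;>
    simp [transC, conv, sum_range_succ, Nat.choose, coordT, Rat.smul_def] <;> ring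

theorem theta40_form : theta40 (form 5 a) = C (coordD a) := by
  rw [theta40, theta22_form, transvectant_form (by decide), form_order_zero]
  congr 1
  simp [transC, conv, sum_range_succ, Nat.choose, coordD, Rat.smul_def]
  ring

theorem form_sq_coordQ : form 2 (coordQ a) ^ 2 = form 4 (coordQ2 a) := by
  rw [sq, form_mul]
  refine form_congr fun k hk => ?_
  interval_cases k <;>
    simp [conv, sum_range_succ, Nat.choose, coordQ2, seq, Rat.smul_def] <;> ring

theorem form_cube_coordQ : form 2 (coordQ a) ^ 3 = form 6 (coordQ3 a) := by
  rw [pow_succ, form_sq_coordQ, form_mul]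
  refine form_congr fun k hk => ?_
  interval_cases k <;>
    simp [conv, sum_range_succ, Nat.choose, coordQ2, coordQ3, seq, Rat.smul_def] <;> ring

theorem theta51_form : theta51 (form 5 a) = form 1 (coordE a) := by
  rw [theta51, theta22_form, form_sq_coordQ, transvectant_form (by decide)]
  refine form_congr fun k hk => ?_
  interval_cases k <;>
    simp [transC, conv, sum_range_succ, Nat.choose, coordE, Rat.smul_def] <;> ring

theorem theta80_form : theta80 (form 5 a) = C (coordZ a) := by
  rw [theta80, theta22_form, form_cube_coordQ, theta26_form, transvectant_form (by decide),
    form_order_zero]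
  congr 1
  simp [transC, conv, sum_range_succ, Nat.choose, coordZ, Rat.smul_def]
  ring

/-- The coordinates of `𝒰`. -/
def coordU (α : ℚ) (k : ℕ) : ℂ :=
  seq [coordT a 0 * coordQ a 0, (2 * coordT a 0 * coordQ a 1 + 3 * coordT a 1 * coordQ a 0) / 5,
    (coordT a 0 * coordQ a 2 + 6 * coordT a 1 * coordQ a 1 + 3 * coordT a 2 * coordQ a 0) / 10,
    (3 * coordT a 1 * coordQ a 2 + 6 * coordT a 2 * coordQ a 1 + coordT a 3 * coordQ a 0) / 10,
    (3 * coordT a 2 * coordQ a 2 + 2 * coordT a 3 * coordQ a 1) / 5, coordT a 3 * coordQ a 2] k -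
  α * coordD a * a k

/-- The coordinates of `𝒱`. -/
def coordV (β γ : ℚ) (k : ℕ) : ℂ :=
  seq [coordE a 0 * coordQ2 a 0, (4 * coordE a 0 * coordQ2 a 1 + coordE a 1 * coordQ2 a 0) / 5,
    (3 * coordE a 0 * coordQ2 a 2 + 2 * coordE a 1 * coordQ2 a 1) / 5,
    (2 * coordE a 0 * coordQ2 a 3 + 3 * coordE a 1 * coordQ2 a 2) / 5,
    (coordE a 0 * coordQ2 a 4 + 4 * coordE a 1 * coordQ2 a 3) / 5, coordE a 1 * coordQ2 a 4] k -
  (β * coordD a ^ 2 + γ * coordZ a) * a k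

theorem covU_form (α : ℚ) : covU (form 5 a) α = form 5 (coordU a α) := by
  rw [covU, theta33_form, theta22_form, theta40_form, form_mul, form_C_mul, form_smul,
    ← sub_eq_zero, form_sub, form_sub, ← form_zero 5]
  refine form_congr fun k hk => ?_
  interval_cases k <;>
    simp [conv, sum_range_succ, Nat.choose, coordU, seq, Rat.smul_def] <;> ring

theorem covV_form (β γ : ℚ) : covV (form 5 a) β γ = form 5 (coordV a β γ) := by
  rw [covV, theta51_form, theta22_form, theta40_form, theta80_form, form_sq_coordQ, form_mul,
    ← C_pow, form_C_mul, form_C_mul, form_smul, form_smul, ← sub_eq_zero, form_sub, form_sub,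
    form_sub, ← form_zero 5]
  refine form_congr fun k hk => ?_
  interval_cases k <;>
    simp [conv, sum_range_succ, Nat.choose, coordV, seq, Rat.smul_def] <;> ring

theorem quad_eq_form (b c d : ℂ) : quad b c d = form 2 (seq [b, c / 2, d]) := by
  have h : expo 1 1 = Finsupp.single 0 1 + Finsupp.single 1 1 := rfl
  simp only [quad, form, sum_range_succ, range_one, sum_singleton, seq, X, monomial_pow,
    monomial_mul, C_mul_monomial, expo]
  simp [mul_div_cancel₀]

/-- The coordinates of `σ_τ(F)` at the vector `w`, for the quintic `F` with coordinates `a`. -/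
def coordSigma (τ : ℚ × ℚ × ℚ) (w : Fin 5 → ℂ) (k : ℕ) : ℂ :=
  w 0 * ((5 - k) / 5 * a (k + 1)) + w 1 * ((2 * k - 5) / 10 * a k) - w 2 * (k / 5 * a (k - 1)) +
    w 3 * coordU a τ.1 k + w 4 * coordV a τ.2.1 τ.2.2 k

theorem sigma_form (τ : ℚ × ℚ × ℚ) (w : Fin 5 → ℂ) :
    sigma (form 5 a) τ (quad (w 0) (w 1) (w 2)) (C (w 3)) (C (w 4)) =
      form 5 (coordSigma a τ w) := by
  rw [sigma, quad_eq_form, transvectant_form (by decide), covU_form, covV_form, form_C_mul,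
    form_C_mul, form_add, form_add]
  refine form_congr fun k hk => ?_
  interval_cases k <;>
    simp [transC, conv, sum_range_succ, Nat.choose, coordSigma, seq, Rat.smul_def] <;> ring

theorem dependent_form_iff (τ : ℚ × ℚ × ℚ) :
    Dependent τ (form 5 a) ↔ ∃ w : Fin 5 → ℂ, w ≠ 0 ∧ ∀ k ≤ 5, coordSigma a τ w k = 0 := by
  refine exists_congr fun w => and_congr_right fun _ => ?_
  rw [sigma_form]
  constructor
  · intro h k hk
    rw [← coord_form hk (coordSigma a τ w), h]
    simp [coord]
  · intro h
    rw [form_congr (h := (0 : ℕ → ℂ)) h, form_zero]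

end Coordinates

/-! ### Degrees -/

section Degree

variable {G H : MvPolynomial (Fin 2) R} {d d' : ℕ}

/-- All coefficients of `G` are homogeneous of degree `d` in `a₀, …, a₅`. -/
def CoeffDegree (d : ℕ) (G : MvPolynomial (Fin 2) R) : Prop :=
  ∀ e, (coeff e G).IsHomogeneous d

theorem CoeffDegree.add (hG : CoeffDegree d G) (hH : CoeffDegree d H) : CoeffDegree d (G + H) :=
  fun e => by rw [coeff_add]; exact (hG e).add (hH e)

theorem CoeffDegree.zero : CoeffDegree d (0 : MvPolynomial (Fin 2) R) :=
  fun e => by rw [coeff_zero]; exact isHomogeneous_zero _ _ _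

theorem CoeffDegree.sum {ι : Type*} {s : Finset ι} {G : ι → MvPolynomial (Fin 2) R}
    (h : ∀ i ∈ s, CoeffDegree d (G i)) : CoeffDegree d (∑ i ∈ s, G i) :=
  fun e => by rw [coeff_sum]; exact IsHomogeneous.sum _ _ _ fun i hi => h i hi e

theorem CoeffDegree.smul (c : ℚ) (hG : CoeffDegree d G) : CoeffDegree d (c • G) := fun e => by
  rw [coeff_smul]; exact isHomogeneous_rat_smul (hG e) c

theorem CoeffDegree.sub (hG : CoeffDegree d G) (hH : CoeffDegree d H) : CoeffDegree d (G - H) :=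
  fun e => by rw [coeff_sub]; exact (hG e).sub (hH e)

theorem CoeffDegree.mul (hG : CoeffDegree d G) (hH : CoeffDegree d' H) :
    CoeffDegree (d + d') (G * H) := fun e => by
  rw [coeff_mul]; exact IsHomogeneous.sum _ _ _ fun i _ => (hG i.1).mul (hH i.2)

theorem CoeffDegree.pow (hG : CoeffDegree d G) (n : ℕ) : CoeffDegree (d * n) (G ^ n) := by
  induction n with
  | zero =>
    intro e
    rw [pow_zero, mul_zero, coeff_one]
    split_ifs
    · exact isHomogeneous_one _ _
    · exact isHomogeneous_zero _ _ _
  | succ n ih => rw [pow_succ, mul_add, mul_one]; exact ih.mul hG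

theorem CoeffDegree.pderiv (hG : CoeffDegree d G) (i : Fin 2) : CoeffDegree d (pderiv i G) :=
  fun e => by
    rw [coeff_pderiv]
    simpa using (hG _).mul (isHomogeneous_C (Fin 6) ((e i + 1 : ℕ) : ℂ))

theorem CoeffDegree.partialD (hG : CoeffDegree d G) (i j : ℕ) : CoeffDegree d (partialD i j G) := by
  have h : ∀ (k : Fin 2) (n : ℕ) {G : MvPolynomial (Fin 2) R}, CoeffDegree d G →
      CoeffDegree d ((MvPolynomial.pderiv k)^[n] G) := by
    intro k n
    induction n with
    | zero => intro G h; exact h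
    | succ n ih => intro G h; rw [Function.iterate_succ_apply]; exact ih (h.pderiv k)
  exact h 0 i (h 1 j hG)

theorem CoeffDegree.transvectant (hG : CoeffDegree d G) (hH : CoeffDegree d' H) (m n r : ℕ) :
    CoeffDegree (d + d') (transvectant m n r G H) := by
  unfold Quintic.transvectant
  split_ifs
  · exact CoeffDegree.smul _ (CoeffDegree.sum fun i _ =>
      CoeffDegree.smul _ ((hG.partialD _ _).mul (hH.partialD _ _)))
  · exact CoeffDegree.zero

theorem coeffDegree_genericQuintic : CoeffDegree 1 genericQuintic := by
  refine CoeffDegree.sum fun i _ e => ?_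
  rw [coeff_monomial]
  split_ifs
  · rw [← map_natCast C]
    exact isHomogeneous_C_mul_X _ _
  · exact isHomogeneous_zero _ _ _

section Covariants
variable {F : MvPolynomial (Fin 2) R}

theorem CoeffDegree.theta22 (hF : CoeffDegree 1 F) : CoeffDegree 2 (theta22 F) :=
  hF.transvectant hF 5 5 4

theorem CoeffDegree.theta26 (hF : CoeffDegree 1 F) : CoeffDegree 2 (theta26 F) :=
  hF.transvectant hF 5 5 2

theorem CoeffDegree.theta33 (hF : CoeffDegree 1 F) : CoeffDegree 3 (theta33 F) :=
  hF.theta22.transvectant hF 2 5 2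

theorem CoeffDegree.theta40 (hF : CoeffDegree 1 F) : CoeffDegree 4 (theta40 F) :=
  hF.theta22.transvectant hF.theta22 2 2 2

theorem CoeffDegree.theta51 (hF : CoeffDegree 1 F) : CoeffDegree 5 (theta51 F) :=
  (hF.theta22.pow 2).transvectant hF 4 5 4

theorem CoeffDegree.theta80 (hF : CoeffDegree 1 F) : CoeffDegree 8 (theta80 F) :=
  (hF.theta22.pow 3).transvectant hF.theta26 6 6 6

theorem CoeffDegree.covU (hF : CoeffDegree 1 F) (α : ℚ) : CoeffDegree 5 (covU F α) :=
  (hF.theta33.mul hF.theta22).sub ((hF.theta40.mul hF).smul α)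

theorem CoeffDegree.covV (hF : CoeffDegree 1 F) (β γ : ℚ) : CoeffDegree 9 (covV F β γ) :=
  ((hF.theta51.mul (hF.theta22.pow 2)).sub (((hF.theta40.pow 2).mul hF).smul β)).sub
    ((hF.theta80.mul hF).smul γ)

end Covariants

theorem CoeffDegree.coord (hG : CoeffDegree d G) (m k : ℕ) : (coord m G k).IsHomogeneous d :=
  isHomogeneous_rat_smul (hG _) _

/-- The degrees of the rows of the matrix of `σ_τ(𝔽)`. -/
def rowDegree : Fin 5 → ℕ := ![1, 1, 1, 5, 9]

theorem sigmaMat_degree (τ : ℚ × ℚ × ℚ) (i : Fin 5) (j : Fin 6) :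
    (sigmaMat τ genericQuintic i j).IsHomogeneous (rowDegree i) := by
  have hF := coeffDegree_genericQuintic
  have hX : ∀ k, CoeffDegree 0 (X k : MvPolynomial (Fin 2) R) := fun k e => by
    rw [coeff_X]
    split_ifs
    · exact isHomogeneous_one _ _
    · exact isHomogeneous_zero _ _ _
  have hg : ∀ G : MvPolynomial (Fin 2) R, CoeffDegree 0 G →
      CoeffDegree 1 (sigma genericQuintic τ G 0 0) := by
    intro G hG
    have h := hG.transvectant hF 2 5 1
    simpa [sigma] using h
  refine CoeffDegree.coord ?_ 5 j
  fin_cases i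
  · exact hg _ ((hX 0).pow 2)
  · exact hg _ ((hX 0).mul (hX 1))
  · exact hg _ ((hX 1).pow 2)
  · have h := hF.covU τ.1
    change CoeffDegree 5 (sigma genericQuintic τ 0 1 0)
    simpa [sigma, transvectant_zero_left] using h
  · have h := hF.covV τ.2.1 τ.2.2
    change CoeffDegree 9 (sigma genericQuintic τ 0 0 1)
    simpa [sigma, transvectant_zero_left] using h

/-- The maximal minors have degree `1 + 1 + 1 + 5 + 9`. -/
theorem minor_degree (τ : ℚ × ℚ × ℚ) (j : Fin 6) :
    (minor (sigmaMat τ genericQuintic) j).IsHomogeneous 17 := by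
  rw [minor, Matrix.det_apply]
  refine IsHomogeneous.sum _ _ _ fun s _ => ?_
  have h : (∏ i, (sigmaMat τ genericQuintic).submatrix id j.succAbove (s i) i).IsHomogeneous
      (∑ i, rowDegree (s i)) :=
    IsHomogeneous.prod _ _ _ fun i _ => sigmaMat_degree τ _ _
  rw [Equiv.sum_comp s rowDegree] at h
  rw [Units.smul_def, zsmul_eq_mul, ← map_intCast (C : ℂ →+* R)]
  have h' := (isHomogeneous_C (Fin 6) ((Equiv.Perm.sign s : ℤ) : ℂ)).mul h
  rwa [zero_add, show ∑ i, rowDegree i = 17 from rfl] at h'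

theorem mem_irrelevant {f : R} {n : ℕ} (hf : f.IsHomogeneous n) (hn : n ≠ 0) : f ∈ irrelevant := by
  rw [irrelevant, ← Set.image_univ, mem_ideal_span_X_image]
  intro m hm
  by_contra! h
  have hm0 : m = 0 := by ext i; exact h i (Set.mem_univ i)
  have := hf (mem_support_iff.mp hm)
  rw [hm0, map_zero] at this
  exact hn this.symm

theorem irrelevant_ne_top : irrelevant ≠ ⊤ := by
  rw [Ideal.ne_top_iff_one, irrelevant, ← Set.image_univ, mem_ideal_span_X_image]
  intro h
  obtain ⟨i, -, hi⟩ := h 0 (by simp)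
  exact hi rfl

theorem idealB_le_irrelevant (τ : ℚ × ℚ × ℚ) : idealB τ ≤ irrelevant := by
  rw [idealB_eq, Ideal.span_le]
  rintro _ ⟨j, rfl⟩
  exact mem_irrelevant (minor_degree τ j) (by norm_num)

theorem idealB_ne_top (τ : ℚ × ℚ × ℚ) : idealB τ ≠ ⊤ := fun h =>
  irrelevant_ne_top (top_le_iff.mp (h ▸ idealB_le_irrelevant τ))

theorem sigmaMat_mem_irrelevant (τ : ℚ × ℚ × ℚ) (i : Fin 5) (j : Fin 6) :
    sigmaMat τ genericQuintic i j ∈ irrelevant :=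
  mem_irrelevant (sigmaMat_degree τ i j) (by fin_cases i <;> decide)

theorem vecMul_mem_irrelevant (τ : ℚ × ℚ × ℚ) (w : Fin 5 → R) (j : Fin 6) :
    Matrix.vecMul w (sigmaMat τ genericQuintic) j ∈ irrelevant := by
  rw [Matrix.vecMul, dotProduct]
  exact sum_mem fun i _ => Ideal.mul_mem_left _ _ (sigmaMat_mem_irrelevant τ i j)

end Degree

/-! ### The resolution -/

section Resolution

theorem exists_eq_quad {A : Type} [CommRing A] [Algebra ℚ A]
    (x : BinaryForm A 2 × BinaryForm A 0 × BinaryForm A 0) :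
    ∃ w : Fin 5 → A, (x.1 : MvPolynomial (Fin 2) A) = quad (w 0) (w 1) (w 2) ∧
      (x.2.1 : MvPolynomial (Fin 2) A) = C (w 3) ∧ (x.2.2 : MvPolynomial (Fin 2) A) = C (w 4) := by
  obtain ⟨⟨G, hG⟩, ⟨c, hc⟩, ⟨d, hd⟩⟩ := x
  rw [mem_homogeneousSubmodule] at hG hc hd
  refine ⟨![coord 2 G 0, 2 * coord 2 G 1, coord 2 G 2, coord 0 c 0, coord 0 d 0], ?_, ?_, ?_⟩
  · have h := form_coord hG
    have e : expo 1 1 = Finsupp.single 0 1 + Finsupp.single 1 1 := rfl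
    simp only [form, sum_range_succ, range_one, sum_singleton] at h
    change G = quad (coord 2 G 0) (2 * coord 2 G 1) (coord 2 G 2)
    conv_lhs => rw [← h]
    simp only [quad, X, monomial_pow, monomial_mul, C_mul_monomial, expo]
    simp
  · change c = C (coord 0 c 0)
    rw [← form_order_zero, form_coord hc]
  · change d = C (coord 0 d 0)
    rw [← form_order_zero, form_coord hd]

/-- The map `G ↦ det (G, M)` from `R ⊗ S_5` to `R`, where `M` is the matrix of `σ_τ(𝔽)`. -/
def resD₁ (τ : ℚ × ℚ × ℚ) : BinaryForm R 5 →ₗ[R] R :=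
  borderedDet (sigmaMat τ genericQuintic) ∘ₗ
    { toFun := fun G j => coord 5 G j
      map_add' := fun G H => funext fun j => coord_add 5 _ _ j
      map_smul' := fun c G => funext fun j => by
        simp [smul_eq_C_mul, coord_C_mul] }

theorem resD₁_apply (τ : ℚ × ℚ × ℚ) (G : BinaryForm R 5) :
    resD₁ τ G = borderedDet (sigmaMat τ genericQuintic)
      fun j : Fin 6 => coord 5 (G : MvPolynomial (Fin 2) R) j := rfl

/-- The map `σ_τ(𝔽)`, extended to forms with coefficients in `R`. -/
def resD₂ (τ : ℚ × ℚ × ℚ) :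
    (BinaryForm R 2 × BinaryForm R 0 × BinaryForm R 0) →ₗ[R] BinaryForm R 5 where
  toFun x := ⟨sigma genericQuintic τ x.1 x.2.1 x.2.2,
    sigma_isHomogeneous genericQuintic_isHomogeneous τ x.1.2 x.2.1.2 x.2.2.2⟩
  map_add' x y := Subtype.ext (sigma_add _ _ _ _ _ _ _)
  map_smul' c x := Subtype.ext (by
    simp [smul_eq_C_mul, ← sigma_C_mul])

theorem resD₂_coe (τ : ℚ × ℚ × ℚ) (x : BinaryForm R 2 × BinaryForm R 0 × BinaryForm R 0) :
    (resD₂ τ x : MvPolynomial (Fin 2) R) = sigma genericQuintic τ x.1 x.2.1 x.2.2 := rfl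

theorem exists_coord_resD₂ (τ : ℚ × ℚ × ℚ)
    (x : BinaryForm R 2 × BinaryForm R 0 × BinaryForm R 0) :
    ∃ w : Fin 5 → R, ((x.1 : MvPolynomial (Fin 2) R) = quad (w 0) (w 1) (w 2) ∧
      (x.2.1 : MvPolynomial (Fin 2) R) = C (w 3) ∧ (x.2.2 : MvPolynomial (Fin 2) R) = C (w 4)) ∧
      (fun j : Fin 6 => coord 5 (resD₂ τ x : MvPolynomial (Fin 2) R) j) =
        Matrix.vecMul w (sigmaMat τ genericQuintic) := by
  obtain ⟨w, h⟩ := exists_eq_quad x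
  refine ⟨w, h, ?_⟩
  ext1 j
  rw [resD₂_coe, h.1, h.2.1, h.2.2, coord_sigma]

theorem exists_resD₂_coord_eq (τ : ℚ × ℚ × ℚ) (w : Fin 5 → R) :
    ∃ x, (fun j : Fin 6 => coord 5 (resD₂ τ x : MvPolynomial (Fin 2) R) j) =
      Matrix.vecMul w (sigmaMat τ genericQuintic) := by
  refine ⟨(⟨quad (w 0) (w 1) (w 2), quad_isHomogeneous _ _ _⟩, ⟨C (w 3), isHomogeneous_C _ _⟩,
    ⟨C (w 4), isHomogeneous_C _ _⟩), ?_⟩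
  ext1 j
  exact coord_sigma τ _ w j

theorem binaryForm_ext {A : Type} [CommRing A] [Algebra ℚ A] {m : ℕ} {G H : BinaryForm A m}
    (h : (fun j : Fin (m + 1) => coord m (G : MvPolynomial (Fin 2) A) j) =
      fun j : Fin (m + 1) => coord m (H : MvPolynomial (Fin 2) A) j) : G = H := by
  apply Subtype.ext
  rw [← form_coord G.2, ← form_coord H.2]
  exact form_congr fun k hk => congrFun h ⟨k, by omega⟩

theorem mem_smul_top_of_coord {m : ℕ} {I : Ideal R} {G : BinaryForm R m}
    (h : ∀ j : Fin (m + 1), coord m (G : MvPolynomial (Fin 2) R) j ∈ I) :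
    G ∈ I • (⊤ : Submodule R (BinaryForm R m)) := by
  have e : G = ∑ k : Fin (m + 1), coord m (G : MvPolynomial (Fin 2) R) k •
      (⟨form m (Pi.single (k : ℕ) 1), form_isHomogeneous m _⟩ : BinaryForm R m) := by
    apply Subtype.ext
    rw [AddSubmonoidClass.coe_finsetSum]
    conv_lhs => rw [← form_coord G.2, form_eq_sum]
    simp [smul_eq_C_mul]
  rw [e]
  exact sum_mem fun k _ => Submodule.smul_mem_smul (h k) trivial

/-- The Hilbert–Burch complex of the matrix of `σ_τ(𝔽)` is the asserted resolution as soon as `𝔟_τ`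
contains a regular sequence `f, h`. -/
theorem isMinimalResolution {τ : ℚ × ℚ × ℚ} {f h : R} (hf : f ∈ idealB τ) (hh : h ∈ idealB τ)
    (hf0 : f ≠ 0) (hfh : ∀ a, f ∣ h * a → f ∣ a) :
    IsMinimalResolution (idealB τ) (resD₁ τ) (resD₂ τ) := by
  have hr : LinearMap.range (resD₁ τ) = idealB τ := by
    rw [idealB_eq, ← range_borderedDet, resD₁, LinearMap.range_comp_of_range_eq_top]
    rw [LinearMap.range_eq_top]
    intro v
    refine ⟨⟨form 5 (extend v), form_isHomogeneous _ _⟩, funext fun j => ?_⟩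
    change coord 5 (form 5 (extend v)) j = v j
    rw [coord_form (by have := j.2; omega), extend_coe]
  rw [idealB_eq] at hf hh
  have hex := exact_vecMul_borderedDet hf hh hf0 hfh
  obtain ⟨j₀, hj₀⟩ := exists_minor_ne_zero hf hf0
  refine ⟨hr, ?_, ?_, ?_, ?_, ?_, ?_, ?_, ?_⟩
  · intro G
    rw [resD₁_apply, hex]
    constructor
    · rintro ⟨w, hw⟩
      obtain ⟨x, hx⟩ := exists_resD₂_coord_eq τ w
      exact ⟨x, binaryForm_ext (hx.trans hw)⟩
    · rintro ⟨x, rfl⟩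
      obtain ⟨w, -, hw⟩ := exists_coord_resD₂ τ x
      exact ⟨w, hw.symm⟩
  · rw [← LinearMap.ker_eq_bot, LinearMap.ker_eq_bot']
    intro x hx
    obtain ⟨w, hw, hw'⟩ := exists_coord_resD₂ τ x
    rw [hx] at hw'
    have hw0 : w = 0 := by
      apply vecMul_injective hj₀
      dsimp only
      rw [← hw', Matrix.zero_vecMul]
      ext j; simp [coord]
    subst hw0
    refine Prod.ext (Subtype.ext ?_) (Prod.ext (Subtype.ext ?_) (Subtype.ext ?_))
    · rw [hw.1]; simp [quad]
    · rw [hw.2.1]; simp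
    · rw [hw.2.2]; simp
  · intro n G hG
    rw [resD₁_apply, borderedDet_apply, det_bordered]
    unfold InDegree at hG
    split_ifs at hG with hn
    · refine IsHomogeneous.sum _ _ _ fun j _ => ?_
      have h1 := (minor_degree τ j).mul (CoeffDegree.coord hG 5 j)
      rw [Nat.add_sub_cancel' hn] at h1
      have h2 := (isHomogeneous_C (Fin 6) ((-1 : ℂ) ^ (j : ℕ))).mul h1
      simpa [mul_assoc] using h2
    · subst hG
      simp [coord, isHomogeneous_zero]
  · intro n G c₁ c₂ hG h₁ h₂
    have hF := coeffDegree_genericQuintic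
    have h0 : ∀ {s m : ℕ} {G : BinaryForm R m}, InDegree s n G → n < s →
        (G : MvPolynomial (Fin 2) R) = 0 := by
      intro s m G hG hn
      unfold InDegree at hG
      rw [if_neg (by omega)] at hG
      rw [hG]; rfl
    have h0' : ∀ {s m : ℕ} {G : BinaryForm R m}, InDegree s n G → s ≤ n →
        CoeffDegree (n - s) (G : MvPolynomial (Fin 2) R) := by
      intro s m G hG hn
      unfold InDegree at hG
      rwa [if_pos hn] at hG
    have k1 : 17 ≤ n → CoeffDegree (n - 17)
        (transvectant 2 5 1 (G : MvPolynomial (Fin 2) R) genericQuintic) := by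
      intro _
      by_cases hn : 18 ≤ n
      · have := (h0' hG hn).transvectant hF 2 5 1
        rwa [show n - 18 + 1 = n - 17 by omega] at this
      · rw [h0 hG (by omega), transvectant_zero_left]; exact CoeffDegree.zero
    have k2 : 17 ≤ n → CoeffDegree (n - 17)
        ((c₁ : MvPolynomial (Fin 2) R) * covU genericQuintic τ.1) := by
      intro _
      by_cases hn : 22 ≤ n
      · have := (h0' h₁ hn).mul (hF.covU τ.1)
        rwa [show n - 22 + 5 = n - 17 by omega] at this
      · rw [h0 h₁ (by omega), zero_mul]; exact CoeffDegree.zero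
    have k3 : 17 ≤ n → CoeffDegree (n - 17)
        ((c₂ : MvPolynomial (Fin 2) R) * covV genericQuintic τ.2.1 τ.2.2) := by
      intro _
      by_cases hn : 26 ≤ n
      · have := (h0' h₂ hn).mul (hF.covV τ.2.1 τ.2.2)
        rwa [show n - 26 + 9 = n - 17 by omega] at this
      · rw [h0 h₂ (by omega), zero_mul]; exact CoeffDegree.zero
    unfold InDegree
    split_ifs with hn
    · exact ((k1 hn).add (k2 hn)).add (k3 hn)
    · apply Subtype.ext
      rw [resD₂_coe, h0 hG (by omega), h0 h₁ (by omega), h0 h₂ (by omega)]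
      simp [sigma, transvectant_zero_left]
  · rw [hr]; exact idealB_le_irrelevant τ
  · rintro _ ⟨x, rfl⟩
    obtain ⟨w, -, hw⟩ := exists_coord_resD₂ τ x
    refine mem_smul_top_of_coord fun j => ?_
    rw [congrFun hw j]
    exact vecMul_mem_irrelevant τ w j
  · intro g G
    exact borderedDet_equivariant g τ G.2
  · intro g G c₁ c₂
    exact Subtype.ext (actPoly_sigma g τ _ _ _).symm

/-- The grade is squeezed between the length two of a regular sequence and the height, and the
projective dimension is the length of the resolution. -/
theorem isPerfect_of_height {τ : ℚ × ℚ × ℚ} {f h : R} (hf : f ∈ idealB τ) (hh : h ∈ idealB τ)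
    (hf0 : f ≠ 0) (hfh : ∀ a, f ∣ h * a → f ∣ a) (hht : (idealB τ).height ≤ 2) :
    (idealB τ).height = 2 ∧ IsPerfect (idealB τ) := by
  have h1 := two_le_grade (idealB_ne_top τ) hf hh hf0 hfh
  have h2 := grade_le_height (idealB τ)
  have h3 : grade (idealB τ) = 2 := le_antisymm (h2.trans hht) h1
  refine ⟨le_antisymm hht (h1.trans h2), ?_⟩
  rw [idealB_eq] at hf hh
  obtain ⟨j₀, hj₀⟩ := exists_minor_ne_zero hf hf0
  rw [IsPerfect, h3, projectiveDimension_quotient_eq_two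
    ((range_borderedDet (sigmaMat τ genericQuintic)).trans (idealB_eq τ).symm)
    (exact_vecMul_borderedDet hf hh hf0 hfh) (vecMul_injective hj₀) (by norm_num) irrelevant_ne_top]
  · rfl
  · rintro _ ⟨w, rfl⟩
    have e := (Pi.basisFun R (Fin 6)).sum_repr (Matrix.vecMul w (sigmaMat τ genericQuintic))
    rw [Matrix.vecMulLinear_apply, ← e]
    exact sum_mem fun j _ => Submodule.smul_mem_smul (by
      rw [Pi.basisFun_repr]; exact vecMul_mem_irrelevant τ w j) trivial

end Resolution

/-! ### Common divisors in factorial rings -/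

section GCD
variable {A : Type*} [CommRing A] [IsDomain A] [UniqueFactorizationMonoid A]

/-- A finitely generated ideal of a factorial ring has a greatest common divisor. -/
theorem exists_gcd_ideal (I : Ideal A) (hI : I.FG) :
    ∃ d : A, (∀ f ∈ I, d ∣ f) ∧ ∀ e : A, (∀ f ∈ I, e ∣ f) → e ∣ d := by
  classical
  let _ := UniqueFactorizationMonoid.toGCDMonoid A
  obtain ⟨s, rfl⟩ := hI
  have key : ∀ s : Finset A, ∃ d : A, (∀ f ∈ s, d ∣ f) ∧ ∀ e : A, (∀ f ∈ s, e ∣ f) → e ∣ d := by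
    intro s
    induction s using Finset.induction_on with
    | empty => exact ⟨0, by simp, by simp⟩
    | insert a s _ ih =>
      obtain ⟨d, h1, h2⟩ := ih
      refine ⟨gcd a d, ?_, ?_⟩
      · intro f hf
        rcases Finset.mem_insert.mp hf with rfl | hf
        · exact gcd_dvd_left _ _
        · exact (gcd_dvd_right _ _).trans (h1 f hf)
      · intro e he
        exact dvd_gcd (he a (Finset.mem_insert_self _ _))
          (h2 e fun f hf => he f (Finset.mem_insert_of_mem hf))
  obtain ⟨d, h1, h2⟩ := key s
  refine ⟨d, fun f hf => ?_, fun e he => h2 e fun f hf => he f (Ideal.subset_span hf)⟩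
  have : Ideal.span (s : Set A) ≤ Ideal.span {d} := by
    rw [Ideal.span_le]
    intro f hf
    exact Ideal.mem_span_singleton.mpr (h1 f hf)
  exact Ideal.mem_span_singleton.mp (this hf)

/-- In a factorial ring an ideal whose elements have no common factor contains a regular sequence
of length two: avoid the finitely many prime factors of a nonzero element. -/
theorem exists_relPrime_of_gcd {I : Ideal A} (hI : I ≠ ⊥)
    (h : ∀ e : A, (∀ f ∈ I, e ∣ f) → IsUnit e) :
    ∃ f ∈ I, ∃ g ∈ I, f ≠ 0 ∧ ∀ a, f ∣ g * a → f ∣ a := by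
  classical
  obtain ⟨f, hf, hf0⟩ := Submodule.exists_mem_ne_zero_of_ne_bot hI
  let s := (UniqueFactorizationMonoid.factors f).toFinset
  have hs : ∀ p ∈ s, Prime p := fun p hp =>
    UniqueFactorizationMonoid.prime_of_factor p (Multiset.mem_toFinset.mp hp)
  have hg : ∃ g ∈ I, ∀ p ∈ s, ¬ p ∣ g := by
    by_contra! hcon
    have hsub : (I : Set A) ⊆ ⋃ p ∈ (s : Set A), ((Ideal.span {p} : Ideal A) : Set A) := by
      intro g hg
      obtain ⟨p, hp, hpg⟩ := hcon g hg
      exact Set.mem_biUnion hp (Ideal.mem_span_singleton.mpr hpg)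
    rw [Ideal.subset_union_prime (f := fun p => Ideal.span {p}) 0 0 (fun p hp _ _ =>
      (Ideal.span_singleton_prime (hs p hp).ne_zero).mpr (hs p hp))] at hsub
    obtain ⟨p, hp, hIp⟩ := hsub
    exact (hs p hp).not_isUnit (h p fun f hf => Ideal.mem_span_singleton.mp (hIp hf))
  obtain ⟨g, hg, hgs⟩ := hg
  refine ⟨f, hf, g, hg, hf0, fun a ha => ?_⟩
  have hrel : IsRelPrime f g := by
    refine (UniqueFactorizationMonoid.isRelPrime_iff_no_prime_factors hf0).mpr ?_
    intro p hpf hpg hp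
    obtain ⟨q, hq, hpq⟩ :=
      UniqueFactorizationMonoid.exists_mem_factors_of_dvd hf0 hp.irreducible hpf
    exact hgs q (Multiset.mem_toFinset.mpr hq) (hpq.dvd_iff_dvd_left.mp hpg)
  exact hrel.dvd_of_dvd_mul_left ha

end GCD

/-! ### Invariants of the quintic -/

section Action

theorem actR_X (g : SL2) (i : Fin 6) : actR g (X i) = coord 5 (subst g⁻¹ genericQuintic) i := by
  simp [actR, quinticCoord_eq]

theorem actR_mul (g h : SL2) (f : R) : actR (g * h) f = actR g (actR h f) := by
  have : actR (g * h) = (actR g).comp (actR h) := by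
    apply MvPolynomial.algHom_ext
    intro i
    rw [AlgHom.comp_apply, actR_X, actR_X, subst_eq, subst_eq]
    have h1 := map_coord (actR g : R →+* R) 5 (substM (matR h⁻¹) genericQuintic) i
    rw [map_substM, map_actR_genericQuintic] at h1
    have h2 : (matR h⁻¹).map (actR g : R →+* R) = matR h⁻¹ := by
      ext i j
      simp [matR]
    rw [h2, subst_eq, substM_substM, ← matR_mul, ← mul_inv_rev] at h1
    exact h1
  rw [this]; rfl

theorem actR_one (f : R) : actR 1 f = f := by
  have : actR 1 = AlgHom.id ℂ R := by
    apply MvPolynomial.algHom_ext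
    intro i
    rw [actR_X, subst_eq, inv_one, matR_one, substM_one, genericQuintic_eq,
      coord_form (by have := i.2; omega), extend_coe]
    rfl
  rw [this]; rfl

/-- The diagonal substitution `a_i ↦ c_i a_i`. -/
def diagR (c : Fin 6 → ℂ) : R →ₐ[ℂ] R := aeval fun i => C (c i) * X i

theorem coeff_diagR (c : Fin 6 → ℂ) (f : R) (m : Fin 6 →₀ ℕ) :
    coeff m (diagR c f) = (∏ i, c i ^ m i) * coeff m f := by
  induction f using MvPolynomial.induction_on' with
  | monomial k b =>
    have h : diagR c (monomial k b) = monomial k ((∏ i, c i ^ k i) * b) := by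
      rw [diagR, aeval_monomial, Finsupp.prod_fintype _ _ (by simp), algebraMap_eq,
        monomial_eq (s := k), Finsupp.prod_fintype _ _ (by simp)]
      simp only [mul_pow, prod_mul_distrib, map_mul, map_prod, map_pow]
      ring
    rw [h, coeff_monomial, coeff_monomial]
    split_ifs with hk
    · rw [hk]
    · simp
  | add p q hp hq => rw [map_add, coeff_add, hp, hq, coeff_add, mul_add]

/-- A greatest common divisor of an ideal is a semi-invariant of every automorphism that preserves
the ideal. -/
theorem exists_semiinvariant {I : Ideal R} {d : R} (h1 : ∀ f ∈ I, d ∣ f)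
    (h2 : ∀ e : R, (∀ f ∈ I, e ∣ f) → e ∣ d) (φ ψ : R →ₐ[ℂ] R) (hφψ : ∀ f, φ (ψ f) = f)
    (hψφ : ∀ f, ψ (φ f) = f) (hφ : ∀ f ∈ I, φ f ∈ I) (hψ : ∀ f ∈ I, ψ f ∈ I) :
    ∃ c : ℂ, c ≠ 0 ∧ φ d = C c * d := by
  have a1 : φ d ∣ d := h2 _ fun f hf => by
    have := map_dvd φ (h1 _ (hψ f hf))
    rwa [hφψ] at this
  have a2 : ψ d ∣ d := h2 _ fun f hf => by
    have := map_dvd ψ (h1 _ (hφ f hf))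
    rwa [hψφ] at this
  have a3 : d ∣ φ d := by
    have := map_dvd φ a2
    rwa [hφψ] at this
  obtain ⟨u, hu⟩ := associated_of_dvd_dvd a3 a1
  obtain ⟨c, hc, hc'⟩ := isUnit_iff_eq_C_of_isReduced.mp u.isUnit
  exact ⟨c, hc.ne_zero, by rw [← hu, hc', mul_comm]⟩

theorem diagR_const_of_isHomogeneous (c : ℂ) {f : R} {n : ℕ} (hf : f.IsHomogeneous n) :
    diagR (fun _ => c) f = C (c ^ n) * f := by
  ext m
  rw [coeff_diagR, coeff_C_mul, prod_pow_eq_pow_sum]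
  by_cases hm : coeff m f = 0
  · rw [hm, mul_zero, mul_zero]
  · have h : m.degree = n := by
      rw [Finsupp.degree_eq_weight_one]; exact hf hm
    rw [← Finsupp.degree_eq_sum, h]

theorem diagR_mem_idealB (c : ℂ) {τ : ℚ × ℚ × ℚ} {f : R} (hf : f ∈ idealB τ) :
    diagR (fun _ => c) f ∈ idealB τ := by
  rw [idealB_eq] at hf ⊢
  have h : Ideal.span (Set.range (minor (sigmaMat τ genericQuintic))) ≤
      (Ideal.span (Set.range (minor (sigmaMat τ genericQuintic)))).comap (diagR fun _ => c) := by
    rw [Ideal.span_le]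
    rintro _ ⟨j, rfl⟩
    rw [SetLike.mem_coe, Ideal.mem_comap, diagR_const_of_isHomogeneous c (minor_degree τ j)]
    exact Ideal.mul_mem_left _ _ (Ideal.subset_span ⟨j, rfl⟩)
  exact h hf

theorem diagR_const_inv {c : ℂ} (hc : c ≠ 0) (f : R) :
    diagR (fun _ => c) (diagR (fun _ => c⁻¹) f) = f := by
  ext m
  rw [coeff_diagR, coeff_diagR, ← mul_assoc, ← prod_mul_distrib]
  simp [hc]

theorem form_five {A : Type} [CommRing A] (g : ℕ → A) :
    form 5 g = C (g 0) * X 0 ^ 5 + 5 * C (g 1) * X 0 ^ 4 * X 1 + 10 * C (g 2) * X 0 ^ 3 * X 1 ^ 2 +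
      10 * C (g 3) * X 0 ^ 2 * X 1 ^ 3 + 5 * C (g 4) * X 0 * X 1 ^ 4 + C (g 5) * X 1 ^ 5 := by
  simp only [form, sum_range_succ, range_one, sum_singleton, monomial_expo]
  simp [Nat.choose, map_ofNat C]

theorem substM_upper_form {A : Type} [CommRing A] [Algebra ℚ A] (t : A) (g : ℕ → A) :
    substM !![1, t; 0, 1] (form 5 g) =
      form 5 fun k => ∑ j ∈ range (6 - k), ((5 - k).choose j : A) * t ^ j * g (k + j) := by
  rw [form_five, form_five]
  simp only [map_add, map_mul, map_pow, map_ofNat, substM_C, substM_X]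
  simp [sum_range_succ, Nat.choose, map_ofNat C]
  ring

theorem substM_lower_form {A : Type} [CommRing A] [Algebra ℚ A] (t : A) (g : ℕ → A) :
    substM !![1, 0; t, 1] (form 5 g) =
      form 5 fun k => ∑ j ∈ range (k + 1), (k.choose j : A) * t ^ j * g (k - j) := by
  rw [form_five, form_five]
  simp only [map_add, map_mul, map_pow, map_ofNat, substM_C, substM_X]
  simp [sum_range_succ, Nat.choose, map_ofNat C]
  ring

theorem substM_diag_form {A : Type} [CommRing A] [Algebra ℚ A] (s t : A) (g : ℕ → A) :
    substM !![s, 0; 0, t] (form 5 g) = form 5 fun k => s ^ (5 - k) * t ^ k * g k := by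
  rw [form_five, form_five]
  simp only [map_add, map_mul, map_pow, map_ofNat, substM_C, substM_X]
  simp
  ring

theorem matR_mk (a b c d : ℂ) (h) : matR ⟨!![a, b; c, d], h⟩ = !![C a, C b; C c, C d] := by
  ext i j; fin_cases i <;> fin_cases j <;> rfl

theorem upper_inv (t : ℂ) : (upper t)⁻¹ = upper (-t) := by
  rw [inv_eq_iff_mul_eq_one]
  apply SL2_ext
  rw [Matrix.SpecialLinearGroup.coe_mul, coe_upper, coe_upper, Matrix.mul_fin_two,
    Matrix.SpecialLinearGroup.coe_one, Matrix.one_fin_two]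
  apply matrix_two_congr <;> ring

theorem lower_inv (t : ℂ) : (lower t)⁻¹ = lower (-t) := by
  rw [inv_eq_iff_mul_eq_one]
  apply SL2_ext
  rw [Matrix.SpecialLinearGroup.coe_mul, coe_lower, coe_lower, Matrix.mul_fin_two,
    Matrix.SpecialLinearGroup.coe_one, Matrix.one_fin_two]
  apply matrix_two_congr <;> ring

theorem actR_upper (t : ℂ) (i : Fin 6) : actR (upper t) (X i) =
    ∑ j ∈ range (6 - i), ((5 - i : ℕ).choose j : R) * C (-t) ^ j * extend X (i + j) := by
  rw [actR_X, upper_inv, subst_eq, upper, matR_mk, genericQuintic_eq, C_1, C_0,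
    substM_upper_form, coord_form (by have := i.2; omega)]

theorem actR_lower (t : ℂ) (i : Fin 6) : actR (lower t) (X i) =
    ∑ j ∈ range (i + 1), ((i : ℕ).choose j : R) * C (-t) ^ j * extend X (i - j) := by
  rw [actR_X, lower_inv, subst_eq, lower, matR_mk, genericQuintic_eq, C_1, C_0,
    substM_lower_form, coord_form (by have := i.2; omega)]

theorem torus_inv (t : ℂ) (ht : t ≠ 0) : (torus t ht)⁻¹ = torus t⁻¹ (inv_ne_zero ht) := by
  rw [inv_eq_iff_mul_eq_one]
  apply SL2_ext
  rw [Matrix.SpecialLinearGroup.coe_mul, coe_torus, coe_torus, Matrix.mul_fin_two,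
    Matrix.SpecialLinearGroup.coe_one, Matrix.one_fin_two]
  apply matrix_two_congr <;> simp [ht]

theorem actR_torus (t : ℂ) (ht : t ≠ 0) :
    actR (torus t ht) = diagR fun i => (t⁻¹) ^ (5 - (i : ℕ)) * t ^ (i : ℕ) := by
  apply MvPolynomial.algHom_ext
  intro i
  rw [actR_X, torus_inv, subst_eq, torus, matR_mk, genericQuintic_eq, C_0, inv_inv,
    substM_diag_form, coord_form (by have := i.2; omega), extend_coe, diagR, aeval_X, map_mul,
    map_pow, map_pow]

/-- The infinitesimal form of the invariance of `f` under a one-parameter family of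
substitutions. -/
theorem sum_derivative_mul_pderiv (P : Fin 6 → Polynomial R) (hP : ∀ i, (P i).eval 0 = X i)
    (f : R) (hf : ∀ t : ℂ, aeval (fun i => (P i).eval (C t)) f = f) :
    ∑ i, (P i).derivative.eval 0 * pderiv i f = 0 := by
  have h1 : ∀ f : R, (aeval P f).eval 0 = f := by
    intro f
    have : ((Polynomial.aeval (0 : R)).restrictScalars ℂ).comp (aeval P) = AlgHom.id ℂ R := by
      apply MvPolynomial.algHom_ext
      intro i
      simp [hP]
    simpa using DFunLike.congr_fun this f
  have h2 : ∀ f : R, (aeval P f).derivative.eval 0 = ∑ i, (P i).derivative.eval 0 * pderiv i f := by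
    intro f
    induction f using MvPolynomial.induction_on with
    | C a =>
      have : (aeval P (C a : R)) = Polynomial.C (C a) := by
        rw [aeval_C]; rfl
      simp [this]
    | add p q hp hq => simp only [map_add, Polynomial.eval_add, hp, hq, mul_add, sum_add_distrib]
    | mul_X p i hp =>
      rw [map_mul, aeval_X, Polynomial.derivative_mul, Polynomial.eval_add, Polynomial.eval_mul,
        Polynomial.eval_mul, hp, h1, hP]
      simp only [Derivation.leibniz, smul_eq_mul, pderiv_X, mul_add, sum_add_distrib, sum_mul]
      have hs : ∑ x, (P x).derivative.eval 0 * (p * (Pi.single x (1 : R) : Fin 6 → R) i) =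
          p * (P i).derivative.eval 0 := by
        rw [sum_eq_single i]
        · rw [Pi.single_eq_same, mul_one, mul_comm]
        · intro b _ hb; rw [Pi.single_eq_of_ne (Ne.symm hb)]; ring
        · simp
      rw [hs, add_comm]
      congr 1
      exact sum_congr rfl fun _ _ => by ring
  rw [← h2]
  have h3 : aeval P f = Polynomial.C f := by
    apply Polynomial.eq_of_infinite_eval_eq
    refine Set.infinite_of_injective_forall_mem (f := (C : ℂ → R)) (C_injective _ _) fun t => ?_
    rw [Set.mem_ofPred_eq, Polynomial.eval_C, ← hf t]
    have : ((Polynomial.aeval (C t : R)).restrictScalars ℂ).comp (aeval P) =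
        aeval (fun i => (P i).eval (C t)) := by
      apply MvPolynomial.algHom_ext
      intro i
      simp
    have h4 := DFunLike.congr_fun this f
    rw [hf t] at h4 ⊢
    simpa using h4
  rw [h3, Polynomial.derivative_C, Polynomial.eval_zero]

/-- The differential equation of the invariants under upper unipotent substitutions. -/
theorem upper_invariant {f : R} (hf : ∀ g : SL2, actR g f = f) :
    C 5 * (X 1 * pderiv 0 f) + C 4 * (X 2 * pderiv 1 f) + C 3 * (X 3 * pderiv 2 f) +
      C 2 * (X 4 * pderiv 3 f) + X 5 * pderiv 4 f = 0 := by
  have h := sum_derivative_mul_pderiv (fun i => ∑ j ∈ range (6 - i),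
    ((5 - i : ℕ).choose j : Polynomial R) * (-Polynomial.X) ^ j * Polynomial.C (extend X (i + j)))
    (fun i => by fin_cases i <;> simp [sum_range_succ, extend]) f (fun t => by
      rw [← DFunLike.congr_fun (MvPolynomial.algHom_ext (f := actR (upper t)) fun i => ?_) f,
        hf (upper t)]
      rw [actR_upper, aeval_X]
      simp [Polynomial.eval_finsetSum])
  rw [← neg_eq_zero, ← h, Fin.sum_univ_six]
  simp [sum_range_succ, extend, Polynomial.derivative_pow, map_ofNat C]
  ring

/-- The differential equation of the invariants under lower unipotent substitutions. -/
theorem lower_invariant {f : R} (hf : ∀ g : SL2, actR g f = f) :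
    X 0 * pderiv 1 f + C 2 * (X 1 * pderiv 2 f) + C 3 * (X 2 * pderiv 3 f) +
      C 4 * (X 3 * pderiv 4 f) + C 5 * (X 4 * pderiv 5 f) = 0 := by
  have h := sum_derivative_mul_pderiv (fun i => ∑ j ∈ range (i + 1),
    ((i : ℕ).choose j : Polynomial R) * (-Polynomial.X) ^ j * Polynomial.C (extend X (i - j)))
    (fun i => by fin_cases i <;> simp [sum_range_succ, extend]) f (fun t => by
      rw [← DFunLike.congr_fun (MvPolynomial.algHom_ext (f := actR (lower t)) fun i => ?_) f,
        hf (lower t)]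
      rw [actR_lower, aeval_X]
      simp [Polynomial.eval_finsetSum])
  rw [← neg_eq_zero, ← h, Fin.sum_univ_six]
  simp [sum_range_succ, extend, Polynomial.derivative_pow, map_ofNat C]
  ring

/-- The coefficient of `a₀^n₀ ⋯ a₅^n₅`. -/
def coeff6 (f : R) (n₀ n₁ n₂ n₃ n₄ n₅ : ℕ) : ℂ :=
  coeff (Finsupp.equivFunOnFinite.symm ![n₀, n₁, n₂, n₃, n₄, n₅]) f

theorem coeff_X_mul_pderiv (f : R) {i j : Fin 6} (hij : i ≠ j) (n n' : Fin 6 → ℕ)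
    (hj : n' j = n j - 1) (hi : n' i = n i + 1) (hk : ∀ k, k ≠ i → k ≠ j → n' k = n k) :
    coeff (Finsupp.equivFunOnFinite.symm n) (X j * pderiv i f) =
      if n j = 0 then 0 else (n i + 1) * coeff (Finsupp.equivFunOnFinite.symm n') f := by
  rw [coeff_X_mul']
  by_cases h : n j = 0
  · rw [if_neg (by simpa using h), if_pos h]
  · rw [if_pos (by simpa using h), if_neg h, coeff_pderiv, mul_comm]
    have e1 : (Finsupp.equivFunOnFinite.symm n - Finsupp.single j 1 : Fin 6 →₀ ℕ) i = n i := by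
      simp [hij]
    have e2 : (Finsupp.equivFunOnFinite.symm n - Finsupp.single j 1 + Finsupp.single i 1 :
        Fin 6 →₀ ℕ) = Finsupp.equivFunOnFinite.symm n' := by
      ext k
      by_cases hki : k = i
      · subst hki; simp [hij, hi]
      · by_cases hkj : k = j
        · subst hkj; simp [hki, hj]
        · simp [hki, hkj, hk k hki hkj]
    rw [e1, e2]

/-- The coefficient of `a₀^n₀ ⋯ a₅^n₅` in `lower_invariant`. -/
theorem lower_invariant_coeff {f : R} (hf : ∀ g : SL2, actR g f = f) (n₀ n₁ n₂ n₃ n₄ n₅ : ℕ) :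
    (if n₀ = 0 then 0 else (n₁ + 1) * coeff6 f (n₀ - 1) (n₁ + 1) n₂ n₃ n₄ n₅) +
    2 * (if n₁ = 0 then 0 else (n₂ + 1) * coeff6 f n₀ (n₁ - 1) (n₂ + 1) n₃ n₄ n₅) +
    3 * (if n₂ = 0 then 0 else (n₃ + 1) * coeff6 f n₀ n₁ (n₂ - 1) (n₃ + 1) n₄ n₅) +
    4 * (if n₃ = 0 then 0 else (n₄ + 1) * coeff6 f n₀ n₁ n₂ (n₃ - 1) (n₄ + 1) n₅) +
    5 * (if n₄ = 0 then 0 else (n₅ + 1) * coeff6 f n₀ n₁ n₂ n₃ (n₄ - 1) (n₅ + 1)) = 0 := by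
  have h := congrArg (coeff (Finsupp.equivFunOnFinite.symm ![n₀, n₁, n₂, n₃, n₄, n₅]))
    (lower_invariant hf)
  have t0 := coeff_X_mul_pderiv f (i := 1) (j := 0) (by decide) ![n₀, n₁, n₂, n₃, n₄, n₅]
    ![n₀ - 1, n₁ + 1, n₂, n₃, n₄, n₅] rfl rfl (by intro k; fin_cases k <;> simp)
  have t1 := coeff_X_mul_pderiv f (i := 2) (j := 1) (by decide) ![n₀, n₁, n₂, n₃, n₄, n₅]
    ![n₀, n₁ - 1, n₂ + 1, n₃, n₄, n₅] rfl rfl (by intro k; fin_cases k <;> simp)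
  have t2 := coeff_X_mul_pderiv f (i := 3) (j := 2) (by decide) ![n₀, n₁, n₂, n₃, n₄, n₅]
    ![n₀, n₁, n₂ - 1, n₃ + 1, n₄, n₅] rfl rfl (by intro k; fin_cases k <;> simp)
  have t3 := coeff_X_mul_pderiv f (i := 4) (j := 3) (by decide) ![n₀, n₁, n₂, n₃, n₄, n₅]
    ![n₀, n₁, n₂, n₃ - 1, n₄ + 1, n₅] rfl rfl (by intro k; fin_cases k <;> simp)
  have t4 := coeff_X_mul_pderiv f (i := 5) (j := 4) (by decide) ![n₀, n₁, n₂, n₃, n₄, n₅]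
    ![n₀, n₁, n₂, n₃, n₄ - 1, n₅ + 1] rfl rfl (by intro k; fin_cases k <;> simp)
  simp only [coeff_add, coeff_C_mul, t0, t1, t2, t3, t4, coeff_zero] at h
  exact h

/-- The coefficient of `a₀^n₀ ⋯ a₅^n₅` in `upper_invariant`. -/
theorem upper_invariant_coeff {f : R} (hf : ∀ g : SL2, actR g f = f) (n₀ n₁ n₂ n₃ n₄ n₅ : ℕ) :
    5 * (if n₁ = 0 then 0 else (n₀ + 1) * coeff6 f (n₀ + 1) (n₁ - 1) n₂ n₃ n₄ n₅) +
    4 * (if n₂ = 0 then 0 else (n₁ + 1) * coeff6 f n₀ (n₁ + 1) (n₂ - 1) n₃ n₄ n₅) +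
    3 * (if n₃ = 0 then 0 else (n₂ + 1) * coeff6 f n₀ n₁ (n₂ + 1) (n₃ - 1) n₄ n₅) +
    2 * (if n₄ = 0 then 0 else (n₃ + 1) * coeff6 f n₀ n₁ n₂ (n₃ + 1) (n₄ - 1) n₅) +
    (if n₅ = 0 then 0 else (n₄ + 1) * coeff6 f n₀ n₁ n₂ n₃ (n₄ + 1) (n₅ - 1)) = 0 := by
  have h := congrArg (coeff (Finsupp.equivFunOnFinite.symm ![n₀, n₁, n₂, n₃, n₄, n₅]))
    (upper_invariant hf)
  have t0 := coeff_X_mul_pderiv f (i := 0) (j := 1) (by decide) ![n₀, n₁, n₂, n₃, n₄, n₅]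
    ![n₀ + 1, n₁ - 1, n₂, n₃, n₄, n₅] rfl rfl (by intro k; fin_cases k <;> simp)
  have t1 := coeff_X_mul_pderiv f (i := 1) (j := 2) (by decide) ![n₀, n₁, n₂, n₃, n₄, n₅]
    ![n₀, n₁ + 1, n₂ - 1, n₃, n₄, n₅] rfl rfl (by intro k; fin_cases k <;> simp)
  have t2 := coeff_X_mul_pderiv f (i := 2) (j := 3) (by decide) ![n₀, n₁, n₂, n₃, n₄, n₅]
    ![n₀, n₁, n₂ + 1, n₃ - 1, n₄, n₅] rfl rfl (by intro k; fin_cases k <;> simp)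
  have t3 := coeff_X_mul_pderiv f (i := 3) (j := 4) (by decide) ![n₀, n₁, n₂, n₃, n₄, n₅]
    ![n₀, n₁, n₂, n₃ + 1, n₄ - 1, n₅] rfl rfl (by intro k; fin_cases k <;> simp)
  have t4 := coeff_X_mul_pderiv f (i := 4) (j := 5) (by decide) ![n₀, n₁, n₂, n₃, n₄, n₅]
    ![n₀, n₁, n₂, n₃, n₄ + 1, n₅ - 1] rfl rfl (by intro k; fin_cases k <;> simp)
  simp only [coeff_add, coeff_C_mul, t0, t1, t2, t3, t4, coeff_zero] at h
  exact h

/-- There is no invariant of degree six in which the monomial `a₀ a₃⁵` occurs: the equations that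
express the invariance under unipotent matrices force its coefficient to vanish. -/
theorem coeff6_eq_zero {f : R} (hf : ∀ g : SL2, actR g f = f) : coeff6 f 1 0 0 5 0 0 = 0 := by
  have hE := lower_invariant_coeff hf
  have hD := upper_invariant_coeff hf
  -- equations between the coefficients of the monomials of degree six and weight fifteen
  have e0 := hE 1 0 1 4 0 0
  have e1 := hD 0 2 0 3 0 1
  have e2 := hD 2 0 0 0 4 0
  have e3 := hE 1 1 0 3 1 0
  have e4 := hD 1 0 0 4 1 0
  have e5 := hD 1 1 0 1 3 0
  have e6 := hE 1 2 0 0 3 0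
  have e7 := hE 0 3 0 2 0 1
  have e8 := hE 0 2 0 4 0 0
  have e9 := hD 0 3 0 0 2 1
  norm_num at e0 e1 e2 e3 e4 e5 e6 e7 e8 e9
  linear_combination (-3 / 35) * e0 + (6 / 35) * e1 + (-24 / 7) * e2 + (-6 / 35) * e3 +
    (8 / 35) * e4 + (12 / 35) * e5 + (-18 / 35) * e6 + (-9 / 35) * e7 + (3 / 70) * e8 +
    (18 / 35) * e9

end Action

/-! ### Coprimality of the maximal minors -/

section Coprime

/-- The determinant of the generic quintic together with the matrix of `σ_τ(𝔽)`, an invariant of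
degree `18`. -/
def invariantD (τ : ℚ × ℚ × ℚ) : R := borderedDet (sigmaMat τ genericQuintic) X

theorem invariantD_mem (τ : ℚ × ℚ × ℚ) : invariantD τ ∈ idealB τ := by
  rw [idealB_eq, ← range_borderedDet]
  exact ⟨X, rfl⟩

theorem invariantD_isHomogeneous (τ : ℚ × ℚ × ℚ) : (invariantD τ).IsHomogeneous 18 := by
  rw [invariantD, borderedDet_apply, det_bordered]
  refine IsHomogeneous.sum _ _ _ fun j _ => ?_
  have h2 := (isHomogeneous_C (Fin 6) ((-1 : ℂ) ^ (j : ℕ))).mul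
    ((minor_degree τ j).mul (isHomogeneous_X ℂ j))
  simpa [mul_assoc] using h2

theorem actR_invariantD (g : SL2) (τ : ℚ × ℚ × ℚ) : actR g (invariantD τ) = invariantD τ := by
  have h := borderedDet_equivariant g τ genericQuintic_isHomogeneous
  have hX : (fun j : Fin 6 => coord 5 genericQuintic j) = X := by
    ext1 j
    rw [genericQuintic_eq, coord_form (by have := j.2; omega), extend_coe]
  rw [actPoly_genericQuintic, hX] at h
  exact h.symm

theorem eval_invariantD (τ : ℚ × ℚ × ℚ) (a : ℕ → ℂ) :
    eval (fun i : Fin 6 => a i) (invariantD τ) =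
      (bordered (fun i : Fin 6 => a i) (sigmaMat τ (form 5 a))).det := by
  have hm : map (eval fun i : Fin 6 => a i) genericQuintic = form 5 a :=
    map_genericQuintic _ (form_isHomogeneous 5 a) fun i => by
      rw [eval_X, quinticCoord_eq, coord_form (by have := i.2; omega)]
  rw [invariantD, borderedDet_apply, RingHom.map_det, ← hm, sigmaMat_map]
  congr 1
  ext i j
  refine Fin.cases ?_ (fun i => ?_) i
  · exact eval_X _
  · rfl

/-- The invariant vanishes at a quintic `F` if and only if `F` and the rows of the matrix of
`σ_τ(F)` are linearly dependent. -/
theorem det_bordered_eq_zero_iff (τ : ℚ × ℚ × ℚ) (a : ℕ → ℂ) :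
    (bordered (fun i : Fin 6 => a i) (sigmaMat τ (form 5 a))).det = 0 ↔
      ∃ (z : ℂ) (w : Fin 5 → ℂ), (z ≠ 0 ∨ w ≠ 0) ∧ ∀ k ≤ 5, z * a k + coordSigma a τ w k = 0 := by
  have hw : ∀ (w : Fin 5 → ℂ) (j : Fin 6),
      Matrix.vecMul w (sigmaMat τ (form 5 a)) j = coordSigma a τ w j := by
    intro w j
    rw [← coord_sigma, sigma_form, coord_form (by have := j.2; omega)]
  have hz : ∀ (z : ℂ) (w : Fin 5 → ℂ) (j : Fin 6), Matrix.vecMul (Fin.cons z w : Fin 6 → ℂ)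
      (bordered (fun i : Fin 6 => a i) (sigmaMat τ (form 5 a))) j =
      z * a j + coordSigma a τ w j := by
    intro z w j
    rw [← hw, Matrix.vecMul, dotProduct, Fin.sum_univ_succ]
    rfl
  rw [← Matrix.exists_vecMul_eq_zero_iff]
  constructor
  · rintro ⟨v, hv, hv0⟩
    rw [← Fin.cons_self_tail v] at hv hv0
    refine ⟨v 0, Fin.tail v, ?_, fun k hk => ?_⟩
    · by_contra! h
      apply hv
      rw [h.1, h.2]
      ext i
      refine Fin.cases ?_ (fun i => ?_) i <;> rfl
    · rw [← hz _ _ ⟨k, by omega⟩, hv0]; rfl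
  · rintro ⟨z, w, h, h0⟩
    refine ⟨Fin.cons z w, fun hc => ?_, ?_⟩
    · rcases h with h | h
      · exact h (congrFun hc 0)
      · exact h (funext fun i => congrFun hc i.succ)
    · ext j
      rw [hz]
      exact h0 j (by have := j.2; omega)

/-- The coordinates of the quintic `x₁⁵ + 10 x₁² x₂³`. -/
def testPoint : ℕ → ℂ := seq [1, 0, 0, 1]

theorem eval_invariantD_testPoint (τ : ℚ × ℚ × ℚ) :
    eval (fun i : Fin 6 => testPoint i) (invariantD τ) ≠ 0 := by
  rw [eval_invariantD, Ne, det_bordered_eq_zero_iff]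
  rintro ⟨z, w, h, h0⟩
  have e0 := h0 0 (by norm_num)
  have e1 := h0 1 (by norm_num)
  have e2 := h0 2 (by norm_num)
  have e3 := h0 3 (by norm_num)
  have e4 := h0 4 (by norm_num)
  have e5 := h0 5 (by norm_num)
  clear h0
  simp [coordSigma, coordU, coordV, coordT, coordD, coordE, coordZ, coordQ, coordQ2, coordQ3,
    coordH, seq, testPoint] at e0 e1 e2 e3 e4 e5
  norm_num at e0 e1 e2 e3 e4 e5
  have h1 : w 1 = 0 := by linear_combination (-5 / 3) * e0 + (5 / 3) * e3
  have hz : z = 0 := by linear_combination e0 + (1 / 2) * h1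
  have hw0 : w 0 = 0 := by linear_combination (5 / 3) * e2 - 6 * e5
  have hw4 : w 4 = 0 := by linear_combination (5 / 1296) * e4 + (5 / 1296) * (4 / 5) * e1
  rcases h with h | h
  · exact h hz
  · apply h
    ext i
    fin_cases i
    exacts [hw0, h1, e1, e5, hw4]

theorem two_pow_injective {m n : ℕ} (h : (2 : ℂ) ^ m = 2 ^ n) : m = n := by
  have : (2 : ℕ) ^ m = 2 ^ n := by exact_mod_cast h
  exact Nat.pow_right_injective le_rfl this

/-- The degree of an invariant of the quintic that does not vanish at `x₁⁵ + 10 x₁² x₂³` is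
divisible by `6`, but it is not `6`. -/
theorem degree_of_invariant {f : R} (hf : ∀ g : SL2, actR g f = f) {n : ℕ}
    (hn : f.IsHomogeneous n) (h0 : eval (fun i : Fin 6 => testPoint i) f ≠ 0) : 6 ∣ n ∧ n ≠ 6 := by
  rw [eval_eq'] at h0
  obtain ⟨m, -, hm⟩ := exists_ne_zero_of_sum_ne_zero h0
  have hc := left_ne_zero_of_mul hm
  have hp : ∀ i : Fin 6, testPoint i ^ m i ≠ 0 := fun i =>
    (prod_ne_zero_iff.mp (right_ne_zero_of_mul hm)) i (mem_univ i)
  have hz : ∀ i : Fin 6, testPoint i = 0 → m i = 0 := by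
    intro i hi
    by_contra h
    exact hp i (by rw [hi, zero_pow h])
  have m1 := hz 1 rfl
  have m2 := hz 2 rfl
  have m4 := hz 4 rfl
  have m5 := hz 5 rfl
  have hdeg : m.degree = n := by
    rw [Finsupp.degree_eq_weight_one]; exact hn hc
  rw [Finsupp.degree_eq_sum, Fin.sum_univ_six, m1, m2, m4, m5] at hdeg
  -- a torus element shows that the monomial has weight zero
  have ht := congrArg (coeff m) (hf (torus 2 two_ne_zero))
  rw [actR_torus, coeff_diagR, Fin.prod_univ_six, m1, m2, m4, m5] at ht
  have ht1 := mul_right_cancel₀ hc (ht.trans (one_mul _).symm)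
  simp only [Fin.val_zero, pow_zero, mul_one, Nat.sub_zero] at ht1
  rw [show ((3 : Fin 6) : ℕ) = 3 from rfl, show ((2 : ℂ)⁻¹ ^ (5 - 3) * 2 ^ 3) = 2 by norm_num,
    ← pow_mul, inv_pow, inv_mul_eq_one₀ (pow_ne_zero _ two_ne_zero)] at ht1
  have ht2 := two_pow_injective ht1
  refine ⟨⟨m 0, by omega⟩, fun h6 => hc ?_⟩
  have hme : m = Finsupp.equivFunOnFinite.symm ![1, 0, 0, 5, 0, 0] := by
    ext i
    fin_cases i
    exacts [(by omega : m 0 = 1), m1, m2, (by omega : m 3 = 5), m4, m5]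
  rw [hme]
  exact coeff6_eq_zero hf

/-- Since `2` is not a root of unity, the eigenvectors of the dilation by `2` are homogeneous. -/
theorem isHomogeneous_of_diagR {f : R} (hf : f ≠ 0) {u : ℂ}
    (h : diagR (fun _ => 2) f = C u * f) : ∃ n, f.IsHomogeneous n ∧ u = 2 ^ n := by
  have key : ∀ m, coeff m f ≠ 0 → 2 ^ m.degree = u := by
    intro m hm
    have h1 := congrArg (coeff m) h
    rw [coeff_diagR, coeff_C_mul, prod_pow_eq_pow_sum, ← Finsupp.degree_eq_sum] at h1
    exact mul_right_cancel₀ hm h1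
  obtain ⟨m, hm⟩ := exists_coeff_ne_zero hf
  refine ⟨m.degree, fun m' hm' => ?_, (key m hm).symm⟩
  have := two_pow_injective ((key m' hm').trans (key m hm).symm)
  rwa [Finsupp.degree_eq_weight_one] at this ⊢

theorem isHomogeneous_factors {d q : R} {N : ℕ} (h : (d * q).IsHomogeneous N) (h0 : d * q ≠ 0)
    {u : ℂ} (hu : diagR (fun _ => 2) d = C u * d) :
    ∃ n n', d.IsHomogeneous n ∧ q.IsHomogeneous n' ∧ n + n' = N := by
  obtain ⟨n, hn, rfl⟩ := isHomogeneous_of_diagR (left_ne_zero_of_mul h0) hu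
  have h1 := diagR_const_of_isHomogeneous 2 h
  rw [map_mul, hu] at h1
  have h2 : diagR (fun _ => 2) q = C (((2 : ℂ) ^ n)⁻¹ * 2 ^ N) * q := by
    have hC : C (((2 : ℂ) ^ n)⁻¹) * C (2 ^ n) = (1 : R) := by
      rw [← C_mul, inv_mul_cancel₀ (pow_ne_zero _ two_ne_zero), C_1]
    apply mul_left_cancel₀ (left_ne_zero_of_mul h0)
    rw [C_mul]
    linear_combination C (((2 : ℂ) ^ n)⁻¹) * h1 - d * diagR (fun _ => 2) q * hC
  obtain ⟨n', hn', -⟩ := isHomogeneous_of_diagR (right_ne_zero_of_mul h0) h2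
  exact ⟨n, n', hn, hn', (hn.mul hn').inj_right h h0⟩

/-- The ideal `𝔟_τ` contains two elements without common factors. Its greatest common divisor `d`
is an invariant, and so is the cofactor `e` in `invariantD τ = d * e`. Neither of them vanishes at
`x₁⁵ + 10 x₁² x₂³`, so by `degree_of_invariant` their degrees are multiples of `6` other than `6`
with sum `18`. As `d` divides the minors, of degree `17`, it is constant. -/
theorem exists_relPrime_idealB (τ : ℚ × ℚ × ℚ) :
    ∃ f ∈ idealB τ, ∃ h ∈ idealB τ, f ≠ 0 ∧ ∀ a, f ∣ h * a → f ∣ a := by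
  have hD0 : invariantD τ ≠ 0 := fun h => eval_invariantD_testPoint τ (by rw [h, map_zero])
  have hI : idealB τ ≠ ⊥ := fun h => hD0 (by simpa [h] using invariantD_mem τ)
  refine exists_relPrime_of_gcd hI ?_
  obtain ⟨d, h1, h2⟩ := exists_gcd_ideal (idealB τ) (IsNoetherian.noetherian _)
  have hdu : IsUnit d := by
    obtain ⟨e, he⟩ := h1 _ (invariantD_mem τ)
    have hde : d * e ≠ 0 := he ▸ hD0
    have hd0 := left_ne_zero_of_mul hde
    have hdN := invariantD_isHomogeneous τ
    -- `d` is an eigenvector of `SL₂`, hence an invariant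
    have hinv : ∀ g : SL2, actR g d = d := by
      have hg : ∀ g : SL2, ∃ c : ℂ, c ≠ 0 ∧ actR g d = C c * d := fun g =>
        exists_semiinvariant h1 h2 (actR g) (actR g⁻¹)
          (fun f => by rw [← actR_mul, mul_inv_cancel, actR_one])
          (fun f => by rw [← actR_mul, inv_mul_cancel, actR_one])
          (fun f hf => actR_mem_idealB g τ hf) (fun f hf => actR_mem_idealB _ τ hf)
      choose c hc hcd using hg
      have huniq : ∀ a b : ℂ, C a * d = C b * d → a = b := fun a b hab =>
        C_injective _ _ (mul_right_cancel₀ hd0 hab)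
      let χ : SL2 →* ℂ :=
        { toFun := c
          map_one' := huniq _ _ (by rw [← hcd, actR_one, C_1, one_mul])
          map_mul' := fun g h => huniq _ _ (by
            rw [← hcd, actR_mul, hcd h, map_mul, hcd g, ← algebraMap_eq, AlgHom.commutes,
              algebraMap_eq, C_mul]
            ring) }
      intro g
      have : c g = 1 := map_SL2_eq_one χ g
      rw [hcd, this, C_1, one_mul]
    have hinv' : ∀ g : SL2, actR g e = e := by
      intro g
      have h := actR_invariantD g τ
      rw [he, map_mul, hinv] at h
      exact mul_left_cancel₀ hd0 h
    -- `d` and `e` are homogeneous, because the ideal is stable under dilations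
    obtain ⟨u, -, hu⟩ := exists_semiinvariant h1 h2 (diagR fun _ => 2) (diagR fun _ => 2⁻¹)
      (diagR_const_inv two_ne_zero)
      (fun f => by simpa using diagR_const_inv (inv_ne_zero (two_ne_zero (α := ℂ))) f)
      (fun f hf => diagR_mem_idealB 2 hf) (fun f hf => diagR_mem_idealB _ hf)
    obtain ⟨n, n', hn, hn', hnn⟩ := isHomogeneous_factors (he ▸ hdN) hde hu
    have hev := eval_invariantD_testPoint τ
    rw [he, map_mul] at hev
    have k1 := degree_of_invariant hinv hn (left_ne_zero_of_mul hev)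
    have k2 := degree_of_invariant hinv' hn' (right_ne_zero_of_mul hev)
    obtain ⟨j, hj⟩ : ∃ j, minor (sigmaMat τ genericQuintic) j ≠ 0 := by
      by_contra! hM
      apply hI
      rw [idealB_eq, Ideal.span_eq_bot]
      rintro _ ⟨j, rfl⟩
      exact hM j
    obtain ⟨q, hq⟩ := h1 (minor (sigmaMat τ genericQuintic) j)
      (by rw [idealB_eq]; exact Ideal.subset_span ⟨j, rfl⟩)
    obtain ⟨m, m', hm, -, hmm⟩ := isHomogeneous_factors (hq ▸ minor_degree τ j) (hq ▸ hj) hu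
    have hnm := hn.inj_right hm hd0
    -- `n` and `18 - n` are multiples of `6` other than `6`, and `n` is at most `17`
    have hn0 : n = 0 := by omega
    have hdC := totalDegree_eq_zero_iff_eq_C.mp ((hn.totalDegree hd0).trans hn0)
    rw [isUnit_iff_eq_C_of_isReduced]
    refine ⟨_, ?_, hdC⟩
    rw [isUnit_iff_ne_zero]
    intro h
    rw [h, C_0] at hdC
    exact hd0 hdC
  intro e he
  exact isUnit_of_dvd_unit (h2 e he) hdu

end Coprime

/-! ### Dependence along orbits, and the inclusion of `ℬ` -/

section Orbits

variable {τ : ℚ × ℚ × ℚ} {F : MvPolynomial (Fin 2) ℂ}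

theorem substM_injective {h : Matrix (Fin 2) (Fin 2) ℂ} (hh : h.det ≠ 0) :
    Function.Injective (substM h) := by
  intro G H hGH
  have e := congrArg (substM h⁻¹) hGH
  rwa [substM_substM, substM_substM, Matrix.nonsing_inv_mul _ (isUnit_iff_ne_zero.mpr hh),
    substM_one, substM_one] at e

/-- The coordinate-free form of `Dependent`. -/
theorem dependent_iff_exists : Dependent τ F ↔ ∃ (G : MvPolynomial (Fin 2) ℂ) (c₁ c₂ : ℂ),
    G.IsHomogeneous 2 ∧ (G ≠ 0 ∨ c₁ ≠ 0 ∨ c₂ ≠ 0) ∧ sigma F τ G (C c₁) (C c₂) = 0 := by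
  constructor
  · rintro ⟨w, hw, h⟩
    refine ⟨_, _, _, quad_isHomogeneous _ _ _, ?_, h⟩
    by_contra! hc
    obtain ⟨h1, h2, h3⟩ := hc
    apply hw
    have hq : form 2 (seq [w 0, w 1 / 2, w 2]) = 0 := by rw [← quad_eq_form, h1]
    have hk : ∀ k ≤ 2, seq [w 0, w 1 / 2, w 2] k = 0 := fun k hk => by
      rw [← coord_form hk (seq _), hq]; simp [coord]
    have k0 := hk 0 (by norm_num)
    have k1 := hk 1 (by norm_num)
    have k2 := hk 2 (by norm_num)
    simp [seq] at k0 k1 k2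
    ext i
    fin_cases i
    exacts [k0, k1, k2, h2, h3]
  · rintro ⟨G, c₁, c₂, hG, h0, h⟩
    obtain ⟨w, h1, h2, h3⟩ := exists_eq_quad
      ((⟨G, hG⟩, ⟨C c₁, isHomogeneous_C _ _⟩, ⟨C c₂, isHomogeneous_C _ _⟩) :
        BinaryForm ℂ 2 × BinaryForm ℂ 0 × BinaryForm ℂ 0)
    dsimp only at h1 h2 h3
    refine ⟨w, ?_, by rw [← h1, ← h2, ← h3, h]⟩
    rintro rfl
    rcases h0 with h0 | h0 | h0
    · exact h0 (by rw [h1]; simp [quad])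
    · exact h0 (C_injective _ _ h2)
    · exact h0 (C_injective _ _ h3)

/-- The zero locus is stable under `GL₂`. -/
theorem Dependent.substM (hF : Dependent τ F) {h : Matrix (Fin 2) (Fin 2) ℂ} (hh : h.det ≠ 0) :
    Dependent τ (substM h F) := by
  rw [dependent_iff_exists] at hF ⊢
  obtain ⟨G, c₁, c₂, hG, h0, hs⟩ := hF
  have hC : (C h.det⁻¹ : MvPolynomial (Fin 2) ℂ) ≠ 0 := by
    rw [Ne, C_eq_zero]; exact inv_ne_zero hh
  refine ⟨Quintic.substM h (C h.det⁻¹ * G), (h.det ^ 10)⁻¹ * c₁, (h.det ^ 20)⁻¹ * c₂,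
    substM_isHomogeneous h (by simpa using (isHomogeneous_C (Fin 2) h.det⁻¹).mul hG), ?_, ?_⟩
  · rcases h0 with h0 | h0 | h0
    · left
      rw [Ne, ← map_zero (Quintic.substM h), (substM_injective hh).eq_iff]
      exact mul_ne_zero hC h0
    · exact Or.inr (Or.inl (mul_ne_zero (inv_ne_zero (pow_ne_zero _ hh)) h0))
    · exact Or.inr (Or.inr (mul_ne_zero (inv_ne_zero (pow_ne_zero _ hh)) h0))
  · have e := sigma_substM F h τ (C h.det⁻¹ * G) (C ((h.det ^ 10)⁻¹ * c₁)) (C ((h.det ^ 20)⁻¹ * c₂))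
    rw [substM_C, substM_C, ← mul_assoc, ← C_mul, ← C_mul, ← C_mul, mul_inv_cancel₀ hh,
      mul_inv_cancel_left₀ (pow_ne_zero _ hh), mul_inv_cancel_left₀ (pow_ne_zero _ hh), C_1,
      one_mul, hs, map_zero] at e
    exact e

/-- If `𝒰` and `𝒱` are both multiples of `F`, then they are proportional to each other. -/
theorem dependent_of_proportional {a : ℕ → ℂ} {u v : ℂ} (hU : ∀ k ≤ 5, coordU a τ.1 k = u * a k)
    (hV : ∀ k ≤ 5, coordV a τ.2.1 τ.2.2 k = v * a k) : Dependent τ (form 5 a) := by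
  rw [dependent_form_iff]
  by_cases hu : u = 0
  · refine ⟨Pi.single 3 1, by simp, fun k hk => ?_⟩
    simp [coordSigma, hU k hk, hu]
  · refine ⟨![0, 0, 0, v, -u], fun h => hu ?_, fun k hk => ?_⟩
    · simpa using congrFun h 4
    · simp [coordSigma, hU k hk, hV k hk]
      ring

/-- The covariant `𝒱` vanishes at quintics with a triple root. -/
theorem dependent_of_cube {a : ℕ → ℂ} (h3 : a 3 = 0) (h4 : a 4 = 0) (h5 : a 5 = 0) :
    Dependent τ (form 5 a) := by
  rw [dependent_form_iff]
  refine ⟨Pi.single 4 1, by simp, fun k hk => ?_⟩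
  interval_cases k <;>
    simp [coordSigma, coordV, coordE, coordD, coordZ, coordQ, coordQ2, coordQ3, coordH, seq, h3, h4,
      h5]

theorem formU_eq (i : Fin 6) : formU i = form 5 (seq (
    ![[1, 0, 0, 0, 0, 1], [0, 1 / 5, 0, 0, -1 / 5], [0, 1 / 5, 1 / 10], [0, 0, 1 / 10], [0, 1 / 5],
      [1]] i)) := by
  have h5 : (C 5⁻¹ : MvPolynomial (Fin 2) ℂ) * 5 = 1 := by
    rw [← map_ofNat C, ← C_mul, inv_mul_cancel₀ (by norm_num), C_1]
  have h10 : (C 10⁻¹ : MvPolynomial (Fin 2) ℂ) * 10 = 1 := by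
    rw [← map_ofNat C, ← C_mul, inv_mul_cancel₀ (by norm_num), C_1]
  rw [form_five]
  fin_cases i <;> simp [formU, seq, neg_div]
  · linear_combination (X 0 * X 1 ^ 4 - X 0 ^ 4 * X 1) * h5
  · linear_combination (-(X 0 ^ 4 * X 1)) * h5 - (X 0 ^ 3 * X 1 ^ 2) * h10
  · linear_combination h10
  · linear_combination h5

theorem dependent_formU (i : Fin 6) : Dependent τ (formU i) := by
  rw [formU_eq]
  fin_cases i
  · refine dependent_of_proportional (u := 2 * τ.1) (v := -(4 * τ.2.1 - 4 / 5 * τ.2.2)) ?_ ?_ <;>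
    · intro k hk
      interval_cases k <;> simp [coordU, coordV, coordT, coordE, coordD, coordZ, coordQ, coordQ2,
        coordQ3, coordH, seq]
      all_goals ring
  · refine dependent_of_proportional (u := -36 / 3125 + 18 / 625 * τ.1)
      (v := -(324 / 390625 * τ.2.1 + 756 / 1953125 * τ.2.2)) ?_ ?_ <;>
    · intro k hk
      interval_cases k <;> simp [coordU, coordV, coordT, coordE, coordD, coordZ, coordQ, coordQ2,
        coordQ3, coordH, seq]
      all_goals ring
  all_goals exact dependent_of_cube rfl rfl rfl

/-- `F` lies in the `GL₂`-orbit of one of the six forms. As scalar matrices act on quintics by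
fifth powers, this says that the point `[F]` belongs to `ℬ`. -/
def InB (F : MvPolynomial (Fin 2) ℂ) : Prop :=
  ∃ h : Matrix (Fin 2) (Fin 2) ℂ, h.det ≠ 0 ∧ ∃ i, F = substM h (formU i)

theorem InB.dependent (h : InB F) : Dependent τ F := by
  obtain ⟨h, hh, i, rfl⟩ := h
  exact (dependent_formU i).substM hh

theorem InB.substM (hF : InB F) {h : Matrix (Fin 2) (Fin 2) ℂ} (hh : h.det ≠ 0) :
    InB (substM h F) := by
  obtain ⟨k, hk, i, rfl⟩ := hF
  exact ⟨h * k, by rw [Matrix.det_mul]; exact mul_ne_zero hh hk, i, substM_substM h k _⟩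

theorem InB.of_substM {h : Matrix (Fin 2) (Fin 2) ℂ} (hh : h.det ≠ 0)
    (hF : InB (Quintic.substM h F)) : InB F := by
  have h1 := hF.substM (h := h⁻¹) (by
    rw [Matrix.det_nonsing_inv, Ring.inverse_eq_inv']; exact inv_ne_zero hh)
  rwa [substM_substM, Matrix.nonsing_inv_mul _ (isUnit_iff_ne_zero.mpr hh), substM_one] at h1

theorem substM_scalar (c : ℂ) {m : ℕ} {G : MvPolynomial (Fin 2) ℂ} (hG : G.IsHomogeneous m) :
    substM (c • (1 : Matrix (Fin 2) (Fin 2) ℂ)) G = C (c ^ m) * G := by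
  have h : ∀ j : Fin 2, substM (c • (1 : Matrix (Fin 2) (Fin 2) ℂ)) (X j) = C c * X j := by
    intro j
    rw [substM_X]
    revert j
    rw [Fin.forall_fin_two]
    simp
  rw [← form_coord hG, form, map_sum, mul_sum]
  refine sum_congr rfl fun k hk => ?_
  have hk' : k ≤ m := by simpa [Nat.lt_succ_iff] using hk
  rw [monomial_expo, map_mul, map_mul, map_pow, map_pow, h, h, substM_C, mul_pow, mul_pow]
  have hp : (C (c ^ m) : MvPolynomial (Fin 2) ℂ) = C c ^ (m - k) * C c ^ k := by
    rw [← pow_add, Nat.sub_add_cancel hk', C_pow]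
  rw [hp]
  ring

theorem InB.C_mul (hF : InB F) (h5 : F.IsHomogeneous 5) {c : ℂ} (hc : c ≠ 0) : InB (C c * F) := by
  obtain ⟨d, hd⟩ := IsAlgClosed.exists_pow_nat_eq c (n := 5) (by norm_num)
  have hd0 : d ≠ 0 := by rintro rfl; simp at hd; exact hc hd.symm
  rw [← hd, ← substM_scalar d h5]
  exact hF.substM (by simp [hd0])

theorem Dependent.C_mul (hF : Dependent τ F) (h5 : F.IsHomogeneous 5) {c : ℂ} (hc : c ≠ 0) :
    Dependent τ (C c * F) := by
  obtain ⟨d, hd⟩ := IsAlgClosed.exists_pow_nat_eq c (n := 5) (by norm_num)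
  have hd0 : d ≠ 0 := by rintro rfl; simp at hd; exact hc hd.symm
  rw [← hd, ← substM_scalar d h5]
  exact hF.substM (by simp [hd0])

theorem formU_isHomogeneous (i : Fin 6) : (formU i).IsHomogeneous 5 := by
  rw [formU_eq]; exact form_isHomogeneous _ _

theorem mem_locusB_iff (F : BinaryForm ℂ 5) (hF : F ≠ 0) :
    Projectivization.mk ℂ F hF ∈ locusB ↔ InB (F : MvPolynomial (Fin 2) ℂ) := by
  constructor
  · rintro ⟨G, hG, hGF, g, i, h⟩
    obtain ⟨c, hc⟩ := (Projectivization.mk_eq_mk_iff' ℂ F G hF hG).mp hGF.symm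
    have hc0 : c ≠ 0 := by rintro rfl; rw [zero_smul] at hc; exact hF hc.symm
    have hG' : InB (G : MvPolynomial (Fin 2) ℂ) := ⟨g, by rw [g.2]; exact one_ne_zero, i, h⟩
    have h1 := hG'.C_mul G.2 hc0
    rw [← smul_eq_C_mul] at h1
    rw [← hc]
    exact h1
  · rintro ⟨h, hh, i, hi⟩
    obtain ⟨d, hd⟩ := IsAlgClosed.exists_pow_nat_eq h.det (n := 2) (by norm_num)
    have hd0 : d ≠ 0 := by rintro rfl; simp at hd; exact hh hd.symm
    have hdet : (d⁻¹ • h).det = 1 := by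
      rw [Matrix.det_smul, Fintype.card_fin, ← hd, ← mul_pow, inv_mul_cancel₀ hd0, one_pow]
    let g : SL2 := ⟨d⁻¹ • h, hdet⟩
    have hg : subst g (formU i) = C (d⁻¹ ^ 5) * (F : MvPolynomial (Fin 2) ℂ) := by
      change substM (d⁻¹ • h) (formU i) = _
      rw [hi, ← substM_scalar _ (substM_isHomogeneous h (formU_isHomogeneous i)), substM_substM,
        Matrix.smul_mul, Matrix.one_mul]
    have hd5 : d⁻¹ ^ 5 ≠ 0 := pow_ne_zero _ (inv_ne_zero hd0)
    refine ⟨d⁻¹ ^ 5 • F, smul_ne_zero hd5 hF, ?_, g, i, ?_⟩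
    · rw [Projectivization.mk_eq_mk_iff']
      exact ⟨_, rfl⟩
    · rw [hg, Submodule.coe_smul, smul_eq_C_mul]

theorem mem_zeroLocus_iff (F : BinaryForm ℂ 5) (hF : F ≠ 0) :
    Projectivization.mk ℂ F hF ∈ zeroLocus (idealB τ) ↔
      Dependent τ (F : MvPolynomial (Fin 2) ℂ) := by
  constructor
  · intro h
    rw [dependent_iff_idealB τ F.2]
    exact h F hF rfl
  · rintro h G hG hGF
    rw [← dependent_iff_idealB τ G.2]
    obtain ⟨c, hc⟩ := (Projectivization.mk_eq_mk_iff' ℂ G F hG hF).mp hGF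
    have hc0 : c ≠ 0 := by rintro rfl; rw [zero_smul] at hc; exact hG hc.symm
    have h1 := h.C_mul F.2 hc0
    rw [← smul_eq_C_mul] at h1
    rw [← hc]
    exact h1

theorem locusB_subset (τ : ℚ × ℚ × ℚ) : locusB ⊆ zeroLocus (idealB τ) := by
  intro p
  induction p using Projectivization.ind with
  | h F hF =>
    rw [mem_locusB_iff, mem_zeroLocus_iff]
    exact InB.dependent

theorem locusB_eq_iff (τ : ℚ × ℚ × ℚ) : locusB = zeroLocus (idealB τ) ↔
    ∀ F : MvPolynomial (Fin 2) ℂ, F.IsHomogeneous 5 → F ≠ 0 → Dependent τ F → InB F := by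
  constructor
  · intro h F hF hF0 hd
    have hF0' : (⟨F, hF⟩ : BinaryForm ℂ 5) ≠ 0 := fun hc => hF0 (congrArg Subtype.val hc)
    have h1 := (mem_zeroLocus_iff (τ := τ) ⟨F, hF⟩ hF0').mpr hd
    rw [← h, mem_locusB_iff] at h1
    exact h1
  · intro h
    refine Set.Subset.antisymm (locusB_subset τ) fun p => ?_
    induction p using Projectivization.ind with
    | h F hF =>
      rw [mem_locusB_iff, mem_zeroLocus_iff]
      exact h F F.2 fun hc => hF (Subtype.ext hc)

end Orbits

/-! ### The height -/

section Height

/-- The coordinates of the quintics `y³ (b₀ y² + 5 b₁ y x₂ + 10 b₂ x₂²)` with triple root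
`y = x₁ + t x₂`, as polynomials in the parameters `(b₀, b₁, b₂, t)` of which the last `k` are set to
zero. -/
def cubeParam (k : ℕ) : R →ₐ[ℂ] MvPolynomial (Fin 4) ℂ :=
  aeval fun i : Fin 6 => ∑ j ∈ range (i + 1), ((i : ℕ).choose j : MvPolynomial (Fin 4) ℂ) *
    (if k < 1 then X 3 else 0) ^ j *
      extend ![if k < 4 then X 0 else 0, if k < 3 then X 1 else 0, if k < 2 then X 2 else 0] (i - j)

theorem idealB_le_ker_cubeParam (τ : ℚ × ℚ × ℚ) :
    idealB τ ≤ RingHom.ker (cubeParam 0) := by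
  intro f hf
  rw [RingHom.mem_ker]
  apply MvPolynomial.funext
  intro v
  rw [map_zero]
  have hd : Dependent τ (substM !![1, 0; v 3, 1] (form 5 (seq [v 0, v 1, v 2]))) :=
    Dependent.substM (dependent_of_cube rfl rfl rfl) (by simp)
  rw [dependent_iff_idealB τ (substM_isHomogeneous _ (form_isHomogeneous _ _))] at hd
  rw [← hd f hf, substM_lower_form]
  have e : (MvPolynomial.aeval v).comp (cubeParam 0) =
      MvPolynomial.aeval (quinticCoord (form 5 fun k => ∑ j ∈ range (k + 1),
        (k.choose j : ℂ) * v 3 ^ j * seq [v 0, v 1, v 2] (k - j))) := by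
    apply MvPolynomial.algHom_ext
    intro i
    rw [aeval_X, quinticCoord_eq, coord_form (by have := i.2; omega), AlgHom.comp_apply, cubeParam,
      aeval_X]
    fin_cases i <;> simp [sum_range_succ, extend, seq]
  exact DFunLike.congr_fun e f

/-- Setting one more parameter to zero makes one more of the coordinates `a₃, a₂, a₁, a₀` vanish. -/
theorem ker_cubeParam_lt {k : ℕ} (hk : k < 4) :
    RingHom.ker (cubeParam k) < RingHom.ker (cubeParam (k + 1)) := by
  have h : cubeParam (k + 1) =
      (aeval fun i : Fin 4 => if (i : ℕ) + k = 3 then 0 else X i :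
        MvPolynomial (Fin 4) ℂ →ₐ[ℂ] _).comp (cubeParam k) := by
    apply MvPolynomial.algHom_ext
    intro i
    rw [AlgHom.comp_apply, cubeParam, cubeParam, aeval_X, aeval_X]
    interval_cases k <;> fin_cases i <;> simp [sum_range_succ, extend]
  refine SetLike.lt_iff_le_and_exists.mpr ⟨fun f hf => ?_, X ⟨3 - k, by omega⟩, ?_, ?_⟩
  · rw [RingHom.mem_ker] at hf ⊢
    rw [h, AlgHom.comp_apply, hf, map_zero]
  · rw [RingHom.mem_ker, cubeParam, aeval_X]
    interval_cases k <;> simp [sum_range_succ, extend]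
  · rw [RingHom.mem_ker, cubeParam, aeval_X]
    intro hc
    have := congrArg (eval fun _ => (1 : ℂ)) hc
    interval_cases k <;> simp [sum_range_succ, extend] at this
    norm_num at this

/-- The ideal vanishes on the quintics with a triple root. Above their prime ideal lies a chain of
four further primes, so its height is at most `6 - 4`. -/
theorem height_idealB_le (τ : ℚ × ℚ × ℚ) : (idealB τ).height ≤ 2 := by
  have hprime : ∀ k, (RingHom.ker (cubeParam k)).IsPrime := fun k => RingHom.ker_isPrime _
  have hstep : ∀ k < 4, (RingHom.ker (cubeParam k)).height + 1 ≤
      (RingHom.ker (cubeParam (k + 1))).height := fun k hk => by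
    have := hprime k
    have := hprime (k + 1)
    exact Ideal.height_add_one_le_of_lt_of_isPrime (ker_cubeParam_lt hk)
  have hdim : ringKrullDim R = (6 : ℕ) := by
    rw [ringKrullDim_of_isNoetherianRing, ringKrullDim_eq_zero_of_field]
    simp
  have h4 : (RingHom.ker (cubeParam 4)).height ≤ 6 := by
    have := Ideal.height_le_ringKrullDim_of_ne_top (hprime 4).ne_top
    rw [hdim] at this
    exact WithBot.coe_le_coe.mp this
  have h0 := hstep 0 (by norm_num)
  have h1 := hstep 1 (by norm_num)
  have h2 := hstep 2 (by norm_num)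
  have h3 := hstep 3 (by norm_num)
  have hP := Ideal.height_mono (idealB_le_ker_cubeParam τ)
  refine hP.trans ?_
  have hsum : (RingHom.ker (cubeParam 0)).height + 1 + 1 + 1 + 1 ≤ 6 :=
    (add_le_add_left ((add_le_add_left ((add_le_add_left h0 1).trans h1) 1).trans h2) 1).trans
      (h3.trans h4)
  have hfin : (RingHom.ker (cubeParam 0)).height ≠ ⊤ := by
    intro h
    rw [h] at hsum
    exact absurd hsum (by decide)
  lift (RingHom.ker (cubeParam 0)).height to ℕ using hfin with n
  have : n + 1 + 1 + 1 + 1 ≤ 6 := by exact_mod_cast hsum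
  have : n ≤ 2 := by omega
  exact_mod_cast this

end Height

/-! ### Trinomial quintics, and the necessity of the three triples -/

section Trinomial

/-- A quartic with complex coefficients is a product of linear factors. Each root found is divided
out by Horner's scheme. -/
theorem exists_roots_quartic (c₀ c₁ c₂ c₃ c₄ : ℂ) (h : c₄ ≠ 0) : ∃ r₁ r₂ r₃ r₄ : ℂ,
    ∀ x, c₀ + c₁ * x + c₂ * x ^ 2 + c₃ * x ^ 3 + c₄ * x ^ 4 =
      c₄ * ((x - r₁) * (x - r₂) * (x - r₃) * (x - r₄)) := by
  obtain ⟨r₁, h1⟩ := IsAlgClosed.exists_root (k := ℂ)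
    (Polynomial.C c₀ + Polynomial.C c₁ * Polynomial.X + Polynomial.C c₂ * Polynomial.X ^ 2 +
      Polynomial.C c₃ * Polynomial.X ^ 3 + Polynomial.C c₄ * Polynomial.X ^ 4) (by
      rw [show Polynomial.degree _ = 4 by compute_degree!]; decide)
  obtain ⟨r₂, h2⟩ := IsAlgClosed.exists_root (k := ℂ)
    (Polynomial.C (c₁ + c₂ * r₁ + c₃ * r₁ ^ 2 + c₄ * r₁ ^ 3) +
    Polynomial.C (c₂ + c₃ * r₁ + c₄ * r₁ ^ 2) * Polynomial.X +
    Polynomial.C (c₃ + c₄ * r₁) * Polynomial.X ^ 2 + Polynomial.C c₄ * Polynomial.X ^ 3) (by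
      rw [show Polynomial.degree _ = 3 by compute_degree!]; decide)
  obtain ⟨r₃, h3⟩ := IsAlgClosed.exists_root (k := ℂ)
    (Polynomial.C (c₂ + c₃ * r₁ + c₄ * r₁ ^ 2 + (c₃ + c₄ * r₁) * r₂ + c₄ * r₂ ^ 2) +
    Polynomial.C (c₃ + c₄ * r₁ + c₄ * r₂) * Polynomial.X + Polynomial.C c₄ * Polynomial.X ^ 2) (by
      rw [show Polynomial.degree _ = 2 by compute_degree!]; decide)
  simp only [Polynomial.IsRoot, Polynomial.eval_add, Polynomial.eval_mul, Polynomial.eval_C,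
    Polynomial.eval_X, Polynomial.eval_pow] at h1 h2 h3
  refine ⟨r₁, r₂, r₃, -(c₃ + c₄ * r₁ + c₄ * r₂ + c₄ * r₃) / c₄, fun x => ?_⟩
  have h4 : c₄ * (-(c₃ + c₄ * r₁ + c₄ * r₂ + c₄ * r₃) / c₄) = -(c₃ + c₄ * r₁ + c₄ * r₂ + c₄ * r₃) :=
    mul_div_cancel₀ _ h
  linear_combination h1 + (x - r₁) * h2 + (x - r₁) * (x - r₂) * h3 +
    (x - r₁) * (x - r₂) * (x - r₃) * h4

/-- On `ℬ` one of the covariants `ϑ₃₃` and `ϑ₅₁` vanishes. -/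
theorem InB.theta33_or_theta51 {F : MvPolynomial (Fin 2) ℂ} (hF : InB F) :
    theta33 F = 0 ∨ theta51 F = 0 := by
  obtain ⟨h, -, i, rfl⟩ := hF
  rw [theta33_substM, theta51_substM]
  have key : theta33 (formU i) = 0 ∨ theta51 (formU i) = 0 := by
    rw [formU_eq, theta33_form, theta51_form]
    fin_cases i
    · left
      rw [← form_zero 3]
      refine form_congr fun k hk => ?_
      interval_cases k <;> simp [coordT, coordQ, seq]
    all_goals
      right
      rw [← form_zero 1]
      refine form_congr fun k hk => ?_
      interval_cases k <;> simp [coordE, coordQ2, coordQ, seq]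
  rcases key with key | key
  · left; rw [key, map_zero, mul_zero]
  · right; rw [key, map_zero, mul_zero]

theorem form_eq_zero {m k : ℕ} {g : ℕ → ℂ} (h : form m g = 0) (hk : k ≤ m) : g k = 0 := by
  rw [← coord_form hk g, h]; simp [coord]

theorem not_inB_of_coord {a : ℕ → ℂ} (h3 : ∃ k ≤ 3, coordT a k ≠ 0) (h5 : ∃ k ≤ 1, coordE a k ≠ 0) :
    ¬ InB (form 5 a) := by
  intro h
  obtain ⟨k, hk, hk'⟩ := h3
  obtain ⟨j, hj, hj'⟩ := h5
  rcases h.theta33_or_theta51 with h | h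
  · exact hk' (form_eq_zero (theta33_form a ▸ h) hk)
  · exact hj' (form_eq_zero (theta51_form a ▸ h) hj)

/-- Up to the factor `(s - 1) (s + 15)`, the determinant that decides the dependence of the
quintic `s x₁⁵ + 10 x₁³x₂² + 5 x₁x₂⁴`. -/
def trinomialPoly (α β γ : ℚ) (s : ℂ) : ℂ :=
  (-144 / 25 - 27648 / 5 * α + 221184 / 25 * β - 203904 / 125 * γ) +
  (576 / 25 - 52224 / 5 * α + 73728 / 5 * β - 77568 / 25 * γ) * s +
  (-864 / 25 - 111616 / 25 * α + 172032 / 25 * β - 187392 / 125 * γ) * s ^ 2 +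
  (576 / 25 - 13312 / 25 * α + 24576 / 25 * β - 5376 / 125 * γ) * s ^ 3 +
  (-144 / 25 - 384 / 25 * γ) * s ^ 4

/-- The coordinates of the trinomial `s x₁⁵ + 10 x₁³x₂² + 5 x₁x₂⁴`. -/
def trinomial (s : ℂ) : ℕ → ℂ := seq [s, 0, 1, 0, 1]

theorem coordT_trinomial (s : ℂ) : coordT (trinomial s) 0 = 6 * (1 - s) := by
  simp [coordT, coordQ, seq, trinomial]; ring

theorem coordE_trinomial (s : ℂ) : coordE (trinomial s) 0 = 4 * (s - 1) * (s + 15) := by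
  simp [coordE, coordQ2, coordQ, seq, trinomial]; ring

/-- The determinant of `σ_τ` at a trinomial splits off a determinant of size three, because the sign
change of `x₂` fixes the trinomial. -/
theorem dependent_trinomial_iff (τ : ℚ × ℚ × ℚ) (s : ℂ) :
    Dependent τ (form 5 (trinomial s)) ↔
      (s - 1) * (s + 15) * trinomialPoly τ.1 τ.2.1 τ.2.2 s = 0 := by
  set a := trinomial s with ha
  have hE0 : coordE a 0 = 4 * (s - 1) * (s + 15) := coordE_trinomial s
  have hE1 : coordE a 1 = 0 := by
    simp [coordE, coordQ2, coordQ, seq, ha, trinomial]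
  have hZ : coordZ a = -7664 / 5 * s - 144 / 5 * s ^ 2 - 16 * s ^ 3 - 8496 / 5 := by
    simp [coordZ, coordQ3, coordH, coordQ, seq, ha, trinomial]; ring
  have hD : coordD a = -32 * s - 96 := by
    simp [coordD, coordQ, seq, ha, trinomial]; ring
  have hQ0 : coordQ a 0 = 2 * s + 6 := by simp [coordQ, seq, ha, trinomial]; ring
  have hQ1 : coordQ a 1 = 0 := by simp [coordQ, seq, ha, trinomial]
  have hQ2 : coordQ a 2 = -8 := by simp [coordQ, seq, ha, trinomial]; ring
  have hT0 : coordT a 0 = 6 * (1 - s) := coordT_trinomial s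
  have hT1 : coordT a 1 = 0 := by simp [coordT, coordQ, seq, ha, trinomial]
  have hT2 : coordT a 2 = 2 * s - 2 := by simp [coordT, coordQ, seq, ha, trinomial]; ring
  have hT3 : coordT a 3 = 0 := by simp [coordT, coordQ, seq, ha, trinomial]
  have a0 : a 0 = s := rfl
  have a1 : a 1 = 0 := rfl
  have a2 : a 2 = 1 := rfl
  have a3 : a 3 = 0 := rfl
  have a4 : a 4 = 1 := rfl
  have a5 : a 5 = 0 := rfl
  have a6 : a 6 = 0 := rfl
  have hU0 : coordU a τ.1 0 = (6 * (1 - s)) * (2 * s + 6) - τ.1 * (-32 * s - 96) * s := by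
    simp [coordU, seq, hT0, hQ0, hD, a0]
  have hU2 : coordU a τ.1 2 =
      ((6 * (1 - s)) * (-8) + 3 * (2 * s - 2) * (2 * s + 6)) / 10 - τ.1 * (-32 * s - 96) := by
    simp [coordU, seq, hT0, hT1, hT2, hQ0, hQ2, hD, a2]
  have hU4 : coordU a τ.1 4 = 3 * (2 * s - 2) * (-8) / 5 - τ.1 * (-32 * s - 96) := by
    simp [coordU, seq, hT2, hT3, hQ2, hD, a4]
  have hV0 : coordV a τ.2.1 τ.2.2 0 = 4 * (s - 1) * (s + 15) * (2 * s + 6) ^ 2 -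
      (τ.2.1 * coordD a ^ 2 + τ.2.2 * coordZ a) * s := by
    simp [coordV, coordQ2, seq, hE0, hQ0, a0]
  have hV2 : coordV a τ.2.1 τ.2.2 2 = 3 * (4 * (s - 1) * (s + 15)) * ((2 * s + 6) * (-8) / 3) / 5 -
      (τ.2.1 * coordD a ^ 2 + τ.2.2 * coordZ a) := by
    simp [coordV, coordQ2, seq, hE0, hE1, hQ0, hQ1, hQ2, a2]
  have hV4 : coordV a τ.2.1 τ.2.2 4 = 4 * (s - 1) * (s + 15) * 64 / 5 -
      (τ.2.1 * coordD a ^ 2 + τ.2.2 * coordZ a) := by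
    simp [coordV, coordQ2, seq, hE0, hE1, hQ2, a4]
    left; ring
  have hU1 : coordU a τ.1 1 = 0 := by simp [coordU, seq, hT1, hQ1, a1]
  have hU3 : coordU a τ.1 3 = 0 := by simp [coordU, seq, hT1, hT3, hQ1, a3]
  have hU5 : coordU a τ.1 5 = 0 := by simp [coordU, seq, hT3, a5]
  have hV1 : coordV a τ.2.1 τ.2.2 1 = 0 := by simp [coordV, coordQ2, seq, hE1, hQ1, a1]
  have hV3 : coordV a τ.2.1 τ.2.2 3 = 0 := by simp [coordV, coordQ2, seq, hE1, hQ1, a3]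
  have hV5 : coordV a τ.2.1 τ.2.2 5 = 0 := by simp [coordV, coordQ2, seq, hE1, a5]
  -- the even coordinates only involve the basis vectors `x₁x₂`, `1`, `1`
  let N : Matrix (Fin 3) (Fin 3) ℂ := !![-s / 2, -1 / 10, 3 / 10;
    coordU a τ.1 0, coordU a τ.1 2, coordU a τ.1 4;
    coordV a τ.2.1 τ.2.2 0, coordV a τ.2.1 τ.2.2 2, coordV a τ.2.1 τ.2.2 4]
  have hdet : N.det = (s - 1) * (s + 15) * trinomialPoly τ.1 τ.2.1 τ.2.2 s := by
    simp only [N, Matrix.det_fin_three, Matrix.of_apply, Matrix.cons_val, hU0, hU2, hU4, hV0, hV2,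
      hV4, hD, hZ, trinomialPoly]
    ring
  have hN : ∀ v : Fin 3 → ℂ, Matrix.vecMul v N = ![coordSigma a τ ![0, v 0, 0, v 1, v 2] 0,
      coordSigma a τ ![0, v 0, 0, v 1, v 2] 2, coordSigma a τ ![0, v 0, 0, v 1, v 2] 4] := by
    intro v
    ext j
    fin_cases j <;>
      simp [N, Matrix.vecMul, dotProduct, Fin.sum_univ_three, coordSigma, a0, a2, a4] <;>
      (left; ring)
  rw [← hdet, ← Matrix.exists_vecMul_eq_zero_iff, dependent_form_iff]
  constructor
  · rintro ⟨w, hw, h⟩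
    have e1 := h 1 (by norm_num)
    have e3 := h 3 (by norm_num)
    have e5 := h 5 (by norm_num)
    simp [coordSigma, hU1, hU3, hU5, hV1, hV3, hV5, a0, a1, a2, a3, a4, a5, a6] at e1 e3 e5
    have w2 : w 2 = 0 := e5
    have w0 : w 0 = 0 := by
      rw [w2] at e1
      linear_combination (5 / 4) * e1
    have hw' : (![0, w 1, 0, w 3, w 4] : Fin 5 → ℂ) = w := by
      ext i
      fin_cases i
      exacts [w0.symm, rfl, w2.symm, rfl, rfl]
    refine ⟨![w 1, w 3, w 4], fun hc => hw ?_, ?_⟩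
    · rw [← hw']
      have c0 := congrFun hc 0
      have c1 := congrFun hc 1
      have c2 := congrFun hc 2
      simp only [Matrix.cons_val, Pi.zero_apply] at c0 c1 c2
      rw [c0, c1, c2]
      ext i; fin_cases i <;> rfl
    · rw [hN]
      simp only [Matrix.cons_val, hw', h 0 (by norm_num), h 2 (by norm_num), h 4 (by norm_num)]
      ext i; fin_cases i <;> rfl
  · rintro ⟨v, hv, h⟩
    rw [hN] at h
    refine ⟨![0, v 0, 0, v 1, v 2], fun hc => hv ?_, fun k hk => ?_⟩
    · ext i
      fin_cases i
      exacts [congrFun hc 1, congrFun hc 3, congrFun hc 4]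
    · interval_cases k
      · exact congrFun h 0
      · simp [coordSigma, hU1, hV1, a1]
      · exact congrFun h 1
      · simp [coordSigma, hU3, hV3, a3]
      · exact congrFun h 2
      · simp [coordSigma, hU5, hV5, a5]

/-- If the quartic `trinomialPoly` has degree four and no roots other than `1` and `-15`, then the
triple is special: the multiplicities `4, 2, 3` of the root `1` give the three triples, while the
multiplicities `0` and `1` are impossible. -/
theorem eq_of_roots {α β γ q₁ q₂ q₃ q₄ : ℚ} (hγ : γ ≠ -3 / 8) (k1 : q₁ = 1 ∨ q₁ = -15)
    (k2 : q₂ = 1 ∨ q₂ = -15) (k3 : q₃ = 1 ∨ q₃ = -15) (k4 : q₄ = 1 ∨ q₄ = -15)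
    (hq : ∀ x : ℚ, (-144 / 25 - 27648 / 5 * α + 221184 / 25 * β - 203904 / 125 * γ) +
      (576 / 25 - 52224 / 5 * α + 73728 / 5 * β - 77568 / 25 * γ) * x +
      (-864 / 25 - 111616 / 25 * α + 172032 / 25 * β - 187392 / 125 * γ) * x ^ 2 +
      (576 / 25 - 13312 / 25 * α + 24576 / 25 * β - 5376 / 125 * γ) * x ^ 3 +
      (-144 / 25 - 384 / 25 * γ) * x ^ 4 =
      (-144 / 25 - 384 / 25 * γ) * ((x - q₁) * (x - q₂) * (x - q₃) * (x - q₄))) :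
    (α, β, γ) = (0, 0, 0) ∨ (α, β, γ) = (2 / 5, 14 / 75, -2 / 5) ∨
      (α, β, γ) = (1 / 6, 2 / 45, -1 / 3) := by
  have hP : ∃ i ≤ 4, ∀ x : ℚ,
      (x - q₁) * (x - q₂) * (x - q₃) * (x - q₄) = (x - 1) ^ (4 - i) * (x + 15) ^ i := by
    have step : ∀ {n : ℕ} {f : ℚ → ℚ} {q : ℚ}, (q = 1 ∨ q = -15) →
        (∃ i ≤ n, ∀ x, f x = (x - 1) ^ (n - i) * (x + 15) ^ i) →
        ∃ i ≤ n + 1, ∀ x, f x * (x - q) = (x - 1) ^ (n + 1 - i) * (x + 15) ^ i := by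
      rintro n f q (rfl | rfl) ⟨i, hi, hf⟩
      · exact ⟨i, hi.trans n.le_succ, fun x => by rw [hf, Nat.sub_add_comm hi]; ring⟩
      · exact ⟨i + 1, Nat.succ_le_succ hi, fun x => by rw [hf, Nat.add_sub_add_right]; ring⟩
    simpa using step k4 (step k3 (step k2 (step k1 (n := 0) (f := 1) ⟨0, le_rfl, by simp⟩)))
  obtain ⟨i, hi, hP⟩ := hP
  -- `i` is the multiplicity of `-15`; four values of the quartic determine the three parameters
  have v0 := hq 0
  have v1 := hq 1
  have v2 := hq (-1)
  have v3 := hq (-15)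
  rw [hP] at v0 v1 v2 v3
  clear hq hP k1 k2 k3 k4
  simp only [Prod.mk.injEq]
  interval_cases i
  · left; refine ⟨?_, ?_, ?_⟩
    · linear_combination (-25 / 6144) * v0 + (75 / 65536) * v1 + (125 / 49152) * v2
    · linear_combination (5 / 9216) * v0 + (-95 / 786432) * v1 + (35 / 73728) * v2
    · linear_combination (25 / 1536) * v0 + (-75 / 16384) * v1 + (-25 / 4096) * v2
  · right; right; refine ⟨?_, ?_, ?_⟩
    · linear_combination (175 / 55296) * v0 + (-175 / 196608) * v1 + (-25 / 147456) * v2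
    · linear_combination (205 / 82944) * v0 + (-1565 / 2359296) * v1 + (-55 / 221184) * v2
    · linear_combination (25 / 13824) * v0 + (-25 / 49152) * v1 + (-25 / 36864) * v2
  · right; left; refine ⟨?_, ?_, ?_⟩
    · linear_combination (245 / 18432) * v0 + (-245 / 65536) * v1 + (-65 / 16384) * v2
    · linear_combination (239 / 27648) * v0 + (-629 / 262144) * v1 + (-21 / 8192) * v2
    · linear_combination (-5 / 4608) * v0 + (5 / 16384) * v1 + (5 / 12288) * v2
  · refine absurd ?_ hγ
    linear_combination (-5 / 147456) * v0 + (75 / 8388608) * v1 + (25 / 2752512) * v2 +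
      (-5 / 528482304) * v3
  · refine absurd ?_ hγ
    linear_combination (5 / 1769472) * v0 + (-25 / 33554432) * v1 + (-25 / 33030144) * v2 +
      (5 / 6341787648) * v3

/-- Outside the special triples there is a trinomial quintic, possibly the degenerate one
`x₁⁵ + 5 x₁x₂⁴`, in the zero locus for which neither `ϑ₃₃` nor `ϑ₅₁` vanishes. -/
theorem special_of_locus {τ : ℚ × ℚ × ℚ}
    (h : ∀ F : MvPolynomial (Fin 2) ℂ, F.IsHomogeneous 5 → F ≠ 0 → Dependent τ F → InB F) :
    τ = (0, 0, 0) ∨ τ = (2 / 5, 14 / 75, -2 / 5) ∨ τ = (1 / 6, 2 / 45, -1 / 3) := by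
  obtain ⟨α, β, γ⟩ := τ
  -- the quartic drops in degree for `γ = -3/8`, and the degenerate trinomial takes the place of a
  -- root at infinity
  have hγ : γ ≠ -3 / 8 := by
    intro hγ
    let a := seq [1, 0, 0, 0, 1]
    refine not_inB_of_coord (a := a) ⟨2, by norm_num, ?_⟩ ⟨0, by norm_num, ?_⟩
      (h _ (form_isHomogeneous _ _) (fun h0 => ?_) ?_)
    · simp [coordT, coordQ, a, seq]
    · simp [coordE, coordQ2, coordQ, a, seq]
    · simpa [a, seq] using form_eq_zero h0 (k := 0) (by norm_num)
    · rw [dependent_form_iff]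
      refine ⟨![0, 20, 0, 0, 1], fun hc => by simpa using congrFun hc 4, fun k hk => ?_⟩
      interval_cases k <;>
        simp [coordSigma, coordV, coordE, coordD, coordZ, coordQ, coordQ2, coordQ3, coordH, seq, a,
          hγ]
      all_goals norm_num
  have hc4 : (-144 / 25 - 384 / 25 * γ : ℂ) ≠ 0 := by
    intro hc
    apply hγ
    have h0 : ((-144 / 25 - 384 / 25 * γ : ℚ) : ℂ) = 0 := by
      push_cast
      exact hc
    linarith [Rat.cast_eq_zero.mp h0]
  obtain ⟨r₁, r₂, r₃, r₄, hr⟩ := exists_roots_quartic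
    (-144 / 25 - 27648 / 5 * α + 221184 / 25 * β - 203904 / 125 * γ)
    (576 / 25 - 52224 / 5 * α + 73728 / 5 * β - 77568 / 25 * γ)
    (-864 / 25 - 111616 / 25 * α + 172032 / 25 * β - 187392 / 125 * γ)
    (576 / 25 - 13312 / 25 * α + 24576 / 25 * β - 5376 / 125 * γ) _ hc4
  have hroot : ∀ s, trinomialPoly α β γ s = 0 → s = 1 ∨ s = -15 := by
    intro s hs
    by_contra! hcon
    have h1 : s - 1 ≠ 0 := sub_ne_zero.mpr hcon.1
    have h2 : s + 15 ≠ 0 := fun hc => hcon.2 (eq_neg_of_add_eq_zero_left hc)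
    refine not_inB_of_coord (a := trinomial s) ⟨0, by norm_num, ?_⟩ ⟨0, by norm_num, ?_⟩
      (h _ (form_isHomogeneous _ _) (fun h0 => ?_) ?_)
    · rw [coordT_trinomial]
      intro hc
      apply h1
      linear_combination (-1 / 6) * hc
    · rw [coordE_trinomial]
      exact mul_ne_zero (mul_ne_zero (by norm_num) h1) h2
    · simpa [trinomial, seq] using form_eq_zero h0 (k := 2) (by norm_num)
    · rw [dependent_trinomial_iff, hs, mul_zero]
  have hrat : ∀ r, trinomialPoly α β γ r = 0 → ∃ q : ℚ, r = q ∧ (q = 1 ∨ q = -15) := by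
    intro r hr
    rcases hroot r hr with rfl | rfl
    · exact ⟨1, by norm_num, Or.inl rfl⟩
    · exact ⟨-15, by norm_num, Or.inr rfl⟩
  obtain ⟨q₁, rfl, k1⟩ := hrat r₁ ((hr r₁).trans (by ring))
  obtain ⟨q₂, rfl, k2⟩ := hrat r₂ ((hr r₂).trans (by ring))
  obtain ⟨q₃, rfl, k3⟩ := hrat r₃ ((hr r₃).trans (by ring))
  obtain ⟨q₄, rfl, k4⟩ := hrat r₄ ((hr r₄).trans (by ring))
  have hq : ∀ x : ℚ, (-144 / 25 - 27648 / 5 * α + 221184 / 25 * β - 203904 / 125 * γ) +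
      (576 / 25 - 52224 / 5 * α + 73728 / 5 * β - 77568 / 25 * γ) * x +
      (-864 / 25 - 111616 / 25 * α + 172032 / 25 * β - 187392 / 125 * γ) * x ^ 2 +
      (576 / 25 - 13312 / 25 * α + 24576 / 25 * β - 5376 / 125 * γ) * x ^ 3 +
      (-144 / 25 - 384 / 25 * γ) * x ^ 4 =
      (-144 / 25 - 384 / 25 * γ) * ((x - q₁) * (x - q₂) * (x - q₃) * (x - q₄)) := fun x => by
    apply Rat.cast_injective (α := ℂ)
    push_cast
    exact hr x
  exact eq_of_roots hγ k1 k2 k3 k4 hq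

end Trinomial

/-! ### Normal forms of binary quadratics and cubics -/

section NormalForms

/-- The linear form `u x₁ + v x₂`. -/
def lin (u v : ℂ) : MvPolynomial (Fin 2) ℂ := C u * X 0 + C v * X 1

theorem substM_lin (h : Matrix (Fin 2) (Fin 2) ℂ) (u v : ℂ) :
    substM h (lin u v) = lin (h 0 0 * u + h 0 1 * v) (h 1 0 * u + h 1 1 * v) := by
  simp only [lin, map_add, map_mul, substM_C, substM_X]
  ring

theorem lin_one_zero : lin 1 0 = X 0 := by simp [lin]

theorem lin_zero_one : lin 0 1 = X 1 := by simp [lin]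

/-- Two independent linear forms can be made the coordinates. -/
theorem exists_substM_lin {u v u' v' : ℂ} (h : u * v' - u' * v ≠ 0) :
    ∃ g : Matrix (Fin 2) (Fin 2) ℂ, g.det ≠ 0 ∧ substM g (lin u v) = X 0 ∧
      substM g (lin u' v') = X 1 := by
  set d := u * v' - u' * v with hd
  refine ⟨!![v' / d, -u' / d; -v / d, u / d], ?_, ?_, ?_⟩
  · have : v' / d * (u / d) - -u' / d * (-v / d) = d⁻¹ := by
      field_simp
      rw [hd]; ring
    rw [Matrix.det_fin_two_of, this]
    exact inv_ne_zero h
  · rw [substM_lin, ← lin_one_zero]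
    congr 1
    · simp; field_simp; rw [hd]; ring
    · simp; field_simp; ring
  · rw [substM_lin, ← lin_zero_one]
    congr 1
    · simp; field_simp; ring
    · simp; field_simp; rw [hd]; ring

theorem exists_substM_lin_eq_X {u v : ℂ} (h : u ≠ 0 ∨ v ≠ 0) :
    ∃ g : Matrix (Fin 2) (Fin 2) ℂ, g.det ≠ 0 ∧ substM g (lin u v) = X 0 := by
  rcases h with h | h
  · obtain ⟨g, h1, h2, -⟩ := exists_substM_lin (u := u) (v := v) (u' := 0) (v' := 1) (by simpa)
    exact ⟨g, h1, h2⟩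
  · obtain ⟨g, h1, h2, -⟩ := exists_substM_lin (u := u) (v := v) (u' := 1) (v' := 0) (by simpa)
    exact ⟨g, h1, h2⟩

theorem exists_mul_eq_quadratic (a b c : ℂ) : ∃ u v u' v' : ℂ,
    C a * X 0 ^ 2 + C b * X 0 * X 1 + C c * X 1 ^ 2 = lin u v * lin u' v' := by
  by_cases ha : a = 0
  · refine ⟨0, 1, b, c, ?_⟩
    simp [lin, ha]; ring
  · obtain ⟨r, hr⟩ := IsAlgClosed.exists_root (k := ℂ)
      (Polynomial.C a * Polynomial.X ^ 2 + Polynomial.C b * Polynomial.X + Polynomial.C c)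
      (by rw [Polynomial.degree_quadratic ha]; decide)
    simp only [Polynomial.IsRoot, Polynomial.eval_add, Polynomial.eval_mul, Polynomial.eval_C,
      Polynomial.eval_X, Polynomial.eval_pow] at hr
    refine ⟨1, -r, a, b + a * r, ?_⟩
    have hc : c = -(a * r ^ 2 + b * r) := by linear_combination hr
    simp only [lin, hc, map_add, map_neg, map_mul, map_pow, map_one]
    ring

theorem exists_mul_eq_cubic (a b c d : ℂ) : ∃ u v a' b' c' : ℂ,
    C a * X 0 ^ 3 + C b * X 0 ^ 2 * X 1 + C c * X 0 * X 1 ^ 2 + C d * X 1 ^ 3 =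
      (C a' * X 0 ^ 2 + C b' * X 0 * X 1 + C c' * X 1 ^ 2) * lin u v := by
  by_cases ha : a = 0
  · refine ⟨0, 1, b, c, d, ?_⟩
    simp [lin, ha]; ring
  · obtain ⟨r, hr⟩ := IsAlgClosed.exists_root (k := ℂ)
      (Polynomial.C a * Polynomial.X ^ 3 + Polynomial.C b * Polynomial.X ^ 2 +
        Polynomial.C c * Polynomial.X + Polynomial.C d)
      (by rw [Polynomial.degree_cubic ha]; decide)
    simp only [Polynomial.IsRoot, Polynomial.eval_add, Polynomial.eval_mul, Polynomial.eval_C,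
      Polynomial.eval_X, Polynomial.eval_pow] at hr
    refine ⟨1, -r, a, b + a * r, c + b * r + a * r ^ 2, ?_⟩
    have hd : d = -(a * r ^ 3 + b * r ^ 2 + c * r) := by linear_combination hr
    simp only [lin, hd, map_add, map_neg, map_mul, map_pow, map_one]
    ring

/-- A product of two linear forms becomes `x₁x₂` or a multiple of `x₁²`. -/
theorem exists_quadratic_normalForm (G : MvPolynomial (Fin 2) ℂ)
    (hG : ∃ u v u' v' : ℂ, G = lin u v * lin u' v') :
    ∃ g : Matrix (Fin 2) (Fin 2) ℂ, g.det ≠ 0 ∧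
      (substM g G = X 0 * X 1 ∨ ∃ c, substM g G = C c * X 0 ^ 2) := by
  obtain ⟨u, v, u', v', rfl⟩ := hG
  by_cases h : u * v' - u' * v = 0
  · by_cases h0 : u ≠ 0 ∨ v ≠ 0
    · obtain ⟨g, hg, h1⟩ := exists_substM_lin_eq_X h0
      -- the second factor is proportional to the first
      obtain ⟨c, hc⟩ : ∃ c, lin u' v' = C c * lin u v := by
        rcases h0 with h0 | h0
        · refine ⟨u' / u, ?_⟩
          rw [lin, lin, mul_add, ← mul_assoc, ← mul_assoc, ← C_mul, ← C_mul, div_mul_cancel₀ _ h0,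
            show u' / u * v = v' by field_simp; linear_combination -h]
        · refine ⟨v' / v, ?_⟩
          rw [lin, lin, mul_add, ← mul_assoc, ← mul_assoc, ← C_mul, ← C_mul, div_mul_cancel₀ _ h0,
            show v' / v * u = u' by field_simp; linear_combination h]
      refine ⟨g, hg, Or.inr ⟨c, ?_⟩⟩
      rw [hc, map_mul, map_mul, h1, substM_C]
      ring
    · push Not at h0
      exact ⟨1, by simp, Or.inr ⟨0, by simp [lin, h0.1, h0.2]⟩⟩
  · obtain ⟨g, hg, h1, h2⟩ := exists_substM_lin h
    exact ⟨g, hg, Or.inl (by rw [map_mul, h1, h2])⟩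

/-- Up to scalars and substitutions a binary cubic is `x₁x₂(x₁ + x₂)`, `x₁²x₂` or `x₁³`, according
to the multiplicities of its roots, or zero. -/
theorem exists_cubic_normalForm (a b c d : ℂ) :
    ∃ g : Matrix (Fin 2) (Fin 2) ℂ, g.det ≠ 0 ∧ ∃ e : ℂ,
      (substM g (C a * X 0 ^ 3 + C b * X 0 ^ 2 * X 1 + C c * X 0 * X 1 ^ 2 + C d * X 1 ^ 3) =
        C e * (X 0 ^ 2 * X 1 + X 0 * X 1 ^ 2) ∨
      substM g (C a * X 0 ^ 3 + C b * X 0 ^ 2 * X 1 + C c * X 0 * X 1 ^ 2 + C d * X 1 ^ 3) =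
        C e * (X 0 ^ 2 * X 1) ∨
      substM g (C a * X 0 ^ 3 + C b * X 0 ^ 2 * X 1 + C c * X 0 * X 1 ^ 2 + C d * X 1 ^ 3) =
        C e * X 0 ^ 3) := by
  obtain ⟨u, v, a', b', c', h⟩ := exists_mul_eq_cubic a b c d
  rw [h]
  obtain ⟨g, hg, hQ⟩ := exists_quadratic_normalForm _ (exists_mul_eq_quadratic a' b' c')
  obtain ⟨α, β, hL⟩ : ∃ α β, substM g (lin u v) = lin α β := ⟨_, _, substM_lin g u v⟩
  -- it remains to normalise the third linear factor
  suffices H : ∃ k : Matrix (Fin 2) (Fin 2) ℂ, k.det ≠ 0 ∧ ∃ e : ℂ,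
      (substM k (substM g (C a' * X 0 ^ 2 + C b' * X 0 * X 1 + C c' * X 1 ^ 2) * lin α β) =
        C e * (X 0 ^ 2 * X 1 + X 0 * X 1 ^ 2) ∨
      substM k (substM g (C a' * X 0 ^ 2 + C b' * X 0 * X 1 + C c' * X 1 ^ 2) * lin α β) =
        C e * (X 0 ^ 2 * X 1) ∨
      substM k (substM g (C a' * X 0 ^ 2 + C b' * X 0 * X 1 + C c' * X 1 ^ 2) * lin α β) =
        C e * X 0 ^ 3) by
    obtain ⟨k, hk, e, H⟩ := H
    refine ⟨k * g, by rw [Matrix.det_mul]; exact mul_ne_zero hk hg, e, ?_⟩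
    rwa [← substM_substM, map_mul, hL]
  rcases hQ with hQ | ⟨e, hQ⟩
  · rw [hQ]
    by_cases hα : α = 0
    · refine ⟨!![0, 1; 1, 0], by simp, β, Or.inr (Or.inl ?_)⟩
      simp only [lin, hα, map_mul, map_add, substM_C, substM_X]
      simp
      ring
    · by_cases hβ : β = 0
      · refine ⟨1, by simp, α, Or.inr (Or.inl ?_)⟩
        rw [substM_one, lin, hβ]
        simp
        ring
      · refine ⟨!![α⁻¹, 0; 0, β⁻¹], by simp [hα, hβ], α⁻¹ * β⁻¹, Or.inl ?_⟩
        have h1 : (C α * C α⁻¹ : MvPolynomial (Fin 2) ℂ) = 1 := by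
          rw [← C_mul, mul_inv_cancel₀ hα, C_1]
        have h2 : (C β * C β⁻¹ : MvPolynomial (Fin 2) ℂ) = 1 := by
          rw [← C_mul, mul_inv_cancel₀ hβ, C_1]
        simp only [lin, map_mul, map_add, substM_C, substM_X]
        simp
        linear_combination C α⁻¹ * C β⁻¹ * X 0 ^ 2 * X 1 * h1 + C α⁻¹ * C β⁻¹ * X 0 * X 1 ^ 2 * h2
  · rw [hQ]
    by_cases hβ : β = 0
    · refine ⟨1, by simp, e * α, Or.inr (Or.inr ?_)⟩
      rw [substM_one, lin, hβ]
      simp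
      ring
    · obtain ⟨k, hk, h1, h2⟩ :=
        exists_substM_lin (u := 1) (v := 0) (u' := α) (v' := β) (by simpa)
      rw [lin_one_zero] at h1
      refine ⟨k, hk, e, Or.inr (Or.inl ?_)⟩
      rw [map_mul, map_mul, map_pow, h1, h2, substM_C]
      ring

end NormalForms

/-! ### Degenerate quintics in `ℬ` -/

section Degenerate

variable {a : ℕ → ℂ}

/-- A quintic lies in `ℬ` if a substitution takes it to a multiple of one of the six forms. -/
theorem inB_of_coords (i : Fin 6) {c : ℂ} (hc : c ≠ 0) {h : Matrix (Fin 2) (Fin 2) ℂ}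
    (hh : h.det ≠ 0) {b : ℕ → ℂ} (hb : substM h (form 5 a) = form 5 b)
    (H : ∀ k ≤ 5, b k = c * seq (![[1, 0, 0, 0, 0, 1], [0, 1 / 5, 0, 0, -1 / 5], [0, 1 / 5, 1 / 10],
      [0, 0, 1 / 10], [0, 1 / 5], [1]] i) k) : InB (form 5 a) := by
  have hF : substM h (form 5 a) = C c * formU i := by
    rw [hb, formU_eq, form_C_mul]
    exact form_congr H
  refine InB.of_substM hh ?_
  rw [hF]
  exact InB.C_mul ⟨1, by simp, i, by rw [substM_one]⟩ (formU_isHomogeneous i) hc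

/-- Sums of two independent fifth powers lie in `ℬ`. -/
theorem inB_of_sum_powers (h0 : a 0 ≠ 0) (h5 : a 5 ≠ 0) (h1 : a 1 = 0) (h2 : a 2 = 0)
    (h3 : a 3 = 0) (h4 : a 4 = 0) : InB (form 5 a) := by
  obtain ⟨t, ht⟩ := IsAlgClosed.exists_pow_nat_eq (a 0 / a 5) (n := 5) (by norm_num)
  have ht0 : t ≠ 0 := by
    rintro rfl
    exact div_ne_zero h0 h5 (by rw [← ht]; simp)
  refine inB_of_coords 0 h0 (h := !![1, 0; 0, t]) (by simpa) (substM_diag_form _ _ _) fun k hk => ?_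
  interval_cases k <;> simp [seq, h1, h2, h3, h4, ht]
  field_simp

/-- Every quintic with a triple root lies in `ℬ`. -/
theorem inB_of_cube (h3 : a 3 = 0) (h4 : a 4 = 0) (h5 : a 5 = 0) (hF : form 5 a ≠ 0) :
    InB (form 5 a) := by
  by_cases h2 : a 2 = 0
  · by_cases h1 : a 1 = 0
    · have h0 : a 0 ≠ 0 := fun h0 => hF (by
        rw [← form_zero 5]
        exact form_congr fun k hk => by interval_cases k <;> assumption)
      refine inB_of_coords 5 h0 (h := 1) (by simp) (substM_one _) fun k hk => ?_
      interval_cases k <;> simp [seq, h1, h2, h3, h4, h5]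
    · refine inB_of_coords 4 (c := 5 * a 1) (by simpa) (h := !![1, -a 0 / (5 * a 1); 0, 1])
        (by simp) (substM_upper_form _ _) fun k hk => ?_
      interval_cases k <;> simp [sum_range_succ, Nat.choose, seq, h2, h3, h4, h5]
      · field_simp; ring
      · ring
  · -- a shear makes `x₂` a root
    obtain ⟨t, ht⟩ := IsAlgClosed.exists_root (k := ℂ)
      (Polynomial.C (10 * a 2) * Polynomial.X ^ 2 + Polynomial.C (5 * a 1) * Polynomial.X +
        Polynomial.C (a 0))
      (by rw [Polynomial.degree_quadratic (mul_ne_zero (by norm_num) h2)]; decide)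
    simp only [Polynomial.IsRoot, Polynomial.eval_add, Polynomial.eval_mul, Polynomial.eval_C,
      Polynomial.eval_X, Polynomial.eval_pow] at ht
    by_cases h1 : a 1 + 4 * t * a 2 = 0
    · refine inB_of_coords 3 (c := 10 * a 2) (by simpa) (h := !![1, t; 0, 1])
        (by simp) (substM_upper_form _ _) fun k hk => ?_
      interval_cases k <;> simp [sum_range_succ, Nat.choose, seq, h3, h4, h5]
      · linear_combination ht
      · linear_combination h1
      · ring
    · set b := a 1 + 4 * t * a 2 with hb
      have hs : b / (2 * a 2) ≠ 0 := div_ne_zero h1 (by simpa)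
      refine inB_of_coords 2 (c := 5 * b ^ 2 / (2 * a 2)) (by simp [h1, h2])
        (h := !![1, 0; 0, b / (2 * a 2)] * !![1, t; 0, 1])
        (by rw [Matrix.det_mul]; simp [h1, h2])
        (by rw [← substM_substM, substM_upper_form, substM_diag_form]) fun k hk => ?_
      interval_cases k <;> simp [sum_range_succ, Nat.choose, seq, h3, h4, h5]
      · linear_combination ht
      · rw [show a 1 + 4 * t * a 2 = b from rfl]; field_simp
      · field_simp; ring

/-- A root of the quintic can be moved to `(0 : 1)`. -/
theorem exists_substM_last_eq_zero (a : ℕ → ℂ) : ∃ (h : Matrix (Fin 2) (Fin 2) ℂ) (b : ℕ → ℂ),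
    h.det ≠ 0 ∧ substM h (form 5 a) = form 5 b ∧ b 5 = 0 := by
  by_cases h0 : a 0 = 0
  · refine ⟨!![0, 1; 1, 0], fun k => a (5 - k), by simp, ?_, by simpa⟩
    rw [form_five, form_five]
    simp only [map_add, map_mul, map_pow, map_ofNat, substM_C, substM_X]
    simp
    ring
  · obtain ⟨t, ht⟩ := IsAlgClosed.exists_root (k := ℂ)
      (Polynomial.C (a 0) * Polynomial.X ^ 5 + Polynomial.C (5 * a 1) * Polynomial.X ^ 4 +
        Polynomial.C (10 * a 2) * Polynomial.X ^ 3 + Polynomial.C (10 * a 3) * Polynomial.X ^ 2 +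
        Polynomial.C (5 * a 4) * Polynomial.X + Polynomial.C (a 5))
      (by rw [show Polynomial.degree _ = 5 by compute_degree!]; decide)
    simp only [Polynomial.IsRoot, Polynomial.eval_add, Polynomial.eval_mul, Polynomial.eval_C,
      Polynomial.eval_X, Polynomial.eval_pow] at ht
    refine ⟨_, _, by simp, substM_lower_form t a, ?_⟩
    simp [sum_range_succ, Nat.choose]
    linear_combination ht

theorem theta22_form_eq_zero {a b : ℕ → ℂ} {h : Matrix (Fin 2) (Fin 2) ℂ}
    (hQ : theta22 (form 5 a) = 0) (H : substM h (form 5 a) = form 5 b) :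
    theta22 (form 5 b) = 0 := by
  rw [← H, theta22_substM, hQ, map_zero, mul_zero]

/-- The covariant `ϑ₂₂` vanishes only at quintics with a root of multiplicity four. -/
theorem inB_of_theta22_eq_zero (hQ : theta22 (form 5 a) = 0) (hF : form 5 a ≠ 0) :
    InB (form 5 a) := by
  obtain ⟨h, b, hh, hb, b5⟩ := exists_substM_last_eq_zero a
  refine InB.of_substM hh ?_
  have hF' : form 5 b ≠ 0 := by
    rw [← hb, Ne, ← map_zero (substM h), (substM_injective hh).eq_iff]
    exact hF
  replace hQ := theta22_form_eq_zero hQ hb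
  rw [hb]
  clear hF hb hh
  have q2 : coordQ b 2 = 0 := form_eq_zero (theta22_form b ▸ hQ) le_rfl
  simp only [coordQ, seq, List.getD_cons_zero, List.getD_cons_succ, b5, mul_zero, zero_sub] at q2
  by_cases b4 : b 4 = 0
  · have b3 : b 3 = 0 := by
      rw [b4] at q2
      have : b 3 ^ 2 = 0 := by linear_combination (1 / 6) * q2
      simpa using this
    exact inB_of_cube b3 b4 b5 hF'
  · -- a shear removes the coordinate `b 3`, and then all others but `b 4`
    have hs := substM_upper_form (-b 3 / (2 * b 4)) b
    set c : ℕ → ℂ := fun k => ∑ j ∈ range (6 - k), ((5 - k).choose j : ℂ) *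
      (-b 3 / (2 * b 4)) ^ j * b (k + j) with hc
    replace hQ := theta22_form_eq_zero hQ hs
    have c5 : c 5 = 0 := by simp [hc, b5]
    have c4 : c 4 = b 4 := by simp [hc, sum_range_succ, b5]
    have c3 : c 3 = 0 := by simp [hc, sum_range_succ, b5]; field_simp; ring
    have q0 : coordQ c 0 = 0 := form_eq_zero (theta22_form c ▸ hQ) (by norm_num)
    have q1 : coordQ c 1 = 0 := form_eq_zero (theta22_form c ▸ hQ) (by norm_num)
    have q2 : coordQ c 2 = 0 := form_eq_zero (theta22_form c ▸ hQ) le_rfl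
    simp [coordQ, seq, c3, c4, c5, b4] at q0 q1 q2
    replace q0 : c 0 = 0 := by simpa [q2, b4] using q0
    refine InB.of_substM (h := !![1, -b 3 / (2 * b 4); 0, 1]) (by simp) ?_
    rw [hs]
    refine inB_of_coords 4 (c := 5 * b 4) (by simpa) (h := !![0, 1; 1, 0])
      (b := fun k => c (5 - k)) (by simp) ?_ fun k hk => ?_
    · rw [form_five, form_five]
      simp only [map_add, map_mul, map_pow, map_ofNat, substM_C, substM_X]
      simp
      ring
    · interval_cases k <;> simp [seq, c3, c4, c5, q0, q1, q2]
      ring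

end Degenerate

/-! ### The special triples: zeros of the ideal lie in `ℬ` -/

section Sufficiency

variable {τ : ℚ × ℚ × ℚ}

/-- The linear system expressing the dependence of `A x₁⁵ + B x₂⁵ + (x₁ + x₂)⁵`. By Cramer's rule it
has only the trivial solution unless `A B (A - B) (A + 1) (B + 1) = 0`. The unknown `m` collects the
multiples of the quintic itself that occur in `𝒰` and `𝒱`. -/
theorem eq_zero_of_three_powers {A B p q r l n m : ℂ} (hA : A ≠ 0) (hB : B ≠ 0) (h1 : A ≠ B)
    (h2 : A ≠ -1) (h3 : B ≠ -1)
    (e0 : p - (A + 1) / 2 * q + 4 * A ^ 2 * B * (A + 1) * n - (A + 1) * m = 0)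
    (e1 : 4 / 5 * p - 3 / 10 * q - (A + 1) / 5 * r + A * l +
      (8 * A * B * (1 + A) * (A * B + A + B) + 4 * A ^ 3 * (1 + B)) / 5 * n - m = 0)
    (e2 : 3 / 5 * p - 1 / 10 * q - 2 / 5 * r + (A * B + 2 * A + B) / 2 * l +
      (B * (1 + A) * (4 * A * B + 2 * (A * B + A + B) ^ 2) +
        4 * A ^ 2 * (1 + B) * (A * B + A + B)) / 5 * n - m = 0)
    (e3 : 2 / 5 * p + 1 / 10 * q - 3 / 5 * r + (A * B + A + 2 * B) / 2 * l +
      (4 * B ^ 2 * (1 + A) * (A * B + A + B) +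
        A * (1 + B) * (4 * A * B + 2 * (A * B + A + B) ^ 2)) / 5 * n - m = 0)
    (e4 : (B + 1) / 5 * p + 3 / 10 * q - 4 / 5 * r + B * l +
      (4 * B ^ 3 * (1 + A) + 8 * A * B * (1 + B) * (A * B + A + B)) / 5 * n - m = 0)
    (e5 : (B + 1) / 2 * q - r + 4 * B ^ 2 * A * (1 + B) * n - (B + 1) * m = 0) :
    p = 0 ∧ q = 0 ∧ r = 0 ∧ l = 0 ∧ n = 0 := by
  have hD : A ^ 3 * B ^ 3 * ((A - B) * (A + 1) * (B + 1)) ≠ 0 := by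
    refine mul_ne_zero (mul_ne_zero (pow_ne_zero _ hA) (pow_ne_zero _ hB))
      (mul_ne_zero (mul_ne_zero (sub_ne_zero.mpr h1) ?_) ?_)
    · exact fun h => h2 (eq_neg_of_add_eq_zero_left h)
    · exact fun h => h3 (eq_neg_of_add_eq_zero_left h)
  -- Cramer's rule, after the elimination of `p` and `r` by means of the first and last equations
  have hm : m = 0 := by
    have : 12 * (A ^ 3 * B ^ 3 * ((A - B) * (A + 1) * (B + 1))) * m = 0 := by
      linear_combination
        (30 * A ^ 3 * B ^ 3 + 30 * A ^ 4 * B ^ 3) * (e1 - 4 / 5 * e0 - (A + 1) / 5 * e5) +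
        ((-60) * A ^ 3 * B ^ 3 - 30 * A ^ 4 * B ^ 3 + 30 * A ^ 4 * B ^ 4) * (e2 - 3 / 5 * e0 - 2 /
          5 * e5) +
        (60 * A ^ 3 * B ^ 3 + 30 * A ^ 3 * B ^ 4 - 30 * A ^ 4 * B ^ 4) * (e3 - 2 / 5 * e0 - 3 / 5
          * e5) +
        ((-30) * A ^ 3 * B ^ 3 - 30 * A ^ 3 * B ^ 4) * (e4 - (B + 1) / 5 * e0 - 4 / 5 * e5)
    exact (mul_eq_zero.mp this).resolve_left (mul_ne_zero (by norm_num) hD)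
  subst hm
  have hn : n = 0 := by
    have : 12 * (A ^ 3 * B ^ 3 * ((A - B) * (A + 1) * (B + 1))) * n = 0 := by
      linear_combination
        (45 / 2 * A * B ^ 2 + 45 / 2 * A ^ 2 * B ^ 2 + 5 / 2 * A ^ 2 * B ^ 3 - 5 / 2 * B ^ 3) *
          (e1 - 4 / 5 * e0 - (A + 1) / 5 * e5) +
        ((-65/2) * A * B ^ 2 + 25 / 2 * A * B ^ 3 - 15 * A ^ 2 * B - 45 * A ^ 2 * B ^ 2 + 10 * A ^
          2 * B ^ 3 + 5 / 2 * A ^ 3 + 15 / 2 * A ^ 3 * B + 15 / 2 * A ^ 3 * B ^ 2 + 5 / 2 * A ^ 3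
          * B ^ 3 + 5 * B ^ 3) * (e2 - 3 / 5 * e0 - 2 / 5 * e5) +
        (15 * A * B ^ 2 - 15 / 2 * A * B ^ 3 + 65 / 2 * A ^ 2 * B + 45 * A ^ 2 * B ^ 2 - 15 / 2 *
          A ^ 2 * B ^ 3 - 5 * A ^ 3 - 25 / 2 * A ^ 3 * B - 10 * A ^ 3 * B ^ 2 - 5 / 2 * A ^ 3 * B
          ^ 3 - 5 / 2 * B ^ 3) * (e3 - 2 / 5 * e0 - 3 / 5 * e5) +
        ((-45/2) * A ^ 2 * B - 45 / 2 * A ^ 2 * B ^ 2 + 5 / 2 * A ^ 3 - 5 / 2 * A ^ 3 * B ^ 2) *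
          (e4 - (B + 1) / 5 * e0 - 4 / 5 * e5)
    exact (mul_eq_zero.mp this).resolve_left (mul_ne_zero (by norm_num) hD)
  subst hn
  have hq : q = 0 := by
    have : 12 * (A ^ 3 * B ^ 3 * ((A - B) * (A + 1) * (B + 1))) * q = 0 := by
      linear_combination
        (20 * A * B ^ 5 - 140 * A ^ 2 * B ^ 4 + 120 * A ^ 3 * B ^ 3 - 120 * A ^ 3 * B ^ 4 - 20 * A
          ^ 3 * B ^ 5 + 120 * A ^ 4 * B ^ 3 + 20 * A ^ 4 * B ^ 4) * (e1 - 4 / 5 * e0 - (A + 1) / 5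
          * e5) +
        ((-40) * A * B ^ 5 + 180 * A ^ 2 * B ^ 4 - 100 * A ^ 2 * B ^ 5 - 80 * A ^ 3 * B ^ 3 + 280
          * A ^ 3 * B ^ 4 - 80 * A ^ 3 * B ^ 5 - 80 * A ^ 4 * B ^ 2 - 240 * A ^ 4 * B ^ 3 + 20 * A
          ^ 4 * B ^ 4 - 20 * A ^ 4 * B ^ 5 + 20 * A ^ 5 * B + 60 * A ^ 5 * B ^ 2 + 60 * A ^ 5 * B
          ^ 3 + 20 * A ^ 5 * B ^ 4) * (e2 - 3 / 5 * e0 - 2 / 5 * e5) +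
        (20 * A * B ^ 5 - 80 * A ^ 2 * B ^ 4 + 60 * A ^ 2 * B ^ 5 - 80 * A ^ 3 * B ^ 3 - 240 * A ^
          3 * B ^ 4 + 60 * A ^ 3 * B ^ 5 + 180 * A ^ 4 * B ^ 2 + 280 * A ^ 4 * B ^ 3 + 20 * A ^ 4
          * B ^ 4 + 20 * A ^ 4 * B ^ 5 - 40 * A ^ 5 * B - 100 * A ^ 5 * B ^ 2 - 80 * A ^ 5 * B ^ 3
          - 20 * A ^ 5 * B ^ 4) * (e3 - 2 / 5 * e0 - 3 / 5 * e5) +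
        (120 * A ^ 3 * B ^ 3 + 120 * A ^ 3 * B ^ 4 - 140 * A ^ 4 * B ^ 2 - 120 * A ^ 4 * B ^ 3 +
          20 * A ^ 4 * B ^ 4 + 20 * A ^ 5 * B - 20 * A ^ 5 * B ^ 3) * (e4 - (B + 1) / 5 * e0 - 4 /
          5 * e5)
    exact (mul_eq_zero.mp this).resolve_left (mul_ne_zero (by norm_num) hD)
  subst hq
  have hp : p = 0 := by linear_combination e0
  have hr : r = 0 := by linear_combination -e5
  have hl : A * l = 0 := by linear_combination e1 - 4 / 5 * hp + (A + 1) / 5 * hr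
  exact ⟨hp, rfl, hr, (mul_eq_zero.mp hl).resolve_left hA, rfl⟩

/-- The quintic `A x₁⁵ + B x₂⁵ + (x₁ + x₂)⁵` is in the zero locus only if two of the numbers `A`,
`B`, `-1` agree. These are its coefficients with respect to the fifth powers of the linear forms
`x₁`, `x₂`, `-(x₁ + x₂)` with sum zero. -/
theorem not_dependent_three_powers {A B : ℂ} (hA : A ≠ 0) (hB : B ≠ 0) (h1 : A ≠ B)
    (h2 : A ≠ -1) (h3 : B ≠ -1) : ¬ Dependent τ (form 5 (seq [A + 1, 1, 1, 1, 1, B + 1])) := by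
  rw [dependent_form_iff]
  rintro ⟨w, hw, h⟩
  set a := seq [A + 1, 1, 1, 1, 1, B + 1] with ha
  have a0 : a 0 = A + 1 := rfl
  have a1 : a 1 = 1 := rfl
  have a2 : a 2 = 1 := rfl
  have a3 : a 3 = 1 := rfl
  have a4 : a 4 = 1 := rfl
  have a5 : a 5 = B + 1 := rfl
  have hQ0 : coordQ a 0 = 2 * A := by simp [coordQ, seq, ha]; ring
  have hQ1 : coordQ a 1 = A * B + A + B := by simp [coordQ, seq, ha]; ring
  have hQ2 : coordQ a 2 = 2 * B := by simp [coordQ, seq, ha]; ring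
  have hT0 : coordT a 0 = 0 := by simp [coordT, hQ0, hQ1, hQ2, a0, a1, a2]; ring
  have hT1 : coordT a 1 = -2 * A * B := by simp [coordT, hQ0, hQ1, hQ2, a3, a1, a2]; ring
  have hT2 : coordT a 2 = -2 * A * B := by simp [coordT, hQ0, hQ1, hQ2, a4, a3, a2]; ring
  have hT3 : coordT a 3 = 0 := by simp [coordT, hQ0, hQ1, hQ2, a3, a4, a5]; ring
  have hE0 : coordE a 0 = 4 * A * B * (B * (1 + A)) := by
    simp [coordE, coordQ2, seq, hQ0, hQ1, hQ2, a0, a1, a2, a3, a4]; ring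
  have hE1 : coordE a 1 = 4 * A * B * (A * (1 + B)) := by
    simp [coordE, coordQ2, seq, hQ0, hQ1, hQ2, a5, a1, a2, a3, a4]; ring
  -- the values of the two invariants do not matter
  generalize hD : coordD a = D at *
  generalize hZ : coordZ a = Z at *
  have h0 := h 0 (by norm_num)
  have h1' := h 1 (by norm_num)
  have h2' := h 2 (by norm_num)
  have h3' := h 3 (by norm_num)
  have h4' := h 4 (by norm_num)
  have h5' := h 5 (by norm_num)
  simp only [coordSigma, coordU, coordV, hD, hZ, hE0, hE1, hT0, hT1, hT2, hT3, coordQ2, hQ0, hQ1,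
    hQ2, seq, List.getD_cons_zero, List.getD_cons_succ, a0, a1, a2, a3, a4, a5, Nat.reduceAdd,
    Nat.reduceSub] at h0 h1' h2' h3' h4' h5'
  push_cast at h0 h1' h2' h3' h4' h5'
  obtain ⟨p, q, r, l, n⟩ := eq_zero_of_three_powers (p := w 0) (q := w 1) (r := w 2)
    (l := -(12 / 5) * A * B * w 3) (n := 4 * A * B * w 4)
    (m := w 3 * (τ.1 * D) + w 4 * (τ.2.1 * D ^ 2 + τ.2.2 * Z)) hA hB h1 h2 h3
    (by linear_combination h0) (by linear_combination h1') (by linear_combination h2')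
    (by linear_combination h3') (by linear_combination h4') (by linear_combination h5')
  refine hw ?_
  have w3 : w 3 = 0 := by simpa [hA, hB] using l
  have w4 : w 4 = 0 := by simpa [hA, hB] using n
  ext i
  fin_cases i
  exacts [p, q, r, w3, w4]

/-- The quintic `A x₁⁵ + 5 B x₁⁴x₂ + D x₂⁵` with `B, D ≠ 0` is not in the zero locus; for `A = 0`
this uses that `γ` is not `-3/8`. -/
theorem not_dependent_of_square {A B D : ℂ} (hγ : τ.2.2 ≠ -3 / 8) (hB : B ≠ 0) (hD : D ≠ 0) :
    ¬ Dependent τ (form 5 (seq [A, B, 0, 0, 0, D])) := by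
  rw [dependent_form_iff]
  rintro ⟨w, hw, h⟩
  set a := seq [A, B, 0, 0, 0, D] with ha
  have a0 : a 0 = A := rfl
  have a1 : a 1 = B := rfl
  have a2 : a 2 = 0 := rfl
  have a3 : a 3 = 0 := rfl
  have a4 : a 4 = 0 := rfl
  have a5 : a 5 = D := rfl
  have a6 : a 6 = 0 := rfl
  have hQ0 : coordQ a 0 = 0 := by simp [coordQ, seq, ha]
  have hQ1 : coordQ a 1 = A * D := by simp [coordQ, seq, ha]
  have hQ2 : coordQ a 2 = 2 * B * D := by simp [coordQ, seq, ha]; ring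
  have hT0 : coordT a 0 = 0 := by simp [coordT, hQ0, hQ1, hQ2, a0, a1, a2]; ring
  have hT1 : coordT a 1 = 2 * B ^ 2 * D := by simp [coordT, hQ0, hQ1, hQ2, a3, a1, a2]; ring
  have hT2 : coordT a 2 = 0 := by simp [coordT, hQ0, hQ1, hQ2, a4, a3, a2]
  have hT3 : coordT a 3 = 0 := by simp [coordT, hQ0, hQ1, hQ2, a3, a4, a5]
  have hE0 : coordE a 0 = -4 * A * B ^ 2 * D ^ 2 := by
    simp [coordE, coordQ2, seq, hQ0, hQ1, hQ2, a0, a1, a2, a3, a4]; ring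
  have hE1 : coordE a 1 = 4 * B ^ 3 * D ^ 2 := by
    simp [coordE, coordQ2, seq, hQ0, hQ1, hQ2, a5, a1, a2, a3, a4]; ring
  have h0 := h 0 (by norm_num)
  have h1 := h 1 (by norm_num)
  have h2 := h 2 (by norm_num)
  have h3 := h 3 (by norm_num)
  have h4 := h 4 (by norm_num)
  have h5 := h 5 (by norm_num)
  simp only [coordSigma, coordU, coordV, hE0, hE1, hT0, hT1, hT2, hT3, coordQ2, hQ0, hQ1,
    hQ2, seq, List.getD_cons_zero, List.getD_cons_succ, a0, a1, a2, a3, a4, a5, a6, Nat.reduceAdd,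
    Nat.reduceSub] at h0 h1 h2 h3 h4 h5
  push_cast at h0 h1 h2 h3 h4 h5
  set m := w 3 * (τ.1 * coordD a) + w 4 * (τ.2.1 * coordD a ^ 2 + τ.2.2 * coordZ a) with hm
  have w2 : w 2 = 0 := by
    have : B ^ 2 * w 2 = 0 := by linear_combination (-5 / 2) * (B * h2 - A * h3)
    simpa [hB] using this
  have hm' : m = 6 * B ^ 5 * D ^ 3 * w 4 := by
    refine mul_left_cancel₀ (mul_ne_zero hB hD) ?_
    linear_combination (-5 / 8) * D * h1 - 3 / 8 * B * h5 - A * D / 8 * w2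
  have w4 : w 4 = 0 := by
    by_cases hA : A = 0
    · subst hA
      have hD0 : coordD a = 0 := by rw [coordD, hQ0, hQ1]; ring
      have hZ : coordZ a = -16 * B ^ 5 * D ^ 3 := by
        simp [coordZ, coordQ3, coordH, seq, hQ0, hQ1, hQ2, a0, a1, a2, a3, a4, a5]; ring
      rw [hD0, hZ] at hm
      have hγ' : (8 * τ.2.2 + 3 : ℂ) ≠ 0 := by
        intro hc
        have h0 : ((8 * τ.2.2 + 3 : ℚ) : ℂ) = 0 := by
          push_cast
          exact hc
        exact hγ (by linarith [Rat.cast_eq_zero.mp h0])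
      have : B ^ 5 * D ^ 3 * (8 * τ.2.2 + 3) * w 4 = 0 := by
        linear_combination (1 / 2) * (hm - hm')
      simpa [hB, hD, hγ'] using this
    · have : A * B ^ 5 * D ^ 4 * w 4 = 0 := by
        linear_combination (-1 / 12) * (D * h0 - 5 * B * h4 + A * h5 + 2 * A * D * hm')
      simpa [hA, hB, hD] using this
  have w3 : w 3 = 0 := by
    have : B ^ 3 * D ^ 2 * w 3 = 0 := by
      linear_combination (5 / 6) * h3 + 4 / 3 * A ^ 2 * B ^ 3 * D ^ 4 * w4
    simpa [hB, hD] using this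
  have w0 : w 0 = 0 := by
    have : D * w 0 = 0 := by linear_combination 5 * h4 - 16 * A * B ^ 4 * D ^ 4 * w4
    simpa [hD] using this
  have w1 : w 1 = 0 := by
    have : D * w 1 = 0 := by
      linear_combination 2 * h5 + 2 * D * hm' - 20 * B ^ 5 * D ^ 4 * w4
    simpa [hD] using this
  refine hw ?_
  ext i
  fin_cases i
  exacts [w0, w1, w2, w3, w4]

/-- For the special triples the quartic is, up to a factor, `(s - 1)⁴`, `(s - 1)² (s + 15)²` or
`(s - 1)³ (s + 15)`. -/
theorem trinomialPoly_special (hτ : τ = (0, 0, 0) ∨ τ = (2 / 5, 14 / 75, -2 / 5) ∨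
    τ = (1 / 6, 2 / 45, -1 / 3)) {s : ℂ} (h : trinomialPoly τ.1 τ.2.1 τ.2.2 s = 0) :
    s = 1 ∨ s = -15 := by
  have : (s - 1) * (s + 15) = 0 := by
    rcases hτ with rfl | rfl | rfl <;> simp [trinomialPoly] at h
    · have h1 : (s - 1) ^ 4 = 0 := by linear_combination (-25 / 144) * h
      rw [(pow_eq_zero_iff (by norm_num)).mp h1, zero_mul]
    · have h1 : ((s - 1) * (s + 15)) ^ 2 = 0 := by linear_combination (125 / 48) * h
      exact pow_eq_zero_iff (by norm_num) |>.mp h1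
    · have h1 : ((s - 1) * (s + 15)) ^ 3 = 0 := by linear_combination (-25 / 16 * (s + 15) ^ 2) * h
      exact pow_eq_zero_iff (by norm_num) |>.mp h1
  rcases mul_eq_zero.mp this with h | h
  · exact Or.inl (sub_eq_zero.mp h)
  · exact Or.inr (eq_neg_of_add_eq_zero_left h)

/-- The trinomial with parameter `-15` is equivalent to `x₁x₂(x₁³ - x₂³)`, the second of the six
forms. -/
theorem inB_trinomial : InB (form 5 (trinomial (-15))) := by
  obtain ⟨t, ht⟩ := IsAlgClosed.exists_pow_nat_eq (-3 : ℂ) (n := 2) (by norm_num)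
  have ht0 : t ≠ 0 := by rintro rfl; norm_num at ht
  have h1 : substM !![0, t; 1, 0] (form 5 (trinomial (-15))) =
      C (15 / 2) * substM !![1, 1; 1, -1] (formU 1) := by
    have ht' : (C t ^ 2 : MvPolynomial (Fin 2) ℂ) = -3 := by rw [← C_pow, ht, map_neg, map_ofNat]
    have h15 : (C 15 : MvPolynomial (Fin 2) ℂ) = 15 := map_ofNat C 15
    have hC : (C (15 / 2) * 2 : MvPolynomial (Fin 2) ℂ) = 15 := by
      rw [← map_ofNat C, ← C_mul, ← map_ofNat C]; norm_num
    rw [form_five]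
    simp only [map_add, map_mul, map_pow, map_ofNat, substM_C, substM_X, trinomial, seq,
      List.getD_cons_zero, List.getD_cons_succ, formU]
    simp [substM_X]
    linear_combination -X 1 ^ 5 * h15 +
      (10 * X 1 ^ 3 * X 0 ^ 2 + 5 * X 1 * X 0 ^ 4 * (C t ^ 2 - 3)) * ht' -
      (X 0 ^ 2 - X 1 ^ 2) * X 1 * (3 * X 0 ^ 2 + X 1 ^ 2) * hC
  refine InB.of_substM (h := !![0, t; 1, 0]) (by simpa) ?_
  rw [h1]
  exact InB.C_mul ⟨!![1, 1; 1, -1], by norm_num [Matrix.det_fin_two_of], 1, rfl⟩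
    (substM_isHomogeneous _ (formU_isHomogeneous 1)) (by norm_num)

/-- For `A = B` the substitution `x₁ + x₂, x₁ - x₂` turns `A x₁⁵ + B x₂⁵ + (x₁ + x₂)⁵` into a
multiple of the trinomial with parameter `1 + 16 / A`. -/
theorem inB_of_symmetric (hτ : ∀ s, trinomialPoly τ.1 τ.2.1 τ.2.2 s = 0 → s = 1 ∨ s = -15) {A : ℂ}
    (hA : A ≠ 0) (h : Dependent τ (form 5 (seq [A + 1, 1, 1, 1, 1, A + 1]))) :
    InB (form 5 (seq [A + 1, 1, 1, 1, 1, A + 1])) := by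
  have hd : (!![1, 1; 1, -1] : Matrix (Fin 2) (Fin 2) ℂ).det ≠ 0 := by
    norm_num [Matrix.det_fin_two_of]
  have h2A : 2 * A ≠ 0 := mul_ne_zero two_ne_zero hA
  have e : substM !![1, 1; 1, -1] (form 5 (seq [A + 1, 1, 1, 1, 1, A + 1])) =
      C (2 * A) * form 5 (trinomial (1 + 16 / A)) := by
    have hC : (C A * C (16 / A) : MvPolynomial (Fin 2) ℂ) = 16 := by
      rw [← C_mul, mul_div_cancel₀ _ hA, map_ofNat]
    rw [form_five, form_five]
    simp only [map_add, map_mul, map_pow, map_ofNat, substM_C, substM_X, trinomial, seq,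
      List.getD_cons_zero, List.getD_cons_succ]
    simp
    linear_combination (-2 * X 0 ^ 5) * hC
  have h1 := h.substM hd
  rw [e] at h1
  have h2 := h1.C_mul ((isHomogeneous_C _ _).mul (form_isHomogeneous 5 _)) (inv_ne_zero h2A)
  rw [← mul_assoc, ← C_mul, inv_mul_cancel₀ h2A, C_1, one_mul, dependent_trinomial_iff] at h2
  have hs : 1 + 16 / A = -15 := by
    have h16 : (1 + 16 / A : ℂ) ≠ 1 := by simp [hA]
    rcases mul_eq_zero.mp h2 with h | h
    · exact eq_neg_of_add_eq_zero_left
        ((mul_eq_zero.mp h).resolve_left (sub_ne_zero.mpr h16))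
    · exact (hτ _ h).resolve_left h16
  refine InB.of_substM hd ?_
  rw [e, hs]
  exact inB_trinomial.C_mul (form_isHomogeneous 5 _) h2A

theorem form_two (g : ℕ → ℂ) :
    form 2 g = C (g 0) * X 0 ^ 2 + C (2 * g 1) * X 0 * X 1 + C (g 2) * X 1 ^ 2 := by
  simp [form, sum_range_succ, monomial_expo, Nat.choose,
    show (C 2 : MvPolynomial (Fin 2) ℂ) = 2 from map_ofNat C 2]

theorem form_three (g : ℕ → ℂ) :
    form 3 g = C (g 0) * X 0 ^ 3 + C (3 * g 1) * X 0 ^ 2 * X 1 + C (3 * g 2) * X 0 * X 1 ^ 2 +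
      C (g 3) * X 1 ^ 3 := by
  simp [form, sum_range_succ, monomial_expo, Nat.choose,
    show (C 3 : MvPolynomial (Fin 2) ℂ) = 3 from map_ofNat C 3]

/-- A quintic is apolar to its covariant `ϑ₃₃`. -/
theorem coordT_apolar (a : ℕ → ℂ) {i : ℕ} (hi : i ≤ 2) :
    coordT a 0 * a (i + 3) - 3 * coordT a 1 * a (i + 2) + 3 * coordT a 2 * a (i + 1) -
      coordT a 3 * a i = 0 := by
  interval_cases i <;> simp [coordT, coordQ, seq] <;> ring

/-- If `ϑ₃₃` vanishes, then `ϑ₂₂` is apolar to the quintic. According to whether `ϑ₂₂` has distinct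
roots, a double root or vanishes, the quintic is a sum of two fifth powers or has a root of
multiplicity three or four. -/
theorem inB_of_theta33_eq_zero {a : ℕ → ℂ} (hT : theta33 (form 5 a) = 0) (hF : form 5 a ≠ 0) :
    InB (form 5 a) := by
  obtain ⟨g, hg, hQ⟩ := exists_quadratic_normalForm (theta22 (form 5 a)) (by
    rw [theta22_form, form_two]
    exact exists_mul_eq_quadratic _ _ _)
  refine InB.of_substM hg ?_
  have hb := form_coord (substM_isHomogeneous g (form_isHomogeneous 5 a))
  set b := coord 5 (substM g (form 5 a))
  have hF' : form 5 b ≠ 0 := by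
    rw [hb, Ne, ← map_zero (substM g), (substM_injective hg).eq_iff]
    exact hF
  have hT' : theta33 (form 5 b) = 0 := by rw [hb, theta33_substM, hT, map_zero, mul_zero]
  have hQ' : theta22 (form 5 b) = C (g.det ^ 4) * substM g (theta22 (form 5 a)) := by
    rw [hb, theta22_substM]
  have hd : g.det ^ 4 ≠ 0 := pow_ne_zero _ hg
  rw [← hb]
  have t : ∀ k ≤ 3, coordT b k = 0 := fun k hk => form_eq_zero (theta33_form b ▸ hT') hk
  have t0 := t 0 (by norm_num)
  have t1 := t 1 (by norm_num)
  have t2 := t 2 (by norm_num)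
  have t3 := t 3 le_rfl
  simp only [coordT, Nat.reduceAdd] at t0 t1 t2 t3
  rcases hQ with hQ | ⟨c, hQ⟩
  · -- `ϑ₂₂` is nondegenerate, and the quintic is a sum of two fifth powers
    have q : form 2 (coordQ b) = form 2 (seq [0, g.det ^ 4 / 2, 0]) := by
      rw [← theta22_form, hQ', hQ, form_two]
      simp [seq, mul_div_cancel₀]
      ring
    have q0 : coordQ b 0 = 0 := form_injective q 0 (by norm_num)
    have q1 : coordQ b 1 = g.det ^ 4 / 2 := form_injective q 1 (by norm_num)
    have q2 : coordQ b 2 = 0 := form_injective q 2 (by norm_num)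
    have q1' : coordQ b 1 ≠ 0 := by rw [q1]; exact div_ne_zero hd two_ne_zero
    simp [q0, q2, q1'] at t0 t1 t2 t3
    have e : b 0 * b 5 ≠ 0 := by
      simpa [coordQ, seq, t0, t1, t2, t3] using q1'
    exact inB_of_sum_powers (left_ne_zero_of_mul e) (right_ne_zero_of_mul e) t0 t1 t2 t3
  · by_cases hc : c = 0
    · refine inB_of_theta22_eq_zero ?_ hF'
      rw [hQ', hQ, hc, C_0, zero_mul, mul_zero]
    · have q : form 2 (coordQ b) = form 2 (seq [g.det ^ 4 * c, 0, 0]) := by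
        rw [← theta22_form, hQ', hQ, form_two]
        simp [seq]
        ring
      have q0 : coordQ b 0 = g.det ^ 4 * c := form_injective q 0 (by norm_num)
      have q1 : coordQ b 1 = 0 := form_injective q 1 (by norm_num)
      have q2 : coordQ b 2 = 0 := form_injective q 2 (by norm_num)
      have q0' : coordQ b 0 ≠ 0 := by rw [q0]; exact mul_ne_zero hd hc
      simp [q1, q2, q0'] at t1 t2 t3
      exact inB_of_cube t1 t2 t3 hF'

/-- A quintic `A x₁⁵ + B x₂⁵ + (x₁ + x₂)⁵` in the zero locus lies in `ℬ` if `trinomialPoly` has no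
roots other than `1` and `-15`: since two of the numbers `A`, `B`, `-1` agree, a permutation of
the three linear forms leads to the case `A = B`. -/
theorem inB_of_three_powers (hτ : ∀ s, trinomialPoly τ.1 τ.2.1 τ.2.2 s = 0 → s = 1 ∨ s = -15)
    {A B : ℂ} (hA : A ≠ 0) (hB : B ≠ 0)
    (h : Dependent τ (form 5 (seq [A + 1, 1, 1, 1, 1, B + 1]))) :
    InB (form 5 (seq [A + 1, 1, 1, 1, 1, B + 1])) := by
  by_cases h1 : A = B
  · subst h1
    exact inB_of_symmetric hτ hA h
  by_cases h2 : A = -1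
  · -- exchanging `x₂` and `-(x₁ + x₂)` leads to the symmetric case
    have hd : (!![1, -1; 0, -1] : Matrix (Fin 2) (Fin 2) ℂ).det ≠ 0 := by
      norm_num [Matrix.det_fin_two_of]
    have e : substM !![1, -1; 0, -1] (form 5 (seq [A + 1, 1, 1, 1, 1, B + 1])) =
        C (-B) * form 5 (seq [B⁻¹ + 1, 1, 1, 1, 1, B⁻¹ + 1]) := by
      have hC : (C B * C B⁻¹ : MvPolynomial (Fin 2) ℂ) = 1 := by
        rw [← C_mul, mul_inv_cancel₀ hB, C_1]
      rw [form_five, form_five]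
      simp only [map_add, map_mul, map_pow, map_ofNat, substM_C, substM_X, seq,
        List.getD_cons_zero, List.getD_cons_succ, h2]
      simp
      linear_combination (X 0 ^ 5 + X 1 ^ 5) * hC
    have h3 := h.substM hd
    rw [e] at h3
    have h4 := h3.C_mul ((isHomogeneous_C _ _).mul (form_isHomogeneous 5 _))
      (inv_ne_zero (neg_ne_zero.mpr hB))
    rw [← mul_assoc, ← C_mul, inv_mul_cancel₀ (neg_ne_zero.mpr hB), C_1, one_mul] at h4
    refine InB.of_substM hd ?_
    rw [e]
    exact (inB_of_symmetric hτ (inv_ne_zero hB) h4).C_mul (form_isHomogeneous 5 _)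
      (neg_ne_zero.mpr hB)
  by_cases h3 : B = -1
  · -- likewise for `x₁` and `-(x₁ + x₂)`
    have hd : (!![-1, 0; -1, 1] : Matrix (Fin 2) (Fin 2) ℂ).det ≠ 0 := by
      norm_num [Matrix.det_fin_two_of]
    have e : substM !![-1, 0; -1, 1] (form 5 (seq [A + 1, 1, 1, 1, 1, B + 1])) =
        C (-A) * form 5 (seq [A⁻¹ + 1, 1, 1, 1, 1, A⁻¹ + 1]) := by
      have hC : (C A * C A⁻¹ : MvPolynomial (Fin 2) ℂ) = 1 := by
        rw [← C_mul, mul_inv_cancel₀ hA, C_1]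
      rw [form_five, form_five]
      simp only [map_add, map_mul, map_pow, map_ofNat, substM_C, substM_X, seq,
        List.getD_cons_zero, List.getD_cons_succ, h3]
      simp
      linear_combination (X 0 ^ 5 + X 1 ^ 5) * hC
    have h3 := h.substM hd
    rw [e] at h3
    have h4 := h3.C_mul ((isHomogeneous_C _ _).mul (form_isHomogeneous 5 _))
      (inv_ne_zero (neg_ne_zero.mpr hA))
    rw [← mul_assoc, ← C_mul, inv_mul_cancel₀ (neg_ne_zero.mpr hA), C_1, one_mul] at h4
    refine InB.of_substM hd ?_
    rw [e]
    exact (inB_of_symmetric hτ (inv_ne_zero hA) h4).C_mul (form_isHomogeneous 5 _)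
      (neg_ne_zero.mpr hA)
  exact absurd h (not_dependent_three_powers hA hB h1 h2 h3)

/-- For the special triples every quintic in the zero locus lies in `ℬ`. The quintic is apolar to
the cubic `ϑ₃₃`, so a normal form of `ϑ₃₃` yields one of the quintic: a sum of three fifth powers
for distinct roots, `A x₁⁵ + 5 B x₁⁴x₂ + D x₂⁵` for a double root, and a quintic with a triple
root for a triple root. -/
theorem inB_of_dependent (hτ : τ = (0, 0, 0) ∨ τ = (2 / 5, 14 / 75, -2 / 5) ∨
    τ = (1 / 6, 2 / 45, -1 / 3)) {F : MvPolynomial (Fin 2) ℂ} (hF : F.IsHomogeneous 5)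
    (hF0 : F ≠ 0) (h : Dependent τ F) : InB F := by
  have hγ : τ.2.2 ≠ -3 / 8 := by rcases hτ with rfl | rfl | rfl <;> norm_num
  have hP : ∀ s, trinomialPoly τ.1 τ.2.1 τ.2.2 s = 0 → s = 1 ∨ s = -15 :=
    fun s => trinomialPoly_special hτ
  by_cases hT : theta33 F = 0
  · rw [← form_coord hF] at hT hF0 ⊢
    exact inB_of_theta33_eq_zero hT hF0
  have hT3 : theta33 F = form 3 (coordT (coord 5 F)) := by rw [← theta33_form, form_coord hF]
  obtain ⟨g, hg, e, hN⟩ := exists_cubic_normalForm (coordT (coord 5 F) 0)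
    (3 * coordT (coord 5 F) 1) (3 * coordT (coord 5 F) 2) (coordT (coord 5 F) 3)
  rw [← form_three, ← hT3] at hN
  refine InB.of_substM hg ?_
  replace h := h.substM hg
  have hb := form_coord (substM_isHomogeneous g hF)
  set b := coord 5 (substM g F)
  have hF' : form 5 b ≠ 0 := by
    rw [hb, Ne, ← map_zero (substM g), (substM_injective hg).eq_iff]
    exact hF0
  have hTb : form 3 (coordT b) = C (g.det ^ 6) * substM g (theta33 F) := by
    rw [← theta33_form, hb, theta33_substM]
  have hTb0 : form 3 (coordT b) ≠ 0 := by
    rw [hTb]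
    refine mul_ne_zero (C_ne_zero.mpr (pow_ne_zero _ hg)) ?_
    rw [Ne, ← map_zero (substM g), (substM_injective hg).eq_iff]
    exact hT
  rw [← hb] at h ⊢
  clear_value b
  clear hb hT hT3 hF0 hF
  have p0 := coordT_apolar b (i := 0) (by norm_num)
  have p1 := coordT_apolar b (i := 1) (by norm_num)
  have p2 := coordT_apolar b (i := 2) (by norm_num)
  simp only [Nat.reduceAdd] at p0 p1 p2
  obtain ⟨c, t, hc⟩ : ∃ (c : ℂ) (t : ℕ → ℂ), form 3 (coordT b) = form 3 (fun k => c * t k) ∧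
      (t = seq [0, 1, 1, 0] ∨ t = seq [0, 1, 0, 0] ∨ t = seq [1, 0, 0, 0]) := by
    have h3 : (C 3⁻¹ * 3 : MvPolynomial (Fin 2) ℂ) = 1 := by
      rw [← map_ofNat C, ← C_mul]; norm_num
    rcases hN with hN | hN | hN <;> rw [hTb, hN]
    · refine ⟨g.det ^ 6 * e / 3, _, ?_, Or.inl rfl⟩
      rw [form_three]
      simp [seq, div_eq_mul_inv, show (C 3 : MvPolynomial (Fin 2) ℂ) = 3 from map_ofNat C 3]
      linear_combination (-C g.det ^ 6 * C e * (X 0 ^ 2 * X 1 + X 0 * X 1 ^ 2)) * h3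
    · refine ⟨g.det ^ 6 * e / 3, _, ?_, Or.inr (Or.inl rfl)⟩
      rw [form_three]
      simp [seq, div_eq_mul_inv, show (C 3 : MvPolynomial (Fin 2) ℂ) = 3 from map_ofNat C 3]
      linear_combination (-C g.det ^ 6 * C e * (X 0 ^ 2 * X 1)) * h3
    · refine ⟨g.det ^ 6 * e, _, ?_, Or.inr (Or.inr rfl)⟩
      rw [form_three]
      simp [seq]
      ring
  obtain ⟨hc, ht⟩ := hc
  have hc0 : c ≠ 0 := by
    rintro rfl
    refine hTb0 ?_
    rw [hc, ← form_zero 3]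
    exact form_congr fun k _ => by simp
  have t0 := form_injective hc 0 (by norm_num)
  have t1 := form_injective hc 1 (by norm_num)
  have t2 := form_injective hc 2 (by norm_num)
  have t3 := form_injective hc 3 (by norm_num)
  rcases ht with rfl | rfl | rfl <;> simp [seq] at t0 t1 t2 t3 <;>
    simp [t0, t1, t2, t3, hc0] at p0 p1 p2
  · -- three distinct roots
    have e2 : b 2 = b 1 := mul_left_cancel₀ hc0 (by linear_combination (-1 / 3) * p0)
    have e3 : b 3 = b 1 := mul_left_cancel₀ hc0 (by linear_combination (-1 / 3) * (p0 + p1))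
    have e4 : b 4 = b 1 := mul_left_cancel₀ hc0 (by linear_combination (-1 / 3) * (p0 + p1 + p2))
    rw [← t1] at hc0
    have key : coordT b 1 = -2 * b 1 * (b 0 - b 1) * (b 5 - b 1) := by
      simp [coordT, coordQ, seq, e2, e3, e4]
      ring
    rw [key] at hc0
    have h1 : b 1 ≠ 0 := right_ne_zero_of_mul (left_ne_zero_of_mul (left_ne_zero_of_mul hc0))
    have hA : (b 0 - b 1) / b 1 ≠ 0 :=
      div_ne_zero (right_ne_zero_of_mul (left_ne_zero_of_mul hc0)) h1
    have hB : (b 5 - b 1) / b 1 ≠ 0 := div_ne_zero (right_ne_zero_of_mul hc0) h1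
    have hb : form 5 b = C (b 1) * form 5 (seq [(b 0 - b 1) / b 1 + 1, 1, 1, 1, 1,
        (b 5 - b 1) / b 1 + 1]) := by
      rw [form_C_mul]
      refine form_congr fun k hk => ?_
      interval_cases k <;> simp [seq, e2, e3, e4] <;> field_simp <;> ring
    rw [hb] at h ⊢
    have h' := h.C_mul ((isHomogeneous_C _ _).mul (form_isHomogeneous 5 _)) (inv_ne_zero h1)
    rw [← mul_assoc, ← C_mul, inv_mul_cancel₀ h1, C_1, one_mul] at h'
    exact (inB_of_three_powers hP hA hB h').C_mul (form_isHomogeneous 5 _) h1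
  · -- a double root
    have hb : form 5 b = form 5 (seq [b 0, b 1, 0, 0, 0, b 5]) := form_congr fun k hk => by
      interval_cases k <;> simp [seq, p0, p1, p2]
    rw [hb] at h
    rw [← t1] at hc0
    simp [coordT, coordQ, seq, p0, p1, p2] at hc0
    exact absurd h (not_dependent_of_square hγ hc0.2 hc0.1.2)
  · exact inB_of_cube p0 p1 p2 hF'

end Sufficiency

end Quintic

end

theorem mainTheorem4 (τ : ℚ × ℚ × ℚ) :
    ((Quintic.idealB τ).height = 2 ∧ Quintic.IsPerfect (Quintic.idealB τ)) ∧
    (∃ (d₁ : Quintic.BinaryForm Quintic.R 5 →ₗ[Quintic.R] Quintic.R)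
        (d₂ : (Quintic.BinaryForm Quintic.R 2 × Quintic.BinaryForm Quintic.R 0 ×
          Quintic.BinaryForm Quintic.R 0) →ₗ[Quintic.R] Quintic.BinaryForm Quintic.R 5),
      Quintic.IsMinimalResolution (Quintic.idealB τ) d₁ d₂) ∧
    Quintic.locusB ⊆ Quintic.zeroLocus (Quintic.idealB τ) ∧
    (Quintic.locusB = Quintic.zeroLocus (Quintic.idealB τ) ↔
      τ = (0, 0, 0) ∨ τ = (2 / 5, 14 / 75, -2 / 5) ∨ τ = (1 / 6, 2 / 45, -1 / 3)) := by
  obtain ⟨f, hf, h, hh, hf0, hfh⟩ := Quintic.exists_relPrime_idealB τ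
  exact ⟨Quintic.isPerfect_of_height hf hh hf0 hfh (Quintic.height_idealB_le τ),
    ⟨Quintic.resD₁ τ, Quintic.resD₂ τ, Quintic.isMinimalResolution hf hh hf0 hfh⟩,
    Quintic.locusB_subset τ,
    (Quintic.locusB_eq_iff τ).trans ⟨Quintic.special_of_locus,
      fun hτ _ hF hF0 hd => Quintic.inB_of_dependent hτ hF hF0 hd⟩⟩
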